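/- Let $\{x\}=x-\lfloor x\rfloor$ and $\psi(x)=\tfrac12-\{x\}$. For a list $\mathfrak a=[a_1,\dots,a_n]$ of non-zero integers put $$N(\mathfrak a)=\int_0^1\Big(\sum_{j=1}^n\psi(a_jx)\Big)^2dx .$$ The list is called non-degenerate if there is no integer $a$ such that both $a$ and $-a$ occur in it. For $n\ge 1$ let $G(n)$ be the infimum of $N(\mathfrak a)$ over all non-degenerate lists $\mathfrak a$ of length $n$. For $n>d\ge 0$ let $$G(n;d)=\sup_{V_1,\dots,V_r}\ \inf\{N(\mathfrak a):\ \mathfrak a\notin V_1\cup\dots\cup V_r\},$$ where the supremum is over all finite collections of vector subspaces of $\mathbb R^n$ of dimension at most $d$, and the infimum is over all non-degenerate lists $\mathfrak a$ of length $n$, viewed as points of $\mathbb R^n$, that lie in none of these subspaces. Let $\widetilde G(n;d)$ be defined in the same way, with the infimum restricted to lists that in addition satisfy $a_1+\dots+a_n=0$, and put $\widetilde G(n)=\widetilde G(n;0)$. The infimum of the empty set is $\infty$. **Theorem.** Let $n$ and $d\ge 0$ be integers. 1. If $d\le n-1$, then $$G(n;d)=\min_{\substack{\ell_1+\dots+\ell_{d+1}=n\\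 \ell_j\ge 1}}\big(G(\ell_1)+\dots+G(\ell_{d+1})\big).$$ 2. If $d\le n-2$, then $$\widetilde G(n;d)\ \ge\ \min\Big(G(n;d+1),\ \min_{\substack{\ell_1+\dots+\ell_{d+1}=n\\ \ell_j\ge 1}}\big(\widetilde G(\ell_1)+\dots+\widetilde G(\ell_{d+1})\big)\Big).$$ 3. If $d+1\le n\le 2d+2$, then $G(n;d)=\dfrac{d+1}{12}$. 4. If $n\ge 2d+3$, then $G(n;d)\ge \dfrac d{12}+\dfrac19$. 5. If $d+2\le n\le 2d+4$, then $\widetilde G(n;d)\ge\dfrac{d+2}{12}$. 6. If $n\ge 2d+5$, then $\widetilde G(n;d)\ge\dfrac d{12}+\dfrac7{36}$. -/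

import Mathlib

open scoped ENNReal

namespace FactorialRatio

/-- The saw-tooth function `ψ(x) = 1/2 - {x}`. -/
noncomputable def sawtooth (x : ℝ) : ℝ := 1 / 2 - Int.fract x

/-- The norm `N([a₁, …, aₙ]) = ∫₀¹ (∑ⱼ ψ(aⱼ x))² dx` of a list of integers.  The integrand is bounded
and piecewise continuous, hence integrable. -/
noncomputable def listNorm {n : ℕ} (a : Fin n → ℤ) : ℝ :=
  ∫ x in (0 : ℝ)..1, (∑ j, sawtooth ((a j : ℝ) * x)) ^ 2

/-- The non-degenerate lists of length `n`: all entries are non-zero, and no integer occurs together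
with its negative. -/
def nondegLists (n : ℕ) : Set (Fin n → ℤ) :=
  {a | (∀ i, a i ≠ 0) ∧ ∀ i j, a i ≠ -a j}

/-- The non-degenerate lists of length `n` whose entries sum to `0`. -/
def zeroSumLists (n : ℕ) : Set (Fin n → ℤ) :=
  {a | a ∈ nondegLists n ∧ ∑ i, a i = 0}

/-- The infimum of the norms of the lists in `L`; it is `∞` if `L` is empty.  Norms are non-negative,
so nothing is lost by taking values in `[0, ∞]`. -/
noncomputable def infNorm {n : ℕ} (L : Set (Fin n → ℤ)) : ℝ≥0∞ :=
  ⨅ a ∈ L, ENNReal.ofReal (listNorm a)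

/-- The lists in `L` that, as points of `ℝⁿ`, lie in none of the subspaces in `𝒱`. -/
def avoiding {n : ℕ} (L : Set (Fin n → ℤ)) (𝒱 : Finset (Submodule ℝ (Fin n → ℝ))) :
    Set (Fin n → ℤ) :=
  {a | a ∈ L ∧ ∀ V ∈ 𝒱, (fun i => (a i : ℝ)) ∉ V}

/-- The supremum, over all finite collections of subspaces of `ℝⁿ` of dimension at most `d`, of the
infimum of the norms of the lists in `L` that lie in none of these subspaces. -/
noncomputable def supInfNorm {n : ℕ} (L : Set (Fin n → ℤ)) (d : ℕ) : ℝ≥0∞ :=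
  ⨆ (𝒱 : Finset (Submodule ℝ (Fin n → ℝ))) (_ : ∀ V ∈ 𝒱, Module.finrank ℝ V ≤ d),
    infNorm (avoiding L 𝒱)

/-- `G(n)`. -/
noncomputable def G (n : ℕ) : ℝ≥0∞ := infNorm (nondegLists n)

/-- `G(n; d)`. -/
noncomputable def Gd (n d : ℕ) : ℝ≥0∞ := supInfNorm (nondegLists n) d

/-- `G̃(n; d)`. -/
noncomputable def GtildeD (n d : ℕ) : ℝ≥0∞ := supInfNorm (zeroSumLists n) d

/-- `G̃(n) = G̃(n; 0)`. -/
noncomputable def Gtilde (n : ℕ) : ℝ≥0∞ := GtildeD n 0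

/-- The sums `F(ℓ₁) + … + F(ℓₖ)` over all `ℓ₁, …, ℓₖ ≥ 1` with `ℓ₁ + … + ℓₖ = n`. -/
def compositionSums (F : ℕ → ℝ≥0∞) (n k : ℕ) : Set ℝ≥0∞ :=
  {S | ∃ ℓ : Fin k → ℕ, (∀ j, 1 ≤ ℓ j) ∧ ∑ j, ℓ j = n ∧ S = ∑ j, F (ℓ j)}

/-- The minimum of `F(ℓ₁) + … + F(ℓₖ)` over all `ℓ₁, …, ℓₖ ≥ 1` with `ℓ₁ + … + ℓₖ = n`. -/
noncomputable def minCompositionSum (F : ℕ → ℝ≥0∞) (n k : ℕ) : ℝ≥0∞ :=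
  sInf (compositionSums F n k)

/-- The infimum in `minCompositionSum` is an attained minimum. -/
theorem isLeast_minCompositionSum (F : ℕ → ℝ≥0∞) {n k : ℕ} (hk : 1 ≤ k) (hkn : k ≤ n) :
    IsLeast (compositionSums F n k) (minCompositionSum F n k) := by
  have hfin : (compositionSums F n k).Finite := by
    have h : (Set.Iic (fun _ : Fin k => n)).Finite := Set.finite_Iic _
    refine (h.image (fun ℓ => ∑ j, F (ℓ j))).subset ?_
    rintro S ⟨ℓ, -, hs, rfl⟩
    refine ⟨ℓ, fun j => ?_, rfl⟩
    rw [← hs]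
    exact Finset.single_le_sum (fun i _ => Nat.zero_le (ℓ i)) (Finset.mem_univ j)
  have hne : (compositionSums F n k).Nonempty := by
    obtain ⟨m, rfl⟩ : ∃ m, k = m + 1 := ⟨k - 1, by omega⟩
    refine ⟨_, Fin.cons (n - m) (fun _ => 1), fun j => ?_, ?_, rfl⟩
    · refine Fin.cases ?_ (fun i => ?_) j
      · simp only [Fin.cons_zero]; omega
      · simp
    · simp only [Fin.sum_univ_succ, Fin.cons_zero, Fin.cons_succ, Finset.sum_const,
        Finset.card_univ, Fintype.card_fin, smul_eq_mul, mul_one]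
      omega
  exact ⟨hne.csInf_mem hfin, fun _ hS => sInf_le hS⟩

end FactorialRatio

/-!
The correlation formula `∫₀¹ ψ(a x) ψ(b x) dx = (a, b)² / (12 a b)` (`mean_sawtooth`) turns
`12 N(𝔞)` into the quadratic form `nsq`, called the norm below, the sum of
`corr a b = (a, b)² / (a b)` over all pairs of entries. The lists are treated as multisets of
integers, on which `nsq` depends only.

**Outside subspaces.** Two entries have a correlation of absolute value at least `δ` only if their
ratio has bounded height. Split a list into the components of the graph that joins such entries.
The linear relations `a j * x i = a i * x j` between joined entries cut out one of finitely many
subspaces (`finite_range_correlatedSpace`), whose dimension is at most the number of components.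
If those of dimension at most `d` are excluded, then there are at least `d + 1` components, and
the norm of the list is almost the sum of the norms of the components. Conversely, lists can be
concatenated at almost no cost after dilating them by powers of a large prime, and the result
avoids given subspaces of small dimension because the exceptional primes are roots of a non-zero
polynomial (`infNorm_avoiding_le`). Together this evaluates `G(n; d)` (`Gd_eq`). For lists with
sum zero the same subspaces are intersected with the hyperplane of sum zero. If the number of
components is exactly `d + 1`, then the intersection is not proper, hence every component has sum
zero (`min_le_GtildeD`).

**Small norms.** It remains to bound `nsq` from below: by `1` for every non-empty non-degenerate
list and by `4 / 3` from length three on, by `2` for sum zero, and by `7 / 3` for sum zero from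
length five on. For a prime `p`, multiplication by `p` divides the correlation with a list of
lower `p`-adic valuation by `p`, so that entries of different valuation are nearly orthogonal
(`nsq_ge_lower_upper`, `nsq_ge_lower_upper_succ`); this gives the first two bounds by induction,
and also, starting from direct estimates for up to four odd integers, `7 / 3` for at least four
odd integers that are not of the form `u, -3u, v, -3v`.

If the sum is zero, then `∑ ψ(a x)` takes values in `ℤ + n / 2`. For odd `n` this gives `nsq ≥ 3`
at once. For even `n`, an integer-valued function `F` satisfies
`F(x)² + F(x + 1/2)² ≥ |F(x) - F(x + 1/2)|`, and the right-hand side is half of the absolute value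
of a sum of square waves over the odd entries (`mean_abs_squareSum_le`). Testing this sum against
one square wave gives `2`, and `7 / 3` in some cases; its mean absolute value is large enough if
the odd entries are `u, -3u, v, -3v`. In the others, write a list as `A + 2B` with `A` odd. Then
its norm is an average of norms of lists with entries from `A` and `B`, some of which cancel, and
the previous bounds apply to these (`nsq_ge_of_lower_ne`, `nsq_ge_of_lower_eq`).
-/

open MeasureTheory intervalIntegral

namespace FactorialRatio

/-! ### Bounded measurable functions on the circle -/

/-- Bounded measurable functions on `ℝ`. All functions whose means over a period are taken below are
of this kind, so that integrability is never an issue. -/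
def BddMeas (f : ℝ → ℝ) : Prop := Measurable f ∧ ∃ C, ∀ x, |f x| ≤ C

namespace BddMeas

variable {f g : ℝ → ℝ}

theorem const (c : ℝ) : BddMeas fun _ => c := ⟨measurable_const, |c|, fun _ => le_rfl⟩

theorem add (hf : BddMeas f) (hg : BddMeas g) : BddMeas fun x => f x + g x := by
  obtain ⟨mf, C, hC⟩ := hf
  obtain ⟨mg, D, hD⟩ := hg
  exact ⟨mf.add mg, C + D, fun x => (abs_add_le _ _).trans (add_le_add (hC x) (hD x))⟩

theorem mul (hf : BddMeas f) (hg : BddMeas g) : BddMeas fun x => f x * g x := by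
  obtain ⟨mf, C, hC⟩ := hf
  obtain ⟨mg, D, hD⟩ := hg
  refine ⟨mf.mul mg, C * D, fun x => ?_⟩
  rw [abs_mul]
  exact mul_le_mul (hC x) (hD x) (abs_nonneg _) ((abs_nonneg _).trans (hC x))

theorem const_mul (c : ℝ) (hf : BddMeas f) : BddMeas fun x => c * f x := (const c).mul hf

theorem sub (hf : BddMeas f) (hg : BddMeas g) : BddMeas fun x => f x - g x := by
  simpa [sub_eq_add_neg] using hf.add (hg.const_mul (-1))

theorem abs (hf : BddMeas f) : BddMeas fun x => |f x| := by
  obtain ⟨mf, C, hC⟩ := hf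
  exact ⟨measurable_norm.comp mf, C, fun x => by simpa using hC x⟩

theorem sq (hf : BddMeas f) : BddMeas fun x => f x ^ 2 := by
  simpa only [pow_two] using hf.mul hf

theorem comp (hf : BddMeas f) {h : ℝ → ℝ} (hh : Measurable h) : BddMeas fun x => f (h x) := by
  obtain ⟨mf, C, hC⟩ := hf
  exact ⟨mf.comp hh, C, fun x => hC _⟩

theorem comp_mul (hf : BddMeas f) (a : ℝ) : BddMeas fun x => f (a * x) :=
  hf.comp (measurable_const_mul a)

theorem comp_add (hf : BddMeas f) (a : ℝ) : BddMeas fun x => f (x + a) :=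
  hf.comp (measurable_add_const a)

theorem multiset_sum {ι : Type*} (s : Multiset ι) {F : ι → ℝ → ℝ} (h : ∀ i, BddMeas (F i)) :
    BddMeas fun x => (s.map fun i => F i x).sum := by
  induction s using Multiset.induction_on with
  | empty => simpa using const 0
  | cons i s ih => simpa using (h i).add ih

theorem intervalIntegrable (hf : BddMeas f) (a b : ℝ) : IntervalIntegrable f volume a b := by
  obtain ⟨mf, C, hC⟩ := hf
  refine (intervalIntegrable_const (c := C)).mono_fun mf.aestronglyMeasurable ?_
  refine Filter.Eventually.of_forall fun x => ?_
  simpa using (hC x).trans (le_abs_self C)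

end BddMeas

/-- The mean of a function over `[0, 1]`. -/
noncomputable def mean (f : ℝ → ℝ) : ℝ := ∫ x in (0 : ℝ)..1, f x

section mean

variable {f g : ℝ → ℝ}

theorem mean_const (c : ℝ) : mean (fun _ => c) = c := by simp [mean]

theorem mean_add (hf : BddMeas f) (hg : BddMeas g) :
    mean (fun x => f x + g x) = mean f + mean g :=
  integral_add (hf.intervalIntegrable _ _) (hg.intervalIntegrable _ _)

theorem mean_const_mul (c : ℝ) (f : ℝ → ℝ) : mean (fun x => c * f x) = c * mean f :=
  integral_const_mul c f

theorem mean_finset_sum {ι : Type*} (s : Finset ι) {F : ι → ℝ → ℝ} (h : ∀ i, BddMeas (F i)) :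
    mean (fun x => ∑ i ∈ s, F i x) = ∑ i ∈ s, mean (F i) :=
  integral_finsetSum fun i _ => (h i).intervalIntegrable _ _

theorem mean_multiset_sum {ι : Type*} (s : Multiset ι) {F : ι → ℝ → ℝ} (h : ∀ i, BddMeas (F i)) :
    mean (fun x => (s.map fun i => F i x).sum) = (s.map fun i => mean (F i)).sum := by
  induction s using Multiset.induction_on with
  | empty => simp [mean]
  | cons i s ih =>
    simp only [Multiset.map_cons, Multiset.sum_cons]
    rw [mean_add (h i) (BddMeas.multiset_sum s h), ih]

theorem mean_mono (hf : BddMeas f) (hg : BddMeas g) (h : ∀ x, f x ≤ g x) : mean f ≤ mean g :=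
  integral_mono zero_le_one (hf.intervalIntegrable _ _) (hg.intervalIntegrable _ _) h

theorem mean_mono_ae (hf : BddMeas f) (hg : BddMeas g) (h : ∀ᵐ x, f x ≤ g x) :
    mean f ≤ mean g :=
  integral_mono_ae zero_le_one (hf.intervalIntegrable _ _) (hg.intervalIntegrable _ _) h

theorem mean_congr_ae (h : ∀ᵐ x, f x = g x) : mean f = mean g :=
  integral_congr_ae (h.mono fun _ hx _ => hx)

theorem mean_nonneg (h : ∀ x, 0 ≤ f x) : 0 ≤ mean f :=
  integral_nonneg zero_le_one fun x _ => h x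

theorem mean_comp_add (hf : Function.Periodic f 1) (t : ℝ) :
    mean (fun x => f (x + t)) = mean f := by
  have := hf.intervalIntegral_add_eq t 0
  simp only [mean, integral_comp_add_right]
  rw [zero_add, add_comm 1 t, this, zero_add]

theorem mean_comp_mul (hb : BddMeas f) (hf : Function.Periodic f 1) {k : ℤ} (hk : k ≠ 0) :
    mean (fun x => f (k * x)) = mean f := by
  have hk' : (k : ℝ) ≠ 0 := by exact_mod_cast hk
  have := hf.intervalIntegral_add_zsmul_eq k 0 hb.intervalIntegrable
  simp only [mean]
  rw [integral_comp_mul_left _ hk']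
  simp only [zero_add, zsmul_eq_mul, mul_one, smul_eq_mul] at this ⊢
  rw [mul_zero, this, inv_mul_cancel_left₀ hk']

end mean

/-! ### Correlations of dilated saw-tooth functions -/

theorem sawtooth_add_int (x : ℝ) (k : ℤ) : sawtooth (x + k) = sawtooth x := by
  simp [sawtooth]

theorem sawtooth_periodic : Function.Periodic sawtooth 1 := fun x => by
  simpa using sawtooth_add_int x 1

theorem bddMeas_sawtooth : BddMeas sawtooth := by
  refine ⟨measurable_const.sub measurable_fract, 1 / 2, fun x => ?_⟩
  rw [sawtooth, abs_le]
  constructor <;> linarith [Int.fract_nonneg x, (Int.fract_lt_one x).le]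

theorem comp_mul_periodic {f : ℝ → ℝ} (hf : Function.Periodic f 1) (k : ℤ) :
    Function.Periodic (fun x => f (k * x)) 1 := fun x => by
  have := hf.int_mul k (k * x)
  simp only [mul_one] at this
  simp only [mul_add, mul_one, this]

/-- The saw-tooth function is odd away from the integers, hence almost everywhere. -/
theorem sawtooth_neg_ae {a : ℤ} (ha : a ≠ 0) :
    ∀ᵐ x : ℝ, sawtooth ((-a : ℤ) * x) = -sawtooth (a * x) := by
  have ha' : (a : ℝ) ≠ 0 := by exact_mod_cast ha
  have hc : (Set.range fun k : ℤ => (k : ℝ) / a).Countable := Set.countable_range _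
  filter_upwards [hc.ae_notMem volume] with x hx
  have h0 : Int.fract ((a : ℝ) * x) ≠ 0 := by
    intro h
    obtain ⟨k, hk⟩ := Int.fract_eq_zero_iff.1 h
    exact hx ⟨k, by simp only [hk]; field_simp⟩
  have h1 : ((-a : ℤ) : ℝ) * x = -(a * x) := by push_cast; ring
  rw [h1, sawtooth, sawtooth, Int.fract_neg h0]
  ring

/-- The multiplication formula for the saw-tooth function (Hermite's identity). -/
theorem sum_sawtooth_add_div {m : ℕ} (hm : 0 < m) (x : ℝ) :
    ∑ j ∈ Finset.range m, sawtooth (x + j / m) = sawtooth (m * x) := by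
  have hm' : (0 : ℝ) < m := by exact_mod_cast hm
  set g : ℝ → ℝ := fun x => ∑ j ∈ Finset.range m, sawtooth (x + j / m) - sawtooth (m * x) with hg
  have hper : Function.Periodic g (1 / m) := by
    intro y
    have h1 : ∑ j ∈ Finset.range m, sawtooth (y + 1 / m + j / m) =
        ∑ j ∈ Finset.range m, sawtooth (y + j / m) := by
      have e : ∀ j : ℕ, y + 1 / m + (j : ℝ) / m = y + ((j + 1 : ℕ) : ℝ) / m := fun j => by
        push_cast; ring
      simp only [e]
      have h2 := Finset.sum_range_succ' (fun j : ℕ => sawtooth (y + j / m)) m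
      rw [Finset.sum_range_succ] at h2
      have h3 : sawtooth (y + (m : ℝ) / m) = sawtooth (y + ((0 : ℕ) : ℝ) / m) := by
        rw [div_self hm'.ne', sawtooth_periodic]; simp
      rw [h3] at h2
      exact (add_right_cancel h2).symm
    have h2 : sawtooth (m * (y + 1 / m)) = sawtooth (m * y) := by
      rw [mul_add, mul_one_div_cancel hm'.ne', sawtooth_periodic]
    simp only [hg, h1, h2]
  have key : g x = 0 := by
    rw [← hper.sub_zsmul_eq ⌊m * x⌋]
    set y := x - ⌊m * x⌋ • (1 / m : ℝ) with hy
    have hmy : m * y = Int.fract (m * x) := by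
      rw [hy, zsmul_eq_mul, mul_sub, Int.fract]; field_simp
    have hy0 : 0 ≤ y := by
      have := Int.fract_nonneg ((m : ℝ) * x)
      rw [← hmy] at this
      exact nonneg_of_mul_nonneg_right this hm'
    have hy1 : m * y < 1 := hmy ▸ Int.fract_lt_one _
    have hs : ∀ j ∈ Finset.range m, sawtooth (y + j / m) = 1 / 2 - (y + j / m) := by
      intro j hj
      have hj' : (j : ℝ) + 1 ≤ m := by exact_mod_cast Finset.mem_range.1 hj
      rw [sawtooth, Int.fract_eq_self.2 ⟨by positivity, ?_⟩]
      rw [← mul_lt_mul_iff_right₀ hm', mul_add, mul_div_cancel₀ _ hm'.ne']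
      linarith
    have hs' : sawtooth (m * y) = 1 / 2 - m * y := by
      rw [sawtooth, Int.fract_eq_self.2 ⟨by positivity, hy1⟩]
    have hsum : ∑ j ∈ Finset.range m, (j : ℝ) = m * (m - 1) / 2 := by
      clear hs hs' hy1 hy0 hmy hy hper hg hm' hm
      induction m with
      | zero => simp
      | succ k ih =>
        rw [Finset.sum_range_succ, ih]; push_cast; ring
    simp only [hg]
    rw [Finset.sum_congr rfl hs, hs', Finset.sum_sub_distrib, Finset.sum_add_distrib,
      ← Finset.sum_div (s := Finset.range m) (f := fun j : ℕ => (j : ℝ)), hsum]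
    simp only [Finset.sum_const, Finset.card_range, nsmul_eq_mul]
    field_simp
    ring
  exact sub_eq_zero.1 key

/-- Multiplication by `a` permutes the residues modulo `m` if `a` is coprime to `m`. -/
theorem sum_range_mul_of_coprime {m : ℕ} (hm : 0 < m) {a : ℤ} (ha : IsCoprime a m) {h : ℤ → ℝ}
    (hh : ∀ k, h (k + m) = h k) :
    ∑ j ∈ Finset.range m, h (a * j) = ∑ j ∈ Finset.range m, h j := by
  have hm' : (m : ℤ) ≠ 0 := by exact_mod_cast hm.ne'
  have hper : Function.Periodic h (m : ℤ) := hh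
  have hmod : ∀ k : ℤ, h (k % m) = h k := fun k => by
    rw [Int.emod_def, mul_comm]
    simpa using hper.sub_zsmul_eq (x := k) (k / m)
  set φ : ℕ → ℕ := fun j => ((a * j) % m).toNat with hφ
  have hφc : ∀ j, ((φ j : ℕ) : ℤ) = (a * j) % m := fun j =>
    Int.toNat_of_nonneg (Int.emod_nonneg _ hm')
  have hmaps : ∀ j ∈ Finset.range m, φ j ∈ Finset.range m := fun j _ => by
    have : ((φ j : ℕ) : ℤ) < m := by
      rw [hφc]; exact Int.emod_lt_of_pos _ (by exact_mod_cast hm)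
    exact Finset.mem_range.2 (by exact_mod_cast this)
  have hinj : Set.InjOn φ (Finset.range m : Set ℕ) := by
    intro i hi j hj hij
    have hi' : (i : ℤ) < m := by exact_mod_cast Finset.mem_range.1 hi
    have hj' : (j : ℤ) < m := by exact_mod_cast Finset.mem_range.1 hj
    have h1 : (a * i) % m = (a * j) % m := by rw [← hφc, ← hφc, hij]
    have h2 : (m : ℤ) ∣ a * (i - j) := by
      rw [mul_sub]; exact Int.ModEq.dvd (Int.ModEq.symm h1)
    have h3 : (m : ℤ) ∣ i - j := ha.symm.dvd_of_dvd_mul_left h2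
    have h4 : (i : ℤ) - j = 0 := by
      apply Int.eq_zero_of_abs_lt_dvd h3
      rw [abs_lt]; constructor <;> linarith [Int.natCast_nonneg i, Int.natCast_nonneg j]
    exact_mod_cast sub_eq_zero.1 h4
  have himg : (Finset.range m).image φ = Finset.range m :=
    Finset.eq_of_subset_of_card_le (Finset.image_subset_iff.2 hmaps)
      (by rw [Finset.card_image_of_injOn hinj])
  conv_rhs => rw [← himg, Finset.sum_image hinj]
  exact Finset.sum_congr rfl fun j _ => by rw [hφc, hmod]

/-- Averaging over the shifts by multiples of `1 / m`, which leave `ψ(m x)` unchanged, replaces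
`ψ(a x)` by `ψ(a m x) / m`. -/
theorem mean_sawtooth_mul_of_coprime {m : ℕ} (hm : 0 < m) {a : ℤ} (ha : IsCoprime a m) :
    mean (fun x => sawtooth (a * x) * sawtooth (m * x)) =
      mean (fun x => sawtooth (a * x) * sawtooth x) / m := by
  have hm' : (0 : ℝ) < m := by exact_mod_cast hm
  have hshift : ∀ j : ℕ, mean (fun x => sawtooth (a * x) * sawtooth (m * x)) =
      mean (fun x => sawtooth (a * x + (a * j : ℤ) / m) * sawtooth (m * x)) := by
    intro j
    have hper : Function.Periodic (fun x => sawtooth (a * x) * sawtooth (m * x)) 1 :=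
      (comp_mul_periodic sawtooth_periodic a).mul (comp_mul_periodic sawtooth_periodic m)
    rw [← mean_comp_add hper (j / m)]
    congr 1
    ext x
    have : (m : ℝ) * (x + j / m) = m * x + (j : ℤ) := by push_cast; field_simp
    rw [this, sawtooth_add_int]
    congr 2
    push_cast; ring
  have hsum : ∀ x : ℝ, ∑ j ∈ Finset.range m, sawtooth (a * x + (a * j : ℤ) / m) =
      sawtooth (a * (m * x)) := by
    intro x
    have h1 := sum_range_mul_of_coprime hm ha (h := fun k => sawtooth (a * x + k / m)) (fun k => by
      have : a * x + ((k + m : ℤ) : ℝ) / m = a * x + k / m + 1 := by push_cast; field_simp; ring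
      simp only [this, sawtooth_periodic (a * x + k / m)])
    simp only [Int.cast_natCast] at h1
    rw [h1, sum_sawtooth_add_div hm]
    congr 1; ring
  have hb : ∀ j : ℕ, BddMeas fun x =>
      sawtooth (a * x + (a * j : ℤ) / m) * sawtooth (m * x) := fun j =>
    (bddMeas_sawtooth.comp ((measurable_const_mul _).add_const _)).mul (bddMeas_sawtooth.comp_mul _)
  have htot : (m : ℝ) * mean (fun x => sawtooth (a * x) * sawtooth (m * x)) =
      mean (fun x => sawtooth (a * x) * sawtooth x) := by
    calc (m : ℝ) * mean (fun x => sawtooth (a * x) * sawtooth (m * x))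
        = ∑ j ∈ Finset.range m, mean (fun x => sawtooth (a * x) * sawtooth (m * x)) := by simp
      _ = ∑ j ∈ Finset.range m,
            mean (fun x => sawtooth (a * x + (a * j : ℤ) / m) * sawtooth (m * x)) :=
          Finset.sum_congr rfl fun j _ => hshift j
      _ = mean (fun x => ∑ j ∈ Finset.range m,
            sawtooth (a * x + (a * j : ℤ) / m) * sawtooth (m * x)) :=
          (mean_finset_sum _ hb).symm
      _ = mean (fun x => sawtooth (a * ((m : ℤ) * x)) * sawtooth ((m : ℤ) * x)) := by
          simp only [← Finset.sum_mul, hsum, Int.cast_natCast]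
      _ = _ := mean_comp_mul (f := fun x => sawtooth (a * x) * sawtooth x)
          ((bddMeas_sawtooth.comp_mul _).mul bddMeas_sawtooth)
          ((comp_mul_periodic sawtooth_periodic a).mul sawtooth_periodic)
          (by exact_mod_cast hm.ne')
  rw [← htot, mul_div_cancel_left₀ _ hm'.ne']

theorem mean_sawtooth_sq : mean (fun x => sawtooth x * sawtooth x) = 1 / 12 := by
  have h : mean (fun x => sawtooth x * sawtooth x) = ∫ x in (0 : ℝ)..1, (1 / 2 - x) ^ 2 := by
    have : ∀ᵐ x : ℝ, x ≠ 1 := by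
      simp [ae_iff, measure_singleton]
    refine integral_congr_ae (this.mono fun x hx hI => ?_)
    rw [Set.uIoc_of_le zero_le_one] at hI
    have : Int.fract x = x := Int.fract_eq_self.2 ⟨hI.1.le, lt_of_le_of_ne hI.2 hx⟩
    simp only [sawtooth, this]; ring
  rw [h, intervalIntegral.integral_comp_sub_left (fun x => x ^ 2)]
  norm_num

theorem mean_sawtooth_of_coprime {a b : ℕ} (ha : 0 < a) (hb : 0 < b) (hab : Nat.Coprime a b) :
    mean (fun x => sawtooth (a * x) * sawtooth (b * x)) = 1 / (12 * (a * b)) := by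
  have h1 := mean_sawtooth_mul_of_coprime hb (a := a) (Nat.isCoprime_iff_coprime.2 hab)
  have h2 := mean_sawtooth_mul_of_coprime ha (a := 1) isCoprime_one_left
  simp only [Int.cast_natCast, Int.cast_one, one_mul] at h1 h2
  simp only [mul_comm (sawtooth (a * _))] at h1 ⊢
  rw [h1, h2, mean_sawtooth_sq]
  have : (0 : ℝ) < a := by exact_mod_cast ha
  have : (0 : ℝ) < b := by exact_mod_cast hb
  field_simp

/-- The correlation `(a, b)² / (a b)` of two non-zero integers; it carries the sign of `a b`. -/
noncomputable def corr (a b : ℤ) : ℝ := (Int.gcd a b : ℝ) ^ 2 / (a * b)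

theorem corr_comm (a b : ℤ) : corr a b = corr b a := by
  rw [corr, corr, Int.gcd_comm, mul_comm (a : ℝ)]

theorem corr_neg_left (a b : ℤ) : corr (-a) b = -corr a b := by
  simp [corr, neg_mul, div_neg]

theorem corr_neg_right (a b : ℤ) : corr a (-b) = -corr a b := by
  simp [corr, mul_neg, div_neg]

theorem mean_sawtooth_natCast {a b : ℕ} (ha : 0 < a) (hb : 0 < b) :
    mean (fun x => sawtooth (a * x) * sawtooth (b * x)) = corr a b / 12 := by
  obtain ⟨g, a', b', hg, hab, rfl, rfl⟩ := Nat.exists_coprime' (Nat.gcd_pos_of_pos_left b ha)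
  have ha' : 0 < a' := pos_of_mul_pos_left ha (Nat.zero_le _)
  have hb' : 0 < b' := pos_of_mul_pos_left hb (Nat.zero_le _)
  have h1 := mean_comp_mul (f := fun x => sawtooth (a' * x) * sawtooth (b' * x)) (k := g)
    ((bddMeas_sawtooth.comp_mul _).mul (bddMeas_sawtooth.comp_mul _))
    ((comp_mul_periodic sawtooth_periodic a').mul (comp_mul_periodic sawtooth_periodic b'))
    (by exact_mod_cast hg.ne')
  rw [mean_sawtooth_of_coprime ha' hb' hab] at h1
  simp only [Int.cast_natCast, ← mul_assoc] at h1
  push_cast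
  rw [h1]
  have hgcd : Int.gcd ((a' * g : ℕ) : ℤ) ((b' * g : ℕ) : ℤ) = g := by
    rw [Int.gcd_natCast_natCast, Nat.gcd_mul_right, hab.gcd_eq_one, one_mul]
  have hg' : (0 : ℝ) < g := by exact_mod_cast hg
  have : (0 : ℝ) < a' := by exact_mod_cast ha'
  have : (0 : ℝ) < b' := by exact_mod_cast hb'
  push_cast at hgcd
  rw [corr, hgcd]
  push_cast
  field_simp

/-- The correlation formula `∫₀¹ ψ(a x) ψ(b x) dx = (a, b)² / (12 a b)`. -/
theorem mean_sawtooth {a b : ℤ} (ha : a ≠ 0) (hb : b ≠ 0) :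
    mean (fun x => sawtooth (a * x) * sawtooth (b * x)) = corr a b / 12 := by
  have aux : ∀ (a : ℕ), 0 < a → ∀ b : ℤ, b ≠ 0 →
      mean (fun x => sawtooth (a * x) * sawtooth (b * x)) = corr a b / 12 := by
    intro a ha b hb
    obtain ⟨n, rfl | rfl⟩ := b.eq_nat_or_neg
    · simpa using mean_sawtooth_natCast ha (by omega)
    · have hn : 0 < n := by omega
      have h := mean_sawtooth_natCast ha hn
      rw [corr_neg_right, neg_div, ← h, ← neg_one_mul (mean _), ← mean_const_mul]
      refine mean_congr_ae ((sawtooth_neg_ae (a := n) (by omega)).mono fun x hx => ?_)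
      rw [hx]; push_cast; ring
  obtain ⟨n, rfl | rfl⟩ := a.eq_nat_or_neg
  · simpa using aux n (by omega) b hb
  · have h := aux n (by omega) b hb
    rw [corr_neg_left, neg_div, ← h, ← neg_one_mul (mean _), ← mean_const_mul]
    refine mean_congr_ae ((sawtooth_neg_ae (a := n) (by omega)).mono fun x hx => ?_)
    rw [hx]; push_cast; ring

/-! ### The quadratic form on lists of integers -/

/-- The bilinear form `∑ (a, b)² / (a b)`, over `a` in `M` and `b` in `N`. Lists are encoded as
multisets of integers; an entry with its sign reversed contributes with the opposite sign. -/
noncomputable def form (M N : Multiset ℤ) : ℝ :=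
  (M.map fun a => (N.map fun b => corr a b).sum).sum

/-- The quadratic form `∑ (a, b)² / (a b)`, over `a` and `b` in `M`; it is `12 N(M)`. -/
noncomputable def nsq (M : Multiset ℤ) : ℝ := form M M

/-- The function `∑ ψ(a x)`, over `a` in `M`. -/
noncomputable def wave (M : Multiset ℤ) (x : ℝ) : ℝ := (M.map fun a : ℤ => sawtooth (a * x)).sum

variable {M N K : Multiset ℤ}

@[simp] theorem form_zero_left (N : Multiset ℤ) : form 0 N = 0 := by simp [form]

@[simp] theorem form_zero_right (M : Multiset ℤ) : form M 0 = 0 := by simp [form]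

theorem form_add_left (M M' N : Multiset ℤ) : form (M + M') N = form M N + form M' N := by
  simp [form]

theorem form_add_right (M N N' : Multiset ℤ) : form M (N + N') = form M N + form M N' := by
  simp [form, Multiset.sum_map_add]

theorem form_comm (M N : Multiset ℤ) : form M N = form N M := by
  induction M using Multiset.induction_on with
  | empty => simp
  | cons a M ih =>
    rw [← Multiset.singleton_add, form_add_left, form_add_right, ih]
    simp [form, corr_comm a]

theorem form_cons_left (a : ℤ) (M N : Multiset ℤ) :
    form (a ::ₘ M) N = form {a} N + form M N := by
  rw [← Multiset.singleton_add, form_add_left]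

@[simp] theorem form_singleton (a b : ℤ) : form {a} {b} = corr a b := by simp [form]

theorem form_nsmul_left (k : ℕ) (M N : Multiset ℤ) : form (k • M) N = k * form M N := by
  induction k with
  | zero => simp
  | succ k ih => rw [succ_nsmul, form_add_left, ih]; push_cast; ring

theorem form_nsmul_right (k : ℕ) (M N : Multiset ℤ) : form M (k • N) = k * form M N := by
  rw [form_comm, form_nsmul_left, form_comm]

theorem form_neg_left (M N : Multiset ℤ) : form (M.map Neg.neg) N = -form M N := by
  induction M using Multiset.induction_on with
  | empty => simp
  | cons a M ih =>
    rw [Multiset.map_cons, form_cons_left, form_cons_left, ih]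
    simp [form, corr_neg_left, Multiset.sum_map_neg]
    ring

theorem nsq_add (M N : Multiset ℤ) : nsq (M + N) = nsq M + 2 * form M N + nsq N := by
  simp only [nsq, form_add_left, form_add_right]
  rw [form_comm N M]; ring

@[simp] theorem nsq_zero : nsq 0 = 0 := form_zero_left 0

theorem corr_self {a : ℤ} (ha : a ≠ 0) : corr a a = 1 := by
  have ha' : (a : ℝ) ≠ 0 := by exact_mod_cast ha
  have h : ((a.natAbs : ℕ) : ℝ) ^ 2 = (a : ℝ) * a := by
    rw [← pow_two, Nat.cast_natAbs, Int.cast_abs, sq_abs]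
  rw [corr, Int.gcd_self, h, div_self (mul_ne_zero ha' ha')]

theorem nsq_singleton {a : ℤ} (ha : a ≠ 0) : nsq {a} = 1 := by
  rw [nsq, form_singleton, corr_self ha]

theorem corr_mul_mul {k : ℤ} (hk : k ≠ 0) (a b : ℤ) : corr (k * a) (k * b) = corr a b := by
  have hk' : (k : ℝ) ≠ 0 := by exact_mod_cast hk
  have h : ((k.natAbs : ℕ) : ℝ) ^ 2 = (k : ℝ) ^ 2 := by
    rw [Nat.cast_natAbs, Int.cast_abs, sq_abs]
  rw [corr, corr, Int.gcd_mul_left]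
  push_cast
  rw [mul_pow, h]
  rw [show (k : ℝ) * a * (k * b) = k ^ 2 * (a * b) by ring,
    mul_div_mul_left _ _ (pow_ne_zero 2 hk')]

theorem form_map_mul {k : ℤ} (hk : k ≠ 0) (M N : Multiset ℤ) :
    form (M.map (k * ·)) (N.map (k * ·)) = form M N := by
  simp [form, corr_mul_mul hk]

theorem nsq_map_mul {k : ℤ} (hk : k ≠ 0) (M : Multiset ℤ) : nsq (M.map (k * ·)) = nsq M :=
  form_map_mul hk M M

theorem bddMeas_wave (M : Multiset ℤ) : BddMeas (wave M) :=
  BddMeas.multiset_sum M fun a => bddMeas_sawtooth.comp_mul (a : ℝ)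

theorem wave_cons (a : ℤ) (M : Multiset ℤ) (x : ℝ) :
    wave (a ::ₘ M) x = sawtooth (a * x) + wave M x := by
  simp [wave]

theorem wave_periodic (M : Multiset ℤ) : Function.Periodic (wave M) 1 := fun x => by
  simp only [wave]
  congr 1
  exact Multiset.map_congr rfl fun a _ => comp_mul_periodic sawtooth_periodic a x

theorem form_eq_mean (hM : 0 ∉ M) (hN : 0 ∉ N) :
    form M N = 12 * mean fun x => wave M x * wave N x := by
  have hs : ∀ a : ℤ, BddMeas fun x => sawtooth (a * x) := fun a =>
    bddMeas_sawtooth.comp_mul (a : ℝ)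
  have h1 : ∀ x, wave M x * wave N x = (M.map fun a : ℤ =>
      (N.map fun b : ℤ => sawtooth (a * x) * sawtooth (b * x)).sum).sum := by
    intro x
    simp only [Multiset.sum_map_mul_left, Multiset.sum_map_mul_right, wave]
  simp only [h1]
  rw [mean_multiset_sum (F := fun (a : ℤ) x =>
    (N.map fun b : ℤ => sawtooth (a * x) * sawtooth (b * x)).sum) M
    (fun a => BddMeas.multiset_sum N fun b => (hs a).mul (hs b)), form,
    ← Multiset.sum_map_mul_left]
  congr 1
  refine Multiset.map_congr rfl fun a ha => ?_
  rw [mean_multiset_sum (F := fun (b : ℤ) x => sawtooth (a * x) * sawtooth (b * x)) N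
    (fun b => (hs a).mul (hs b)), ← Multiset.sum_map_mul_left]
  congr 1
  refine Multiset.map_congr rfl fun b hb => ?_
  rw [mean_sawtooth (fun h => hM (h ▸ ha)) (fun h => hN (h ▸ hb))]
  ring

theorem nsq_eq_mean (hM : 0 ∉ M) : nsq M = 12 * mean fun x => wave M x ^ 2 := by
  simp only [pow_two]; exact form_eq_mean hM hM

theorem listNorm_eq {n : ℕ} (a : Fin n → ℤ) (ha : ∀ i, a i ≠ 0) :
    listNorm a = nsq (Finset.univ.val.map a) / 12 := by
  have h : (0 : ℤ) ∉ Finset.univ.val.map a := by simpa using ha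
  have hw : ∀ x, wave (Finset.univ.val.map a) x = ∑ j, sawtooth ((a j : ℝ) * x) := fun x => by
    rw [wave, Multiset.map_map]; rfl
  rw [nsq_eq_mean h, mul_div_cancel_left₀ _ (by norm_num : (12 : ℝ) ≠ 0)]
  simp only [hw, listNorm, mean]

theorem nsq_nonneg (hM : 0 ∉ M) : 0 ≤ nsq M := by
  rw [nsq_eq_mean hM]
  exact mul_nonneg (by norm_num) (mean_nonneg fun x => sq_nonneg _)

/-- The Cauchy–Schwarz inequality for `form`. -/
theorem form_sq_le (hM : 0 ∉ M) (hN : 0 ∉ N) : form M N ^ 2 ≤ nsq M * nsq N := by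
  have h : ∀ t : ℝ, 0 ≤ nsq N * (t * t) + 2 * form M N * t + nsq M := by
    intro t
    have h0 : 0 ≤ mean fun x => wave M x * wave M x +
        (2 * t * (wave M x * wave N x) + t * t * (wave N x * wave N x)) :=
      mean_nonneg fun x => by nlinarith [sq_nonneg (wave M x + t * wave N x)]
    have bM := bddMeas_wave M
    have bN := bddMeas_wave N
    rw [mean_add (bM.mul bM) (((bM.mul bN).const_mul _).add ((bN.mul bN).const_mul _)),
      mean_add ((bM.mul bN).const_mul _) ((bN.mul bN).const_mul _), mean_const_mul,
      mean_const_mul] at h0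
    rw [nsq, nsq, form_eq_mean hM hM, form_eq_mean hM hN, form_eq_mean hN hN]
    linarith
  have := discrim_le_zero h
  rw [discrim] at this
  linarith

/-! ### Splitting a list by divisibility by powers of a prime -/

theorem corr_prime_mul {p : ℕ} (hp : p.Prime) {k : ℕ} {a b : ℤ} (ha : ¬ (p : ℤ) ^ (k + 1) ∣ a)
    (hb : (p : ℤ) ^ k ∣ b) : corr a (p * b) = corr a b / p := by
  have ha0 : a.natAbs ≠ 0 := by
    rintro h; exact ha (by rw [Int.natAbs_eq_zero.1 h]; exact dvd_zero _)
  have hgcd : Int.gcd a (p * b) = Int.gcd a b := by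
    obtain ⟨j, a', hpa, ha'⟩ := Nat.exists_eq_pow_mul_and_not_dvd ha0 p hp.ne_one
    have hj : j ≤ k := by
      by_contra h
      exact ha (Int.natCast_dvd.2 (by
        rw [ha']; exact_mod_cast (pow_dvd_pow p (by omega)).mul_right a'))
    have hb' : p ^ j ∣ b.natAbs :=
      (pow_dvd_pow p hj).trans (Int.natCast_dvd.1 (by exact_mod_cast hb))
    obtain ⟨b', hb'⟩ := hb'
    rw [Int.gcd_def, Int.gcd_def, Int.natAbs_mul, Int.natAbs_natCast, ha', hb',
      show p * (p ^ j * b') = p ^ j * (p * b') by ring, Nat.gcd_mul_left, Nat.gcd_mul_left]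
    congr 1
    exact Nat.Coprime.gcd_mul_left_cancel_right b'
      ((Nat.Prime.coprime_iff_not_dvd hp).2 hpa)
  have : (p : ℝ) ≠ 0 := by exact_mod_cast hp.ne_zero
  rw [corr, corr, hgcd]
  push_cast
  rw [div_div]
  congr 1; ring

theorem form_map_prime {p : ℕ} (hp : p.Prime) {k : ℕ} (hM : ∀ a ∈ M, ¬ (p : ℤ) ^ (k + 1) ∣ a)
    (hN : ∀ b ∈ N, (p : ℤ) ^ k ∣ b) : form M (N.map ((p : ℤ) * ·)) = form M N / p := by
  rw [form, form, ← Multiset.sum_map_div]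
  congr 1
  refine Multiset.map_congr rfl fun a ha => ?_
  rw [Multiset.map_map, ← Multiset.sum_map_div]
  congr 1
  exact Multiset.map_congr rfl fun b hb => corr_prime_mul hp (hM a ha) (hN b hb)

/-- The entries of `M` that are divisible by `p ^ (k + 1)`. -/
def upper (p k : ℕ) (M : Multiset ℤ) : Multiset ℤ := M.filter fun a => (p : ℤ) ^ (k + 1) ∣ a

/-- The entries of `M` that are not divisible by `p ^ (k + 1)`. -/
def lower (p k : ℕ) (M : Multiset ℤ) : Multiset ℤ := M.filter fun a => ¬ (p : ℤ) ^ (k + 1) ∣ a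

theorem lower_add_upper (p k : ℕ) (M : Multiset ℤ) : lower p k M + upper p k M = M := by
  rw [add_comm]; exact Multiset.filter_add_not _ _

theorem lower_le (p k : ℕ) (M : Multiset ℤ) : lower p k M ≤ M := Multiset.filter_le _ _

theorem upper_le (p k : ℕ) (M : Multiset ℤ) : upper p k M ≤ M := Multiset.filter_le _ _

theorem mem_upper {p k : ℕ} {a : ℤ} : a ∈ upper p k M ↔ a ∈ M ∧ (p : ℤ) ^ (k + 1) ∣ a :=
  Multiset.mem_filter

theorem mem_lower {p k : ℕ} {a : ℤ} : a ∈ lower p k M ↔ a ∈ M ∧ ¬ (p : ℤ) ^ (k + 1) ∣ a :=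
  Multiset.mem_filter

/-- A list all of whose entries are divisible by `p ^ (k + 1)` is `p` times a list all of whose
entries are divisible by `p ^ k`. -/
theorem exists_eq_map_mul {p : ℕ} (hp : p.Prime) {k : ℕ} (hM : ∀ a ∈ M, (p : ℤ) ^ (k + 1) ∣ a) :
    ∃ N : Multiset ℤ, M = N.map ((p : ℤ) * ·) ∧ ∀ b ∈ N, (p : ℤ) ^ k ∣ b := by
  have hp0 : (p : ℤ) ≠ 0 := by exact_mod_cast hp.ne_zero
  refine ⟨M.map (· / (p : ℤ)), ?_, ?_⟩
  · rw [Multiset.map_map]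
    conv_lhs => rw [← Multiset.map_id M]
    refine Multiset.map_congr rfl fun a ha => ?_
    exact (Int.mul_ediv_cancel' ((dvd_pow_self _ k.succ_ne_zero).trans (hM a ha))).symm
  · intro b hb
    obtain ⟨a, ha, rfl⟩ := Multiset.mem_map.1 hb
    obtain ⟨c, rfl⟩ := hM a ha
    rw [pow_succ', mul_assoc, Int.mul_ediv_cancel_left _ hp0]
    exact dvd_mul_right _ _

theorem zero_notMem_of_map_mul {k : ℤ} (h : 0 ∉ N.map (k * ·)) : 0 ∉ N := fun h0 =>
  h (Multiset.mem_map.2 ⟨0, h0, mul_zero k⟩)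

/-- If the entries of a list are divisible by `p ^ k`, then the part of the entries not divisible by
`p ^ (k + 1)` and the part of the remaining entries enclose an angle with cosine at most `1 / p`;
the parameter `t` balances their contributions. -/
theorem nsq_ge_lower_upper {p : ℕ} (hp : p.Prime) {k : ℕ} (h0 : 0 ∉ M) {t : ℝ} (ht : 0 < t) :
    (1 - t / p) * nsq (lower p k M) + (1 - 1 / (t * p)) * nsq (upper p k M) ≤ nsq M := by
  have hp' : (0 : ℝ) < p := by exact_mod_cast hp.pos
  obtain ⟨N, hN, hk⟩ := exists_eq_map_mul hp (M := upper p k M) (k := k)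
    fun a ha => (mem_upper.1 ha).2
  set A := lower p k M with hA
  have hA0 : 0 ∉ A := fun h => h0 (Multiset.mem_of_le (lower_le p k M) h)
  have hU0 : 0 ∉ upper p k M := fun h => h0 (Multiset.mem_of_le (upper_le p k M) h)
  have hN0 : 0 ∉ N := by rw [hN] at hU0; exact zero_notMem_of_map_mul hU0
  have hnsq : nsq (upper p k M) = nsq N := by
    rw [hN, nsq_map_mul (by exact_mod_cast hp.ne_zero)]
  have hform : form A (upper p k M) = form A N / p := by
    rw [hN]; exact form_map_prime hp (fun a ha => (mem_lower.1 ha).2) hk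
  have hM : nsq M = nsq A + 2 * (form A N / p) + nsq N := by
    conv_lhs => rw [← lower_add_upper p k M]
    rw [nsq_add, hform, hnsq]
  have hcs := form_sq_le hA0 hN0
  have hA1 := nsq_nonneg hA0
  have hN1 := nsq_nonneg hN0
  have h1 : -(2 * form A N) ≤ t * nsq A + nsq N / t := by
    have hs : 0 ≤ t * nsq A + nsq N / t := by positivity
    have hsq : (-(2 * form A N)) ^ 2 ≤ (t * nsq A + nsq N / t) ^ 2 := by
      have e : t * nsq A * (nsq N / t) = nsq A * nsq N := by field_simp
      nlinarith [sq_nonneg (t * nsq A - nsq N / t)]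
    exact abs_le_of_sq_le_sq' hsq hs |>.2
  rw [hM, hnsq]
  have h2 : (t * nsq A + nsq N / t) / p = t / p * nsq A + 1 / (t * p) * nsq N := by
    field_simp
  have h3 := div_le_div_of_nonneg_right h1 hp'.le
  rw [h2] at h3
  have h4 : -(2 * form A N) / p = -(2 * (form A N / p)) := by ring
  rw [h4] at h3
  nlinarith

/-- With three levels of divisibility by `p`, the lowest level and the levels above the second one
can be treated as if they were almost orthogonal. -/
theorem nsq_ge_lower_upper_succ {p : ℕ} (hp : p.Prime) {k : ℕ} (h0 : 0 ∉ M) :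
    (1 - 1 / (p : ℝ) ^ 2) * (nsq (lower p k M) + nsq (upper p (k + 1) M)) ≤ nsq M := by
  have hp' : (0 : ℝ) < p := by exact_mod_cast hp.pos
  have hpz : (p : ℤ) ≠ 0 := by exact_mod_cast hp.ne_zero
  -- The middle level consists of the entries divisible by `p ^ (k + 1)` but not by `p ^ (k + 2)`.
  set C := lower p (k + 1) (upper p k M) with hC
  have hmid : C + upper p (k + 1) M = upper p k M := by
    have : upper p (k + 1) (upper p k M) = upper p (k + 1) M := by
      rw [upper, upper, upper, Multiset.filter_filter]
      refine Multiset.filter_congr fun a _ => ⟨fun h => h.1, fun h => ⟨h, ?_⟩⟩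
      exact (pow_dvd_pow _ (by omega)).trans h
    rw [← this]; exact lower_add_upper _ _ _
  obtain ⟨H, hH, hHk⟩ := exists_eq_map_mul hp (M := C) (k := k)
    fun a ha => (mem_upper.1 (mem_lower.1 ha).1).2
  obtain ⟨J', hJ', hJk'⟩ := exists_eq_map_mul hp (M := upper p (k + 1) M) (k := k + 1)
    fun a ha => (mem_upper.1 ha).2
  obtain ⟨J, hJ, hJk⟩ := exists_eq_map_mul hp hJk'
  have hHn : ∀ b ∈ H, ¬ (p : ℤ) ^ (k + 1) ∣ b := by
    intro b hb hd
    have : (p : ℤ) * b ∈ C := by rw [hH]; exact Multiset.mem_map_of_mem _ hb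
    refine (mem_lower.1 this).2 ?_
    rw [pow_succ']; exact mul_dvd_mul_left _ hd
  set A := lower p k M with hA
  have hAn : ∀ a ∈ A, ¬ (p : ℤ) ^ (k + 1) ∣ a := fun a ha => (mem_lower.1 ha).2
  have hA0 : 0 ∉ A := fun h => h0 (Multiset.mem_of_le (lower_le p k M) h)
  have hC0 : 0 ∉ C := fun h => h0
    (Multiset.mem_of_le ((lower_le _ _ _).trans (upper_le p k M)) h)
  have hH0 : 0 ∉ H := by rw [hH] at hC0; exact zero_notMem_of_map_mul hC0
  have hU0 : 0 ∉ upper p (k + 1) M := fun h => h0 (Multiset.mem_of_le (upper_le _ _ _) h)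
  have hJ0 : 0 ∉ J := by
    rw [hJ', hJ] at hU0; exact zero_notMem_of_map_mul (zero_notMem_of_map_mul hU0)
  have e1 : form A C = form A H / p := by rw [hH]; exact form_map_prime hp hAn hHk
  have e2 : form A (upper p (k + 1) M) = form A J / p / p := by
    rw [hJ', form_map_prime hp hAn fun b hb => (pow_dvd_pow _ k.le_succ).trans (hJk' b hb), hJ,
      form_map_prime hp hAn hJk]
  have e3 : form C (upper p (k + 1) M) = form H J / p := by
    rw [hH, hJ', form_map_mul hpz, hJ, form_map_prime hp hHn hJk]
  have e4 : nsq C = nsq H := by rw [hH, nsq_map_mul hpz]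
  have e5 : nsq (upper p (k + 1) M) = nsq J := by
    rw [hJ', nsq_map_mul hpz, hJ, nsq_map_mul hpz]
  have hM : nsq M = nsq A + nsq H + nsq J + 2 * (form A H / p) + 2 * (form A J / p / p) +
      2 * (form H J / p) := by
    conv_lhs => rw [← lower_add_upper p k M, ← hmid]
    rw [nsq_add, nsq_add, form_add_right, e1, e2, e3, e4, e5]
    ring
  have hpos : 0 ≤ nsq (A + (p • H + J)) := by
    refine nsq_nonneg fun h => ?_
    rcases Multiset.mem_add.1 h with h | h
    · exact hA0 h
    · rcases Multiset.mem_add.1 h with h | h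
      · exact hH0 (Multiset.mem_of_mem_nsmul h)
      · exact hJ0 h
  rw [nsq_add, nsq_add, form_add_right, nsq, nsq, nsq, form_nsmul_left, form_nsmul_right,
    form_nsmul_right, form_nsmul_left] at hpos
  rw [hM, e5]
  have key : nsq A + nsq H + nsq J + 2 * (form A H / p) + 2 * (form A J / p / p) +
      2 * (form H J / p) - (1 - 1 / (p : ℝ) ^ 2) * (nsq A + nsq J) =
      (form A A + 2 * (p * form A H + form A J) + (p * (p * form H H) + 2 * (p * form H J) +
        form J J)) / (p : ℝ) ^ 2 := by
    simp only [nsq]; field_simp; ring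
  have := div_nonneg hpos (sq_nonneg (p : ℝ))
  rw [← key] at this
  linarith

/-! ### Lower bounds for general non-degenerate lists -/

/-- A list is non-degenerate if its entries are non-zero and no integer occurs together with its
negative. -/
def Nondeg (M : Multiset ℤ) : Prop := 0 ∉ M ∧ ∀ a ∈ M, -a ∉ M

theorem Nondeg.mono (hM : Nondeg M) (h : N ≤ M) : Nondeg N :=
  ⟨fun h0 => hM.1 (Multiset.mem_of_le h h0), fun a ha hn =>
    hM.2 a (Multiset.mem_of_le h ha) (Multiset.mem_of_le h hn)⟩

theorem Nondeg.lower (hM : Nondeg M) (p k : ℕ) : Nondeg (lower p k M) := hM.mono (lower_le p k M)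

theorem Nondeg.upper (hM : Nondeg M) (p k : ℕ) : Nondeg (upper p k M) := hM.mono (upper_le p k M)

theorem Nondeg.ne_zero (hM : Nondeg M) {a : ℤ} (ha : a ∈ M) : a ≠ 0 := fun h => hM.1 (h ▸ ha)

theorem card_lower_add_upper (p k : ℕ) (M : Multiset ℤ) :
    (lower p k M).card + (upper p k M).card = M.card := by
  rw [← Multiset.card_add, lower_add_upper]

/-- The least power of `p` that divides an entry of the list exactly. -/
theorem exists_level {p : ℕ} (hp : p.Prime) (hM : M ≠ 0) (h0 : 0 ∉ M) :
    ∃ k, (∀ a ∈ M, (p : ℤ) ^ k ∣ a) ∧ lower p k M ≠ 0 := by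
  classical
  have hex : ∃ k, ∃ a ∈ M, ¬ (p : ℤ) ^ (k + 1) ∣ a := by
    obtain ⟨a, ha⟩ := Multiset.exists_mem_of_ne_zero hM
    have ha0 : a ≠ 0 := fun h => h0 (h ▸ ha)
    refine ⟨a.natAbs, a, ha, fun h => ?_⟩
    have h1 := Int.natAbs_le_of_dvd_ne_zero h ha0
    rw [Int.natAbs_pow, Int.natAbs_natCast] at h1
    have h2 := Nat.lt_pow_self hp.one_lt (n := a.natAbs + 1)
    omega
  refine ⟨Nat.find hex, fun a ha => ?_, fun h => ?_⟩
  · by_contra hd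
    obtain ⟨j, hj⟩ : ∃ j, Nat.find hex = j + 1 := by
      refine ⟨Nat.find hex - 1, ?_⟩
      rcases Nat.eq_zero_or_pos (Nat.find hex) with h | h
      · rw [h] at hd; simp at hd
      · omega
    rw [hj] at hd
    exact Nat.find_min hex (m := j) (by omega) ⟨a, ha, hd⟩
  · obtain ⟨a, ha, hd⟩ := Nat.find_spec hex
    have : a ∈ lower p (Nat.find hex) M := mem_lower.2 ⟨ha, hd⟩
    rw [h] at this
    exact Multiset.notMem_zero a this

/-- All entries of the list are divisible by the same powers of `p`. -/
def SameLevel (p : ℕ) (M : Multiset ℤ) : Prop :=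
  ∃ k, ∀ a ∈ M, (p : ℤ) ^ k ∣ a ∧ ¬ (p : ℤ) ^ (k + 1) ∣ a

theorem SameLevel.mono {p : ℕ} (hM : SameLevel p M) (h : N ≤ M) : SameLevel p N := by
  obtain ⟨k, hk⟩ := hM
  exact ⟨k, fun a ha => hk a (Multiset.mem_of_le h ha)⟩

theorem sameLevel_lower {p k : ℕ} (hk : ∀ a ∈ M, (p : ℤ) ^ k ∣ a) :
    SameLevel p (lower p k M) :=
  ⟨k, fun a ha => ⟨hk a (mem_lower.1 ha).1, (mem_lower.1 ha).2⟩⟩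

theorem sameLevel_of_upper_eq_zero {p k : ℕ} (hk : ∀ a ∈ M, (p : ℤ) ^ k ∣ a)
    (h : upper p k M = 0) : SameLevel p M := by
  have := sameLevel_lower hk
  rwa [← lower_add_upper p k M, h, add_zero]

/-- Either all entries are divisible by the same powers of `p`, or the list splits into two
non-empty levels. -/
theorem sameLevel_or_split {p : ℕ} (hp : p.Prime) (hM : M ≠ 0) (h0 : 0 ∉ M) :
    SameLevel p M ∨ ∃ k, (∀ a ∈ M, (p : ℤ) ^ k ∣ a) ∧ lower p k M ≠ 0 ∧ upper p k M ≠ 0 := by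
  obtain ⟨k, hk, hl⟩ := exists_level hp hM h0
  by_cases hu : upper p k M = 0
  · exact Or.inl (sameLevel_of_upper_eq_zero hk hu)
  · exact Or.inr ⟨k, hk, hl, hu⟩

theorem dvd_of_sameLevel {a b : ℤ} (ha : a ∈ M) (hb : b ∈ M)
    (h : ∀ p : ℕ, p.Prime → SameLevel p M) : a.natAbs ∣ b.natAbs := by
  rw [Nat.dvd_iff_prime_pow_dvd_dvd]
  intro p j hp hj
  obtain ⟨k, hk⟩ := h p hp
  have hjk : j ≤ k := by
    by_contra hc
    refine (hk a ha).2 ?_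
    have : (p : ℤ) ^ j ∣ a := by
      have := Int.natCast_dvd.2 hj
      exact_mod_cast this
    exact (pow_dvd_pow _ (by omega)).trans this
  have h1 : (p : ℤ) ^ j ∣ b := (pow_dvd_pow _ hjk).trans (hk b hb).1
  exact Int.natCast_dvd.1 (by exact_mod_cast h1)

/-- A non-degenerate list on which no prime splits is constant. -/
theorem eq_replicate_of_sameLevel (hM : Nondeg M) (hM0 : M ≠ 0)
    (h : ∀ p : ℕ, p.Prime → SameLevel p M) : ∃ a, a ≠ 0 ∧ M = Multiset.replicate M.card a := by
  obtain ⟨a, ha⟩ := Multiset.exists_mem_of_ne_zero hM0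
  refine ⟨a, hM.ne_zero ha, Multiset.eq_replicate_card.2 fun b hb => ?_⟩
  have h1 := Nat.dvd_antisymm (dvd_of_sameLevel ha hb h) (dvd_of_sameLevel hb ha h)
  rcases Int.natAbs_eq_natAbs_iff.1 h1 with h2 | h2
  · exact h2.symm
  · exact absurd (by rw [h2, neg_neg]; exact hb) (hM.2 a ha)

theorem nsq_replicate {a : ℤ} (ha : a ≠ 0) (n : ℕ) : nsq (Multiset.replicate n a) = n ^ 2 := by
  rw [← Multiset.nsmul_singleton, nsq, form_nsmul_left, form_nsmul_right, form_singleton,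
    corr_self ha]
  ring

theorem nsq_of_sameLevel (hM : Nondeg M) (h : ∀ p : ℕ, p.Prime → SameLevel p M) :
    nsq M = (M.card : ℝ) ^ 2 := by
  by_cases hM0 : M = 0
  · simp [hM0]
  · obtain ⟨a, ha, h1⟩ := eq_replicate_of_sameLevel hM hM0 h
    rw [h1, nsq_replicate ha]; simp

theorem one_le_card_sq (hM : M ≠ 0) : (1 : ℝ) ≤ (M.card : ℝ) ^ 2 := by
  have : (1 : ℝ) ≤ M.card := by exact_mod_cast Multiset.card_pos.2 hM
  nlinarith

/-- The norm of a non-empty non-degenerate list is at least that of a single integer. -/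
theorem one_le_nsq (hM : Nondeg M) (hM0 : M ≠ 0) : 1 ≤ nsq M := by
  induction hn : M.card using Nat.strong_induction_on generalizing M with
  | _ n ih =>
  by_cases h : ∀ p : ℕ, p.Prime → SameLevel p M
  · rw [nsq_of_sameLevel hM h]; exact one_le_card_sq hM0
  push Not at h
  obtain ⟨p, hp, hs⟩ := h
  obtain ⟨k, hk, hl, hu⟩ := (sameLevel_or_split hp hM0 hM.1).resolve_left hs
  have hc := card_lower_add_upper p k M
  have cl := Multiset.card_pos.2 hl
  have cu := Multiset.card_pos.2 hu
  have h1 := ih _ (by omega) (hM.lower p k) hl rfl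
  have h2 := ih _ (by omega) (hM.upper p k) hu rfl
  have h3 := nsq_ge_lower_upper hp (k := k) hM.1 one_pos
  have hp2 : (2 : ℝ) ≤ p := by exact_mod_cast hp.two_le
  have h4 : 1 / (p : ℝ) ≤ 1 / 2 := one_div_le_one_div_of_le two_pos hp2
  rw [one_mul] at h3
  nlinarith

/-- The lowest level of a split list already bounds the norm from below. -/
theorem nsq_ge_lower {p : ℕ} (hp : p.Prime) (k : ℕ) (h0 : 0 ∉ M) :
    (1 - 1 / (p : ℝ) ^ 2) * nsq (lower p k M) ≤ nsq M := by
  have hp' : (0 : ℝ) < p := by exact_mod_cast hp.pos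
  have h := nsq_ge_lower_upper hp (k := k) h0 (t := 1 / p) (by positivity)
  have e1 : (1 : ℝ) - 1 / (1 / p * p) = 0 := by field_simp; ring
  have e2 : (1 : ℝ) / p / p = 1 / (p : ℝ) ^ 2 := by rw [div_div, pow_two]
  rw [e1, e2, zero_mul, add_zero] at h
  exact h

theorem nsq_ge_upper {p : ℕ} (hp : p.Prime) (k : ℕ) (h0 : 0 ∉ M) :
    (1 - 1 / (p : ℝ) ^ 2) * nsq (upper p k M) ≤ nsq M := by
  have hp' : (0 : ℝ) < p := by exact_mod_cast hp.pos
  have h := nsq_ge_lower_upper hp (k := k) h0 (t := p) hp'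
  rw [div_self hp'.ne', sub_self, zero_mul, zero_add, ← pow_two] at h
  exact h

theorem two_le_card_sq (h : 2 ≤ M.card) : (4 : ℝ) ≤ (M.card : ℝ) ^ 2 := by
  have : (2 : ℝ) ≤ M.card := by exact_mod_cast h
  nlinarith

/-- A non-degenerate list of length at least three has norm at least `4 / 3`. An odd prime that
splits the list gives `2 - 2 / 3`. If only the prime `2` splits it, then each level is constant. -/
theorem four_thirds_le_nsq (hM : Nondeg M) (hc : 3 ≤ M.card) : 4 / 3 ≤ nsq M := by
  have hM0 : M ≠ 0 := by rintro rfl; simp at hc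
  by_cases h : ∀ p : ℕ, p.Prime → p ≠ 2 → SameLevel p M
  · obtain ⟨k, hk, hl⟩ := exists_level Nat.prime_two hM0 hM.1
    have hs := card_lower_add_upper 2 k M
    have hall : ∀ N ≤ M, SameLevel 2 N → nsq N = (N.card : ℝ) ^ 2 := fun N hN h2 =>
      nsq_of_sameLevel (hM.mono hN) fun p hp => by
        by_cases hp2 : p = 2
        · exact hp2 ▸ h2
        · exact (h p hp hp2).mono hN
    have h1 := nsq_ge_lower Nat.prime_two k hM.1
    have hL := hall _ (lower_le 2 k M) (sameLevel_lower hk)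
    have hcl := Multiset.card_pos.2 hl
    have h3 := nsq_ge_lower_upper_succ Nat.prime_two (k := k) hM.1
    by_cases hu2 : upper 2 (k + 1) M = 0
    · rcases le_or_gt 2 (lower 2 k M).card with hc2 | hc2
      · have := two_le_card_sq hc2
        rw [hL] at h1
        norm_num at h1
        linarith
      · have hU : SameLevel 2 (upper 2 k M) := by
          refine ⟨k + 1, fun a ha => ⟨(mem_upper.1 ha).2, fun hd => ?_⟩⟩
          have : a ∈ upper 2 (k + 1) M := mem_upper.2 ⟨(mem_upper.1 ha).1, hd⟩
          rw [hu2] at this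
          exact Multiset.notMem_zero a this
        have h2 := nsq_ge_upper Nat.prime_two k hM.1
        have := two_le_card_sq (M := upper 2 k M) (by omega)
        rw [hall _ (upper_le 2 k M) hU] at h2
        norm_num at h2
        linarith
    · have h4 := one_le_nsq (hM.upper 2 (k + 1)) hu2
      have h5 := one_le_nsq (hM.lower 2 k) hl
      norm_num at h3
      linarith
  · push Not at h
    obtain ⟨p, hp, hp2, hs⟩ := h
    obtain ⟨k, hk, hl, hu⟩ := (sameLevel_or_split hp hM0 hM.1).resolve_left hs
    have h1 := one_le_nsq (hM.lower p k) hl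
    have h2 := one_le_nsq (hM.upper p k) hu
    have h3 := nsq_ge_lower_upper hp (k := k) hM.1 one_pos
    have hp3 : (3 : ℝ) ≤ p := by
      have := hp.two_le
      exact_mod_cast (show 3 ≤ p by omega)
    have h4 : 1 / (p : ℝ) ≤ 1 / 3 := one_div_le_one_div_of_le (by norm_num) hp3
    rw [one_mul] at h3
    nlinarith

/-! ### Lower bounds for lists of odd integers -/

theorem corr_eq_one_div {a : ℤ} (ha : a ≠ 0) (b : ℤ) :
    ∃ g u v : ℤ, g ≠ 0 ∧ a = g * u ∧ b = g * v ∧ IsCoprime u v ∧ corr a b = 1 / (u * v) := by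
  have hg : Int.gcd a b ≠ 0 := fun h => ha (Int.gcd_eq_zero_iff.1 h).1
  obtain ⟨u, hu⟩ := Int.gcd_dvd_left (a := a) (b := b)
  obtain ⟨v, hv⟩ := Int.gcd_dvd_right (a := a) (b := b)
  have hgz : (Int.gcd a b : ℤ) ≠ 0 := by exact_mod_cast hg
  refine ⟨Int.gcd a b, u, v, hgz, hu, hv, ?_, ?_⟩
  · rw [Int.isCoprime_iff_gcd_eq_one]
    have h1 : Int.gcd (Int.gcd a b * u) (Int.gcd a b * v) = Int.gcd a b := by rw [← hu, ← hv]
    rw [Int.gcd_mul_left, Int.natAbs_natCast] at h1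
    exact Nat.eq_of_mul_eq_mul_left (Nat.pos_of_ne_zero hg) (by rw [h1, mul_one])
  · have hgr : (Int.gcd a b : ℝ) ≠ 0 := by exact_mod_cast hg
    have h1 : (a : ℝ) = Int.gcd a b * u := by exact_mod_cast hu
    have h2 : (b : ℝ) = Int.gcd a b * v := by exact_mod_cast hv
    rw [corr]
    conv_lhs => rw [h1, h2]
    rw [show (Int.gcd a b : ℝ) * u * (Int.gcd a b * v) = (Int.gcd a b : ℝ) ^ 2 * (u * v) by ring]
    rw [← div_div, div_self (pow_ne_zero 2 hgr)]

theorem corr_pos {a b : ℤ} (h : 0 < a * b) : 0 < corr a b := by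
  have h' : (0 : ℝ) < a * b := by exact_mod_cast h
  have ha : a ≠ 0 := by rintro rfl; simp at h
  have hg : (0 : ℝ) < Int.gcd a b := by exact_mod_cast Int.gcd_pos_of_ne_zero_left b ha
  exact div_pos (pow_pos hg 2) h'

theorem corr_neg {a b : ℤ} (h : a * b < 0) : corr a b < 0 := by
  have h1 := corr_pos (a := -a) (b := b) (by linarith)
  rw [corr_neg_left] at h1
  linarith

/-- The two integers have ratio `-3` or `-1 / 3`. -/
def NegThree (a b : ℤ) : Prop := b = -3 * a ∨ a = -3 * b

theorem NegThree.symm {a b : ℤ} (h : NegThree a b) : NegThree b a := h.elim Or.inr Or.inl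

theorem NegThree.corr_eq {a b : ℤ} (h : NegThree a b) (ha : a ≠ 0) : corr a b = -1 / 3 := by
  have aux : ∀ x : ℤ, x ≠ 0 → corr x (-3 * x) = -1 / 3 := by
    intro x hx
    have := corr_mul_mul hx 1 (-3)
    rw [mul_one, mul_comm x] at this
    rw [this, corr]; norm_num
  rcases h with rfl | rfl
  · exact aux a ha
  · rw [corr_comm]; exact aux b (by rintro rfl; simp at ha)

/-- For odd integers `a ≠ -b`, the correlation is at least `-1 / 5` unless the ratio is `-3` or
`-1 / 3`, and then it is `-1 / 3`. -/
theorem neg_fifth_le_corr {a b : ℤ} (ha : Odd a) (hb : Odd b) (h1 : a ≠ -b)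
    (h3 : ¬ NegThree a b) : -1 / 5 ≤ corr a b := by
  have ha0 : a ≠ 0 := by rintro rfl; simp at ha
  obtain ⟨g, u, v, hg, rfl, rfl, -, hc⟩ := corr_eq_one_div ha0 b
  rw [hc]
  have hu := (Int.odd_mul.1 ha).2
  have hv := (Int.odd_mul.1 hb).2
  rcases lt_or_ge (u * v) 0 with hneg | hpos
  · have h5 : u * v ≤ -5 := by
      by_contra hlt
      have hodd : Odd (u * v) := hu.mul hv
      obtain ⟨m, hm⟩ := hodd
      have hcase : u * v = -1 ∨ u * v = -3 := by omega
      rcases hcase with h | h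
      · rcases Int.eq_one_or_neg_one_of_mul_eq_neg_one h with hu1 | hu1
        · subst hu1
          exact h1 (by linear_combination g * h)
        · subst hu1
          exact h1 (by linear_combination -g * h)
      · have hdvd : u ∣ 3 := ⟨-v, by linarith⟩
        have hle : u.natAbs ≤ 3 := Nat.le_of_dvd (by norm_num) (Int.natAbs_dvd_natAbs.2 hdvd)
        have : u = 1 ∨ u = -1 ∨ u = 3 ∨ u = -3 := by
          have : u ≠ 0 := by rintro rfl; simp at h
          have : u ≠ 2 := by rintro rfl; omega
          have : u ≠ -2 := by rintro rfl; omega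
          omega
        refine h3 ?_
        rcases this with rfl | rfl | rfl | rfl
        · exact Or.inl (by linear_combination g * h)
        · exact Or.inl (by linear_combination -g * h)
        · exact Or.inr (by linear_combination g * h)
        · exact Or.inr (by linear_combination -g * h)
    have h5' : ((u : ℝ) * v) ≤ -5 := by exact_mod_cast h5
    rw [le_div_iff_of_neg (by linarith)]; linarith
  · have h0 : (0 : ℝ) ≤ (u : ℝ) * v := by exact_mod_cast hpos
    have := one_div_nonneg.2 h0
    linarith

theorem neg_third_le_corr {a b : ℤ} (ha : Odd a) (hb : Odd b) (h1 : a ≠ -b) :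
    -1 / 3 ≤ corr a b := by
  by_cases h3 : NegThree a b
  · exact (h3.corr_eq (by rintro rfl; simp at ha)).ge
  · linarith [neg_fifth_le_corr ha hb h1 h3]

theorem corr_le_fifth {a b : ℤ} (ha : Odd a) (hb : Odd b) (h1 : a ≠ b)
    (h3 : b ≠ 3 * a) (h4 : a ≠ 3 * b) : corr a b ≤ 1 / 5 := by
  have := neg_fifth_le_corr ha.neg hb (fun h => h1 (neg_injective h)) (fun h => by
    rcases h with h | h
    · exact h3 (by linarith)
    · exact h4 (by linarith))
  rw [corr_neg_left] at this
  linarith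

/-- Tripling an integer divides its correlation with `b` by three, unless `b` is divisible by a
higher power of `3`, in which case it multiplies it by three. -/
theorem corr_three_mul {b x : ℤ} (hb : b ≠ 0) (hx : x ≠ 0) :
    (∃ k : ℕ, (3 : ℤ) ^ (k + 1) ∣ b ∧ ¬ (3 : ℤ) ^ (k + 1) ∣ x ∧ corr b (3 * x) = 3 * corr b x) ∨
    ∃ k : ℕ, ¬ (3 : ℤ) ^ (k + 1) ∣ b ∧ (3 : ℤ) ^ k ∣ x ∧ corr b (3 * x) = corr b x / 3 := by
  obtain ⟨k, hk, hl⟩ := exists_level Nat.prime_three (M := {x}) (by simp) (by simpa using hx.symm)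
  have hkx : (3 : ℤ) ^ k ∣ x := by exact_mod_cast hk x (by simp)
  have hkx' : ¬ (3 : ℤ) ^ (k + 1) ∣ x := by
    obtain ⟨y, hy⟩ := Multiset.exists_mem_of_ne_zero hl
    obtain ⟨hy1, hy2⟩ := mem_lower.1 hy
    rw [Multiset.mem_singleton.1 hy1] at hy2
    exact_mod_cast hy2
  by_cases h : (3 : ℤ) ^ (k + 1) ∣ b
  · left
    obtain ⟨c, rfl⟩ := h
    refine ⟨k, dvd_mul_right _ _, hkx', ?_⟩
    have h1 := corr_prime_mul Nat.prime_three (k := k) (a := x) (b := 3 ^ k * c)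
      (by exact_mod_cast hkx') (by push_cast; exact dvd_mul_right _ _)
    have h2 := corr_mul_mul (k := 3) (by norm_num) (3 ^ k * c) x
    rw [show (3 : ℤ) ^ (k + 1) * c = 3 * (3 ^ k * c) by ring, h2, corr_comm (3 * _)]
    push_cast at h1
    rw [h1, corr_comm x]; ring
  · right
    refine ⟨k, h, hkx, ?_⟩
    exact corr_prime_mul Nat.prime_three (by exact_mod_cast h) (by exact_mod_cast hkx)

theorem corr_three_mul' {b x : ℤ} (hb : b ≠ 0) (hx : x ≠ 0) :
    corr b (3 * x) = 3 * corr b x ∨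
      corr b (3 * x) = corr b x / 3 ∧ corr b (9 * x) = corr b x / 9 := by
  rcases corr_three_mul hb hx with ⟨_, _, _, h⟩ | ⟨k, h1, h2, h⟩
  · exact Or.inl h
  · refine Or.inr ⟨h, ?_⟩
    have h3 := corr_prime_mul Nat.prime_three (k := k) (a := b) (b := 3 * x)
      (by exact_mod_cast h1) (by push_cast; exact h2.mul_left 3)
    push_cast at h3
    rw [show 9 * x = 3 * (3 * x) by ring, h3, h]; ring

theorem NegThree.corr_eq_ninth {x y z : ℤ} (hx : NegThree z x) (hy : NegThree z y) (hxy : x ≠ y)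
    (hz : z ≠ 0) : corr x y = 1 / 9 := by
  have aux : ∀ t : ℤ, t ≠ 0 → corr t (9 * t) = 1 / 9 := by
    intro t ht
    have := corr_mul_mul ht 1 9
    rw [mul_one, mul_comm t] at this
    rw [this, corr]; norm_num
  rcases hx with rfl | rfl <;> rcases hy with h | h
  · exact absurd h.symm hxy
  · subst h
    rw [corr_comm, show -3 * (-3 * y) = 9 * y by ring]
    exact aux y (by rintro rfl; simp at hz)
  · subst h
    rw [show -3 * (-3 * x) = 9 * x by ring]
    exact aux x (by rintro rfl; simp at hz)
  · exact absurd (by linarith) hxy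

/-- A list of the form `u, -3u, v, -3v`. -/
def TwoPair (M : Multiset ℤ) : Prop := ∃ u v : ℤ, M = {u, -3 * u, v, -3 * v}

/-- If `x` and `y` are the two integers in ratio `-3` or `-1 / 3` to `z`, then the correlation of
`w` with `z` makes up for much of the negative correlations with `x` and `y`. -/
theorem star_bound {x y z w : ℤ} (hx : NegThree z x) (hy : NegThree z y) (hxy : x ≠ y)
    (hz : z ≠ 0) (hw : w ≠ 0) (h1 : corr w x ≤ 0) (h2 : corr w y ≤ 0) (h3 : -1 / 5 ≤ corr w x)
    (h4 : -1 / 5 ≤ corr w y) : -1 / 5 ≤ corr w x + corr w y + corr w z := by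
  have aux : ∀ e : ℤ, e ≠ 0 → corr w e ≤ 0 → -1 / 5 ≤ corr w e → -1 / 5 ≤ corr w (9 * e) →
      -1 / 5 ≤ corr w e + corr w (9 * e) + corr w (-3 * e) := by
    intro e he g1 g3 g4
    rw [neg_mul, corr_neg_right]
    rcases corr_three_mul' hw he with h | ⟨h, h'⟩
    · rw [h]; linarith
    · rw [h, h']; linarith
  rcases hx with rfl | rfl <;> rcases hy with h | h
  · exact absurd h.symm hxy
  · subst h
    have hy0 : y ≠ 0 := by rintro rfl; simp at hz
    have e : -3 * (-3 * y) = 9 * y := by ring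
    rw [e] at h1 h3 ⊢
    linarith [aux y hy0 h2 h4 h3]
  · subst h
    have hx0 : x ≠ 0 := by rintro rfl; simp at hz
    have e : -3 * (-3 * x) = 9 * x := by ring
    rw [e] at h2 h4 ⊢
    linarith [aux x hx0 h1 h3 h4]
  · exact absurd (by linarith) hxy

/-- If `x` and `y` have ratio `-3` or `-1 / 3`, and `w` has the sign opposite to that of `x`, then
the correlation of `w` with `y` makes up for at least a third of that with `x`. -/
theorem edge_bound {x y w : ℤ} (h : NegThree x y) (hx : x ≠ 0) (hw : w ≠ 0) (h1 : corr w x ≤ 0)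
    (h2 : 0 ≤ corr w y) (h3 : -1 / 5 ≤ corr w x) : -2 / 15 ≤ corr w x + corr w y := by
  rcases h with rfl | rfl
  · rw [neg_mul, corr_neg_right]
    rcases corr_three_mul' hw hx with h | ⟨h, -⟩ <;> rw [h] <;> linarith
  · have hy0 : y ≠ 0 := by rintro rfl; simp at hx
    rw [neg_mul, corr_neg_right] at h1 h3 ⊢
    rcases corr_three_mul' hw hy0 with h | ⟨h, -⟩ <;> rw [h] at h1 h3 ⊢ <;> linarith

theorem nsq_pair (a b : ℤ) (ha : a ≠ 0) (hb : b ≠ 0) : nsq {a, b} = 2 + 2 * corr a b := by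
  simp only [nsq, form, Multiset.insert_eq_cons, Multiset.map_cons, Multiset.map_singleton,
    Multiset.sum_cons, Multiset.sum_singleton]
  rw [corr_self ha, corr_self hb, corr_comm b a]; ring

theorem nsq_triple {a b c : ℤ} (ha : a ≠ 0) (hb : b ≠ 0) (hc : c ≠ 0) :
    nsq {a, b, c} = 3 + 2 * (corr a b + corr a c + corr b c) := by
  simp only [nsq, form, Multiset.insert_eq_cons, Multiset.map_cons, Multiset.map_singleton,
    Multiset.sum_cons, Multiset.sum_singleton]
  rw [corr_self ha, corr_self hb, corr_self hc, corr_comm b a, corr_comm c a, corr_comm c b]; ring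

theorem nsq_quadruple {a b c d : ℤ} (ha : a ≠ 0) (hb : b ≠ 0) (hc : c ≠ 0) (hd : d ≠ 0) :
    nsq {a, b, c, d} =
      4 + 2 * (corr a b + corr a c + corr a d + corr b c + corr b d + corr c d) := by
  simp only [nsq, form, Multiset.insert_eq_cons, Multiset.map_cons, Multiset.map_singleton,
    Multiset.sum_cons, Multiset.sum_singleton]
  rw [corr_self ha, corr_self hb, corr_self hc, corr_self hd, corr_comm b a, corr_comm c a,
    corr_comm c b, corr_comm d a, corr_comm d b, corr_comm d c]; ring

theorem nsq_map_neg (M : Multiset ℤ) : nsq (M.map Neg.neg) = nsq M := by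
  rw [nsq, form_neg_left, form_comm, form_neg_left, neg_neg, nsq]

theorem Nondeg.map_neg (hM : Nondeg M) : Nondeg (M.map Neg.neg) := by
  refine ⟨fun h => ?_, fun a ha hn => ?_⟩
  · obtain ⟨b, hb, h0⟩ := Multiset.mem_map.1 h
    exact hM.1 (by rwa [neg_eq_zero.1 h0] at hb)
  · obtain ⟨b, hb, rfl⟩ := Multiset.mem_map.1 ha
    obtain ⟨c, hc, h⟩ := Multiset.mem_map.1 hn
    rw [neg_neg] at h
    exact hM.2 c hc (by rw [h]; exact hb)

/-- All entries of the list are odd. -/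
def AllOdd (M : Multiset ℤ) : Prop := ∀ a ∈ M, Odd a

theorem AllOdd.mono (hM : AllOdd M) (h : N ≤ M) : AllOdd N := fun a ha =>
  hM a (Multiset.mem_of_le h ha)

theorem AllOdd.map_neg (hM : AllOdd M) : AllOdd (M.map Neg.neg) := by
  intro a ha
  obtain ⟨b, hb, rfl⟩ := Multiset.mem_map.1 ha
  exact (hM b hb).neg

theorem odd_ne_zero {a : ℤ} (ha : Odd a) : a ≠ 0 := by rintro rfl; simp at ha

theorem nsq_ge_of_card_two (hM : Nondeg M) (ho : AllOdd M) (hc : M.card = 2) :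
    4 / 3 ≤ nsq M := by
  obtain ⟨a, b, rfl⟩ := Multiset.card_eq_two.1 hc
  have ha := ho a (by simp)
  have hb := ho b (by simp)
  have h := neg_third_le_corr ha hb fun h => hM.2 b (by simp) (by simp [h])
  rw [nsq_pair a b (odd_ne_zero ha) (odd_ne_zero hb)]
  linarith

theorem corr_pos_of_pos {a b : ℤ} (ha : 0 < a) (hb : 0 < b) : 0 < corr a b :=
  corr_pos (mul_pos ha hb)

theorem corr_neg_of_pos_neg {a b : ℤ} (ha : 0 < a) (hb : b < 0) : corr a b < 0 :=
  corr_neg (mul_neg_of_pos_of_neg ha hb)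

theorem corr_pos_of_neg {a b : ℤ} (ha : a < 0) (hb : b < 0) : 0 < corr a b :=
  corr_pos (mul_pos_of_neg_of_neg ha hb)

theorem two_one_bound {a b c : ℤ} (ha : 0 < a) (hb : 0 < b) (oa : Odd a) (ob : Odd b)
    (oc : Odd c) (hac : a ≠ -c) (hbc : b ≠ -c) : -5 / 9 ≤ corr a b + corr a c + corr b c := by
  have hc0 := odd_ne_zero oc
  have h1 := neg_third_le_corr oa oc hac
  have h2 := neg_third_le_corr ob oc hbc
  have h3 := corr_pos_of_pos ha hb
  by_cases t1 : NegThree a c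
  · by_cases t2 : NegThree b c
    · by_cases hab : a = b
      · rw [hab, corr_self hb.ne']
        rw [hab] at h1
        linarith
      · rw [t1.symm.corr_eq_ninth t2.symm hab hc0]
        linarith
    · linarith [neg_fifth_le_corr ob oc hbc t2]
  · linarith [neg_fifth_le_corr oa oc hac t1]

theorem nsq_ge_of_card_three (hM : Nondeg M) (ho : AllOdd M) (hc : M.card = 3) :
    16 / 9 ≤ nsq M := by
  obtain ⟨a, b, c, rfl⟩ := Multiset.card_eq_three.1 hc
  have oa := ho a (by simp)
  have ob := ho b (by simp)
  have oc := ho c (by simp)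
  have hab : a ≠ -b := fun h => hM.2 b (by simp) (by simp [h])
  have hac : a ≠ -c := fun h => hM.2 c (by simp) (by simp [h])
  have hbc : b ≠ -c := fun h => hM.2 c (by simp) (by simp [h])
  have a0 := odd_ne_zero oa
  have b0 := odd_ne_zero ob
  have c0 := odd_ne_zero oc
  rw [nsq_triple a0 b0 c0]
  have key : ∀ {x y z : ℤ}, 0 < x * y → Odd x → Odd y → Odd z → x ≠ -z → y ≠ -z →
      -5 / 9 ≤ corr x y + corr x z + corr y z := by
    intro x y z hxy ox oy oz hxz hyz
    rcases lt_or_gt_of_ne (odd_ne_zero ox) with h | h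
    · have h' : y < 0 := by
        by_contra hy
        exact absurd hxy (not_lt.2 (mul_nonpos_of_nonpos_of_nonneg h.le (not_lt.1 hy)))
      have := two_one_bound (neg_pos.2 h) (neg_pos.2 h') ox.neg oy.neg oz.neg
        (fun e => hxz (by linarith)) (fun e => hyz (by linarith))
      simpa only [corr_neg_left, corr_neg_right, neg_neg] using this
    · exact two_one_bound h ((mul_pos_iff_of_pos_left h).1 hxy) ox oy oz hxz hyz
  by_cases h1 : 0 < a * b
  · linarith [key h1 oa ob oc hac hbc]
  by_cases h2 : 0 < a * c
  · have := key h2 oa oc ob hab (fun h => hbc (by rw [h, neg_neg]))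
    rw [corr_comm c b] at this
    linarith
  · have h1' : a * b < 0 := lt_of_le_of_ne (not_lt.1 h1) (mul_ne_zero a0 b0)
    have h2' : a * c < 0 := lt_of_le_of_ne (not_lt.1 h2) (mul_ne_zero a0 c0)
    have h3 : 0 < b * c := by
      have := mul_pos_of_neg_of_neg h1' h2'
      nlinarith [mul_self_pos.2 a0, sq_nonneg a]
    have := key h3 ob oc oa (fun h => hab (by rw [h, neg_neg])) (fun h => hac (by rw [h, neg_neg]))
    rw [corr_comm b a, corr_comm c a] at this
    linarith

theorem three_one_bound {a b c d : ℤ} (ha : 0 < a) (hb : 0 < b) (hc : 0 < c)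
    (oa : Odd a) (ob : Odd b) (oc : Odd c) (od : Odd d) (had : a ≠ -d) (hbd : b ≠ -d)
    (hcd : c ≠ -d) :
    -5 / 6 ≤ corr a b + corr a c + corr a d + corr b c + corr b d + corr c d := by
  have hab := corr_pos_of_pos ha hb
  have hac := corr_pos_of_pos ha hc
  have hbc := corr_pos_of_pos hb hc
  have ta := neg_third_le_corr oa od had
  have tb := neg_third_le_corr ob od hbd
  have tc := neg_third_le_corr oc od hcd
  have d0 := odd_ne_zero od
  have fa := neg_fifth_le_corr oa od had
  have fb := neg_fifth_le_corr ob od hbd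
  have fc := neg_fifth_le_corr oc od hcd
  -- Two of the positive entries in ratio `-3` or `-1 / 3` to `d` have correlation at least `1 / 9`.
  have pair : ∀ {x y : ℤ}, 0 < x → NegThree x d → NegThree y d →
      x = y ∧ corr x y = 1 ∨ corr x y = 1 / 9 := by
    intro x y hx h1 h2
    by_cases h : x = y
    · exact Or.inl ⟨h, by rw [← h, corr_self hx.ne']⟩
    · exact Or.inr (h1.symm.corr_eq_ninth h2.symm h d0)
  by_cases na : NegThree a d <;> by_cases nb : NegThree b d <;> by_cases nc : NegThree c d
  · rcases pair ha na nb with ⟨-, h⟩ | h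
    · linarith
    rcases pair ha na nc with ⟨-, h'⟩ | h'
    · linarith
    rcases pair hb nb nc with ⟨-, h''⟩ | h''
    · linarith
    · linarith
  · have := fc nc
    rcases pair ha na nb with ⟨-, h⟩ | h <;> linarith
  · have := fb nb
    rcases pair ha na nc with ⟨-, h⟩ | h <;> linarith
  · linarith [fb nb, fc nc]
  · have := fa na
    rcases pair hb nb nc with ⟨-, h⟩ | h <;> linarith
  · linarith [fa na, fc nc]
  · linarith [fa na, fb nb]
  · linarith [fa na, fb nb, fc nc]

theorem twoPair_of_negThree {x y z w : ℤ} (h1 : NegThree x y) (h2 : NegThree z w) :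
    TwoPair {x, y, z, w} := by
  have aux : ∀ {x y : ℤ}, NegThree x y → ∃ u : ℤ, ({x, y} : Multiset ℤ) = {u, -3 * u} := by
    intro x y h
    rcases h with rfl | rfl
    · exact ⟨x, rfl⟩
    · exact ⟨y, Multiset.pair_comm _ _⟩
  obtain ⟨u, hu⟩ := aux h1
  obtain ⟨v, hv⟩ := aux h2
  refine ⟨u, v, ?_⟩
  have e : ∀ x y z w : ℤ, ({x, y, z, w} : Multiset ℤ) = {x, y} + {z, w} := fun x y z w => by
    simp only [Multiset.insert_eq_cons, Multiset.cons_add, Multiset.singleton_add]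
  rw [e, e, hu, hv]

theorem two_two_bound_of_negThree {a b c d : ℤ} (ha : 0 < a) (hb : 0 < b) (hc : c < 0) (hd : d < 0)
    (oa : Odd a) (ob : Odd b) (oc : Odd c) (od : Odd d) (had : a ≠ -d) (hbc : b ≠ -c)
    (hbd : b ≠ -d) (nac : NegThree a c) (nbd : ¬ NegThree b d)
    (nadbc : ¬ (NegThree a d ∧ NegThree b c)) :
    -5 / 6 ≤ corr a b + corr a c + corr a d + corr b c + corr b d + corr c d := by
  have a0 := ha.ne'
  have b0 := hb.ne'
  have c0 := hc.ne
  have d0 := hd.ne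
  have pab := corr_pos_of_pos ha hb
  have pcd := corr_pos_of_neg hc hd
  have nac' := nac.corr_eq a0
  have nad := corr_neg_of_pos_neg ha hd
  have nbc := corr_neg_of_pos_neg hb hc
  have nbd' := corr_neg_of_pos_neg hb hd
  have tad := neg_third_le_corr oa od had
  have tbc := neg_third_le_corr ob oc hbc
  have fbd := neg_fifth_le_corr ob od hbd nbd
  by_cases t1 : NegThree a d
  · have fbc := neg_fifth_le_corr ob oc hbc fun h => nadbc ⟨t1, h⟩
    have t1' := t1.corr_eq a0
    by_cases hcd : c = d
    · rw [hcd, corr_self d0] at *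
      linarith
    · rw [nac.corr_eq_ninth t1 hcd a0]
      have := star_bound nac t1 hcd a0 b0 nbc.le nbd'.le fbc fbd
      rw [corr_comm b a] at this
      linarith
  · have fad := neg_fifth_le_corr oa od had t1
    by_cases t2 : NegThree b c
    · by_cases hab : a = b
      · rw [hab, corr_self b0]
        have := t2.corr_eq b0
        rw [hab] at nac' tad
        linarith
      · have t2' := t2.corr_eq b0
        rw [nac.symm.corr_eq_ninth t2.symm hab c0]
        rw [corr_comm] at nad nbd' fad fbd
        have := star_bound nac.symm t2.symm hab c0 d0 nad.le nbd'.le fad fbd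
        rw [corr_comm d a, corr_comm d b, corr_comm d c] at this
        linarith
    · have fbc := neg_fifth_le_corr ob oc hbc t2
      have e1 := edge_bound nac.symm c0 b0 nbc.le (by rw [corr_comm]; exact pab.le) fbc
      have e2 := edge_bound nac a0 d0 (by rw [corr_comm]; exact nad.le)
        (by rw [corr_comm]; exact pcd.le) (by rw [corr_comm]; exact fad)
      rw [corr_comm b a] at e1
      rw [corr_comm d a, corr_comm d c] at e2
      linarith

theorem two_two_bound {a b c d : ℤ} (ha : 0 < a) (hb : 0 < b) (hc : c < 0) (hd : d < 0)
    (oa : Odd a) (ob : Odd b) (oc : Odd c) (od : Odd d) (hac : a ≠ -c) (had : a ≠ -d)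
    (hbc : b ≠ -c) (hbd : b ≠ -d) (h1 : ¬ (NegThree a c ∧ NegThree b d))
    (h2 : ¬ (NegThree a d ∧ NegThree b c)) :
    -5 / 6 ≤ corr a b + corr a c + corr a d + corr b c + corr b d + corr c d := by
  by_cases nac : NegThree a c
  · exact two_two_bound_of_negThree ha hb hc hd oa ob oc od had hbc hbd nac
      (fun h => h1 ⟨nac, h⟩) h2
  by_cases nad : NegThree a d
  · have := two_two_bound_of_negThree ha hb hd hc oa ob od oc hac hbd hbc nad
      (fun h => h2 ⟨nad, h⟩) h1
    rw [corr_comm d c] at this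
    linarith
  by_cases nbc : NegThree b c
  · have := two_two_bound_of_negThree hb ha hc hd ob oa oc od hbd hac had nbc nad
      (fun h => nac h.2)
    rw [corr_comm b a] at this
    linarith
  by_cases nbd : NegThree b d
  · have := two_two_bound_of_negThree hb ha hd hc ob oa od oc hbc had hac nbd nac
      (fun h => nad h.2)
    rw [corr_comm b a, corr_comm d c] at this
    linarith
  · linarith [corr_pos_of_pos ha hb, corr_pos_of_neg hc hd, neg_fifth_le_corr oa oc hac nac,
      neg_fifth_le_corr oa od had nad, neg_fifth_le_corr ob oc hbc nbc,
      neg_fifth_le_corr ob od hbd nbd]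

theorem TwoPair.of_map_neg (h : TwoPair (M.map Neg.neg)) : TwoPair M := by
  obtain ⟨u, v, h⟩ := h
  refine ⟨-u, -v, ?_⟩
  have := congrArg (Multiset.map Neg.neg) h
  rw [Multiset.map_map] at this
  simpa using this

theorem nsq_ge_or_twoPair_aux (hM : Nondeg M) (ho : AllOdd M) (hc : M.card = 4)
    (hp : 2 ≤ (M.filter (0 < ·)).card) : 7 / 3 ≤ nsq M ∨ TwoPair M := by
  have hsum := Multiset.filter_add_not (fun a : ℤ => 0 < a) M
  set P := M.filter (0 < ·) with hP
  set Q := M.filter (fun a => ¬ 0 < a) with hQ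
  have hcard : P.card + Q.card = 4 := by rw [← Multiset.card_add, hsum, hc]
  have pos : ∀ a ∈ P, 0 < a ∧ a ∈ M := fun a ha =>
    ⟨(Multiset.mem_filter.1 ha).2, (Multiset.mem_filter.1 ha).1⟩
  have neg : ∀ a ∈ Q, a < 0 ∧ a ∈ M := fun a ha => by
    obtain ⟨h1, h2⟩ := Multiset.mem_filter.1 ha
    exact ⟨lt_of_le_of_ne (not_lt.1 h2) (hM.ne_zero h1), h1⟩
  have hnd : ∀ {a b : ℤ}, a ∈ M → b ∈ M → a ≠ -b := fun ha hb h => hM.2 _ hb (h ▸ ha)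
  have h34 : P.card = 2 ∨ P.card = 3 ∨ P.card = 4 := by omega
  rcases h34 with h | h | h
  · obtain ⟨a, b, hab⟩ := Multiset.card_eq_two.1 h
    obtain ⟨c, d, hcd⟩ := Multiset.card_eq_two.1 (show Q.card = 2 by omega)
    rw [hab] at pos
    rw [hcd] at neg
    obtain ⟨pa, ma⟩ := pos a (by simp)
    obtain ⟨pb, mb⟩ := pos b (by simp)
    obtain ⟨pc, mc⟩ := neg c (by simp)
    obtain ⟨pd, md⟩ := neg d (by simp)
    have hM4 : M = {a, b, c, d} := by
      rw [← hsum, hab, hcd]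
      simp only [Multiset.insert_eq_cons, Multiset.cons_add, Multiset.singleton_add]
    by_cases h1 : NegThree a c ∧ NegThree b d
    · right
      rw [show M = {a, c, b, d} by
        rw [hM4]; simp only [Multiset.insert_eq_cons]; rw [Multiset.cons_swap b c]]
      exact twoPair_of_negThree h1.1 h1.2
    by_cases h2 : NegThree a d ∧ NegThree b c
    · right
      rw [show M = {a, d, b, c} by
        rw [hM4]; simp only [Multiset.insert_eq_cons]
        rw [← Multiset.insert_eq_cons c, Multiset.pair_comm c d, Multiset.insert_eq_cons,
          Multiset.cons_swap b d]]
      exact twoPair_of_negThree h2.1 h2.2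
    left
    have := two_two_bound pa pb pc pd (ho a ma) (ho b mb) (ho c mc) (ho d md) (hnd ma mc)
      (hnd ma md) (hnd mb mc) (hnd mb md) h1 h2
    rw [hM4, nsq_quadruple pa.ne' pb.ne' pc.ne pd.ne]
    linarith
  · obtain ⟨a, b, c, habc⟩ := Multiset.card_eq_three.1 h
    obtain ⟨d, hd⟩ := Multiset.card_eq_one.1 (show Q.card = 1 by omega)
    rw [habc] at pos
    rw [hd] at neg
    obtain ⟨pa, ma⟩ := pos a (by simp)
    obtain ⟨pb, mb⟩ := pos b (by simp)
    obtain ⟨pc, mc⟩ := pos c (by simp)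
    obtain ⟨pd, md⟩ := neg d (by simp)
    have hM4 : M = {a, b, c, d} := by
      rw [← hsum, habc, hd]
      simp only [Multiset.insert_eq_cons, Multiset.cons_add, Multiset.singleton_add]
    left
    have := three_one_bound pa pb pc (ho a ma) (ho b mb) (ho c mc) (ho d md) (hnd ma md)
      (hnd mb md) (hnd mc md)
    rw [hM4, nsq_quadruple pa.ne' pb.ne' pc.ne' pd.ne]
    linarith
  · have hQ0 : Q = 0 := Multiset.card_eq_zero.1 (by omega)
    obtain ⟨a, b, c, d, habcd⟩ := Multiset.card_eq_four.1 h
    rw [habcd] at pos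
    obtain ⟨pa, ma⟩ := pos a (by simp)
    obtain ⟨pb, mb⟩ := pos b (by simp)
    obtain ⟨pc, mc⟩ := pos c (by simp)
    obtain ⟨pd, md⟩ := pos d (by simp)
    left
    rw [← hsum, hQ0, add_zero, habcd, nsq_quadruple pa.ne' pb.ne' pc.ne' pd.ne']
    linarith [corr_pos_of_pos pa pb, corr_pos_of_pos pa pc, corr_pos_of_pos pa pd,
      corr_pos_of_pos pb pc, corr_pos_of_pos pb pd, corr_pos_of_pos pc pd]

/-- The only lists of four odd integers with norm below `7 / 3` consist of two pairs in ratio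
`-3`. -/
theorem nsq_ge_or_twoPair (hM : Nondeg M) (ho : AllOdd M) (hc : M.card = 4) :
    7 / 3 ≤ nsq M ∨ TwoPair M := by
  by_cases hp : 2 ≤ (M.filter (0 < ·)).card
  · exact nsq_ge_or_twoPair_aux hM ho hc hp
  have hp' : 2 ≤ ((M.map Neg.neg).filter (0 < ·)).card := by
    have h1 : ((M.map Neg.neg).filter (0 < ·)).card = (M.filter (fun a => ¬ 0 < a)).card := by
      rw [Multiset.filter_map, Multiset.card_map]
      congr 1
      refine Multiset.filter_congr fun a ha => ?_
      have := hM.ne_zero ha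
      simp only [Function.comp_apply]
      omega
    have h2 := congrArg Multiset.card (Multiset.filter_add_not (fun a : ℤ => 0 < a) M)
    rw [Multiset.card_add] at h2
    omega
  rcases nsq_ge_or_twoPair_aux hM.map_neg ho.map_neg (by rw [Multiset.card_map, hc]) hp' with h | h
  · left; rwa [nsq_map_neg] at h
  · exact Or.inr h.of_map_neg

theorem form_pair_pair (a b c d : ℤ) :
    form {a, b} {c, d} = corr a c + corr a d + corr b c + corr b d := by
  simp only [form, Multiset.insert_eq_cons, Multiset.map_cons, Multiset.map_singleton,
    Multiset.sum_cons, Multiset.sum_singleton]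
  ring

theorem pair_add_pair (a b c d : ℤ) : ({a, b, c, d} : Multiset ℤ) = {a, b} + {c, d} := by
  simp only [Multiset.insert_eq_cons, Multiset.cons_add, Multiset.singleton_add]

/-- The cross term between two pairs in ratio `-3`. -/
theorem neg_five_eighteenths_le_form_pairs {u v : ℤ} (hu : Odd u) (hv : Odd v)
    (hM : Nondeg {u, -3 * u, v, -3 * v}) : -5 / 18 ≤ form {u, -3 * u} {v, -3 * v} := by
  have u0 := odd_ne_zero hu
  have v0 := odd_ne_zero hv
  have h1 : u ≠ -v := fun h => hM.2 v (by simp) (by simp [h])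
  have h2 : u ≠ 3 * v := fun h => hM.2 (-3 * v) (by simp) (by simp [h])
  have h3 : v ≠ 3 * u := fun h => hM.2 (-3 * u) (by simp) (by simp [h])
  have e : form {u, -3 * u} {v, -3 * v} = 2 * corr u v - corr u (3 * v) - corr v (3 * u) := by
    rw [form_pair_pair, show -3 * u = -(3 * u) by ring, show -3 * v = -(3 * v) by ring,
      corr_neg_left, corr_neg_left, corr_neg_right, corr_neg_right,
      corr_mul_mul (by norm_num : (3 : ℤ) ≠ 0), corr_comm (3 * u)]
    ring
  have hle : corr u v ≤ 1 := by
    by_cases h : u = v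
    · rw [h, corr_self v0]
    · linarith [corr_le_fifth hu hv h h3 h2]
  rw [e]
  by_cases t : NegThree u v
  · -- Here two of the four entries coincide.
    rcases t with rfl | rfl
    · have e1 := corr_mul_mul u0 1 (-3)
      have e2 := corr_mul_mul u0 1 (-9)
      have e3 := corr_mul_mul u0 (-3) 3
      rw [mul_one, mul_comm u] at e1 e2
      rw [mul_comm u, mul_comm u] at e3
      rw [show 3 * (-3 * u) = -9 * u by ring, e1, e2, e3]
      norm_num [corr, Int.gcd]
    · have e1 := corr_mul_mul v0 (-3) 1
      have e2 := corr_mul_mul v0 (-3) 3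
      have e3 := corr_mul_mul v0 1 (-9)
      rw [mul_one, mul_comm v] at e1 e3
      rw [mul_comm v, mul_comm v] at e2
      rw [show 3 * (-3 * v) = -9 * v by ring, e1, e2, e3]
      norm_num [corr, Int.gcd]
  · have h4 := neg_fifth_le_corr hu hv h1 t
    rcases corr_three_mul u0 v0 with ⟨k, k1, k2, hk⟩ | ⟨k, k1, k2, hk⟩ <;>
    rcases corr_three_mul v0 u0 with ⟨j, j1, j2, hj⟩ | ⟨j, j1, j2, hj⟩ <;>
    rw [corr_comm v u] at hj <;> rw [hk, hj]
    · exfalso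
      rcases le_total k j with h | h
      · exact k2 ((pow_dvd_pow 3 (by omega)).trans j1)
      · exact j2 ((pow_dvd_pow 3 (by omega)).trans k1)
    · by_cases h : u = v
      · subst h; exact absurd k1 k2
      · linarith [corr_le_fifth hu hv h h3 h2]
    · by_cases h : u = v
      · subst h; exact absurd j1 j2
      · linarith [corr_le_fifth hu hv h h3 h2]
    · linarith

theorem nsq_negThree {c : ℤ} (hc : c ≠ 0) : nsq {c, -3 * c} = 4 / 3 := by
  have h : NegThree c (-3 * c) := Or.inl rfl
  rw [nsq_pair _ _ hc (mul_ne_zero (by norm_num) hc), h.corr_eq hc]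
  norm_num

theorem nsq_ge_of_card_four (hM : Nondeg M) (ho : AllOdd M) (hc : M.card = 4) :
    19 / 9 ≤ nsq M := by
  rcases nsq_ge_or_twoPair hM ho hc with h | ⟨u, v, rfl⟩
  · linarith
  have hu := ho u (by simp)
  have hv := ho v (by simp)
  have h := neg_five_eighteenths_le_form_pairs hu hv hM
  rw [pair_add_pair, nsq_add, nsq_negThree (odd_ne_zero hu), nsq_negThree (odd_ne_zero hv)]
  linarith

theorem AllOdd.sameLevel_two (ho : AllOdd M) : SameLevel 2 M :=
  ⟨0, fun a ha => ⟨by simp, by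
    have := ho a ha
    rw [zero_add, pow_one]
    exact_mod_cast Int.not_even_iff_odd.2 this ∘ even_iff_two_dvd.2⟩⟩

/-- A list of at least five odd integers has norm at least `7 / 3`. A prime `p ≥ 5` splitting the
list leaves parts that are almost orthogonal. If only the prime `3` splits it, then each level is
constant. -/
theorem nsq_ge_of_five_le_card (hM : Nondeg M) (ho : AllOdd M) (hc : 5 ≤ M.card) :
    7 / 3 ≤ nsq M := by
  induction hn : M.card using Nat.strong_induction_on generalizing M with
  | _ n ih =>
  have hM0 : M ≠ 0 := by rintro rfl; simp at hc
  have b4 : ∀ N ≤ M, N.card < n → 4 ≤ N.card → 19 / 9 ≤ nsq N := fun N hN hlt h4 => by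
    rcases Nat.lt_or_ge 4 N.card with h | h
    · linarith [ih _ hlt (hM.mono hN) (ho.mono hN) h rfl]
    · exact nsq_ge_of_card_four (hM.mono hN) (ho.mono hN) (by omega)
  have b3 : ∀ N ≤ M, N.card < n → 3 ≤ N.card → 16 / 9 ≤ nsq N := fun N hN hlt h3 => by
    rcases Nat.lt_or_ge 3 N.card with h | h
    · linarith [b4 N hN hlt h]
    · exact nsq_ge_of_card_three (hM.mono hN) (ho.mono hN) (by omega)
  have b2 : ∀ N ≤ M, N.card < n → 2 ≤ N.card → 4 / 3 ≤ nsq N := fun N hN hlt h2 => by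
    rcases Nat.lt_or_ge 2 N.card with h | h
    · linarith [b3 N hN hlt h]
    · exact nsq_ge_of_card_two (hM.mono hN) (ho.mono hN) (by omega)
  by_cases h : ∀ p : ℕ, p.Prime → p ≠ 3 → SameLevel p M
  · have hall : ∀ N ≤ M, SameLevel 3 N → nsq N = (N.card : ℝ) ^ 2 := fun N hN h2 =>
      nsq_of_sameLevel (hM.mono hN) fun p hp => by
        by_cases hp3 : p = 3
        · exact hp3 ▸ h2
        · exact (h p hp hp3).mono hN
    obtain ⟨k, hk, hl⟩ := exists_level Nat.prime_three hM0 hM.1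
    have hL := hall _ (lower_le 3 k M) (sameLevel_lower hk)
    have hcard := card_lower_add_upper 3 k M
    have hcl := Multiset.card_pos.2 hl
    have l1 := one_le_nsq (hM.lower 3 k) hl
    rcases le_or_gt 2 (lower 3 k M).card with hc2 | hc2
    · have h1 := nsq_ge_lower Nat.prime_three k hM.1
      have := two_le_card_sq hc2
      rw [hL] at h1
      norm_num at h1
      linarith
    rcases le_or_gt 3 (upper 3 (k + 1) M).card with hc3 | hc3
    · have hle : (upper 3 (k + 1) M).card ≤ (upper 3 k M).card := by
        refine Multiset.card_le_card (Multiset.monotone_filter_right M fun a ha => ?_)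
        exact (pow_dvd_pow _ (by omega)).trans ha
      have h1 := nsq_ge_lower_upper_succ Nat.prime_three (k := k) hM.1
      have h2 := b3 _ (upper_le 3 (k + 1) M) (by omega) hc3
      norm_num at h1
      linarith
    · set U := upper 3 k M with hU
      have hUM : U ≤ M := upper_le 3 k M
      have hUU : (upper 3 (k + 1) U).card ≤ (upper 3 (k + 1) M).card :=
        Multiset.card_le_card (Multiset.filter_le_filter _ hUM)
      have hUc := card_lower_add_upper 3 (k + 1) U
      have hmid := hall (lower 3 (k + 1) U) ((lower_le _ _ _).trans hUM)
        (sameLevel_lower fun a ha => (mem_upper.1 ha).2)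
      have h4 := two_le_card_sq (M := lower 3 (k + 1) U) (by omega)
      have h5 := nsq_ge_lower Nat.prime_three (k + 1) (hM.mono hUM).1
      have h6 := nsq_ge_lower_upper Nat.prime_three (k := k) hM.1 two_pos
      rw [hmid] at h5
      norm_num at h5 h6
      rw [← hU] at h6
      linarith
  · push Not at h
    obtain ⟨p, hp, hp3, hs⟩ := h
    have hp2 : p ≠ 2 := by
      rintro rfl
      exact hs ho.sameLevel_two
    obtain ⟨k, hk, hl, hu⟩ := (sameLevel_or_split hp hM0 hM.1).resolve_left hs
    have hp5 : (5 : ℝ) ≤ p := by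
      have h2 := hp.two_le
      have h4 : p ≠ 4 := by rintro rfl; revert hp; decide
      exact_mod_cast (show 5 ≤ p by omega)
    have hcard := card_lower_add_upper p k M
    have hcl := Multiset.card_pos.2 hl
    have hcu := Multiset.card_pos.2 hu
    have l1 := one_le_nsq (hM.lower p k) hl
    have u1 := one_le_nsq (hM.upper p k) hu
    have hL := b4 _ (lower_le p k M) (by omega)
    have hU := b4 _ (upper_le p k M) (by omega)
    have hL3 := b3 _ (lower_le p k M) (by omega)
    have hU3 := b3 _ (upper_le p k M) (by omega)
    have hL2 := b2 _ (lower_le p k M) (by omega)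
    have hU2 := b2 _ (upper_le p k M) (by omega)
    -- The cosine of the angle is at most `1 / 5`; `t` is chosen according to the lengths.
    have key : ∀ t : ℝ, 0 < t → (1 - t / 5) * nsq (FactorialRatio.lower p k M) +
        (1 - 1 / (t * 5)) * nsq (FactorialRatio.upper p k M) ≤ nsq M := by
      intro t ht
      have h3 := nsq_ge_lower_upper hp (k := k) hM.1 ht
      have h4 : t / p ≤ t / 5 := div_le_div_of_nonneg_left ht.le (by norm_num) hp5
      have h5 : 1 / (t * p) ≤ 1 / (t * 5) :=
        one_div_le_one_div_of_le (by positivity) (by nlinarith)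
      nlinarith
    rcases Nat.lt_or_ge (lower p k M).card 2 with h1 | h1
    · have h2 := key (3 / 2) (by norm_num)
      have h3 := hU (by omega)
      norm_num at h2
      linarith
    rcases Nat.lt_or_ge (upper p k M).card 2 with h1' | h1'
    · have h2 := key (2 / 3) (by norm_num)
      have h3 := hL (by omega)
      norm_num at h2
      linarith
    have h2 := key 1 one_pos
    norm_num at h2
    rcases Nat.lt_or_ge (lower p k M).card 3 with h4 | h4
    · linarith [hL2 h1, hU3 (by omega)]
    · linarith [hL3 h4, hU2 h1']

theorem nsq_ge_of_not_twoPair (hM : Nondeg M) (ho : AllOdd M) (hc : 4 ≤ M.card)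
    (h : ¬ TwoPair M) : 7 / 3 ≤ nsq M := by
  rcases Nat.lt_or_ge 4 M.card with h4 | h4
  · exact nsq_ge_of_five_le_card hM ho h4
  · exact (nsq_ge_or_twoPair hM ho (by omega)).resolve_right h

/-! ### Lists with sum zero and the square wave -/

theorem wave_eq (M : Multiset ℤ) (x : ℝ) : wave M x =
    (M.card : ℝ) / 2 - M.sum * x + ((M.map fun a : ℤ => ⌊(a : ℝ) * x⌋).sum : ℤ) := by
  induction M using Multiset.induction_on with
  | empty => simp [wave]
  | cons a M ih =>
    rw [wave_cons, ih, sawtooth, Int.fract]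
    simp only [Multiset.card_cons, Multiset.sum_cons, Multiset.map_cons]
    push_cast; ring

theorem exists_wave_eq_intCast (hs : M.sum = 0) (hc : Even M.card) (x : ℝ) :
    ∃ k : ℤ, wave M x = k := by
  obtain ⟨m, hm⟩ := hc
  rw [wave_eq, hs, hm]
  exact ⟨m + (M.map fun a : ℤ => ⌊(a : ℝ) * x⌋).sum, by push_cast; ring⟩

/-- For a list of odd length with sum zero, the values of `wave` are half-integers. -/
theorem three_le_nsq_of_odd_card (h0 : 0 ∉ M) (hs : M.sum = 0) (hc : Odd M.card) :
    3 ≤ nsq M := by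
  obtain ⟨m, hm⟩ := hc
  have h : ∀ x, 1 / 4 ≤ wave M x ^ 2 := by
    intro x
    set k : ℤ := m + (M.map fun a : ℤ => ⌊(a : ℝ) * x⌋).sum with hk
    have hw : wave M x = k + 1 / 2 := by
      rw [wave_eq, hs, hm, hk]; push_cast; ring
    have hk2 : (0 : ℝ) ≤ k * (k + 1) := by
      have : 0 ≤ k * (k + 1) := by
        rcases le_or_gt 0 k with h | h
        · positivity
        · exact mul_nonneg_of_nonpos_of_nonpos h.le (by omega)
      exact_mod_cast this
    rw [hw]; nlinarith
  have := mean_mono (BddMeas.const (1 / 4)) (bddMeas_wave M).sq h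
  rw [mean_const] at this
  rw [nsq_eq_mean h0]
  linarith

/-- The square wave `ψ(x) - ψ(x + 1 / 2)`, normalized to take the values `1` and `-1`. -/
noncomputable def square (x : ℝ) : ℝ := 4 * sawtooth x - 2 * sawtooth (2 * x)

theorem fract_two_mul (x : ℝ) :
    Int.fract (2 * x) = if Int.fract x < 1 / 2 then 2 * Int.fract x else 2 * Int.fract x - 1 := by
  have h0 := Int.fract_nonneg x
  have h1 := Int.fract_lt_one x
  split_ifs with h
  · rw [Int.fract_eq_iff]
    refine ⟨by linarith, by linarith, 2 * ⌊x⌋, ?_⟩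
    rw [Int.fract]; push_cast; ring
  · rw [Int.fract_eq_iff]
    refine ⟨by linarith, by linarith, 2 * ⌊x⌋ + 1, ?_⟩
    rw [Int.fract]; push_cast; ring

theorem square_eq (x : ℝ) : square x = if Int.fract x < 1 / 2 then 1 else -1 := by
  rw [square, sawtooth, sawtooth, fract_two_mul]
  split_ifs <;> ring

theorem square_eq_or (x : ℝ) : square x = 1 ∨ square x = -1 := by
  rw [square_eq]; split_ifs <;> simp

theorem bddMeas_square : BddMeas square :=
  (bddMeas_sawtooth.const_mul 4).sub ((bddMeas_sawtooth.comp_mul 2).const_mul 2)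

theorem square_periodic : Function.Periodic square 1 := fun x => by
  have h := sawtooth_periodic.nat_mul 2 (2 * x)
  rw [square, square, sawtooth_periodic x, mul_add]
  push_cast at h
  rw [h]

theorem sawtooth_sub_half (x : ℝ) : sawtooth x - sawtooth (x + 1 / 2) = square x / 2 := by
  have h := sum_sawtooth_add_div (m := 2) (by norm_num) x
  rw [Finset.sum_range_succ, Finset.sum_range_one] at h
  push_cast at h
  rw [zero_div, add_zero] at h
  rw [square]
  linarith

theorem not_dvd_pow_one {a : ℤ} : ¬ ((2 : ℕ) : ℤ) ^ (0 + 1) ∣ a ↔ Odd a := by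
  rw [zero_add, pow_one, ← Int.not_even_iff_odd, even_iff_two_dvd]; rfl

theorem odd_of_mem_lower {a : ℤ} (ha : a ∈ lower 2 0 M) : Odd a :=
  not_dvd_pow_one.1 (mem_lower.1 ha).2

theorem allOdd_lower (M : Multiset ℤ) : AllOdd (lower 2 0 M) := fun _ ha => odd_of_mem_lower ha

/-- The sum of the square waves `square (a x)`, over `a` in `M`. -/
noncomputable def squareSum (M : Multiset ℤ) (x : ℝ) : ℝ :=
  (M.map fun a : ℤ => square (a * x)).sum

theorem bddMeas_squareSum (M : Multiset ℤ) : BddMeas (squareSum M) :=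
  BddMeas.multiset_sum M fun a => bddMeas_square.comp_mul (a : ℝ)

theorem wave_sub_half (M : Multiset ℤ) (x : ℝ) :
    wave M x - wave M (x + 1 / 2) = squareSum (lower 2 0 M) x / 2 := by
  induction M using Multiset.induction_on with
  | empty => simp [wave, squareSum, lower]
  | cons a M ih =>
    rw [wave_cons, wave_cons]
    have e : sawtooth (a * x) + wave M x - (sawtooth (a * (x + 1 / 2)) + wave M (x + 1 / 2)) =
      (sawtooth (a * x) - sawtooth (a * (x + 1 / 2))) + squareSum (lower 2 0 M) x / 2 := by
      rw [← ih]; ring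
    rw [e]
    rcases Int.even_or_odd' a with ⟨b, hb | hb⟩
    · have h1 : lower 2 0 (a ::ₘ M) = lower 2 0 M :=
        Multiset.filter_cons_of_neg M fun h => by
          have := not_dvd_pow_one.1 h
          rw [hb] at this
          exact (Int.not_odd_iff_even.2 (even_two_mul b)) this
      have h2 : (a : ℝ) * (x + 1 / 2) = a * x + b := by rw [hb]; push_cast; ring
      rw [h1, h2, sawtooth_add_int]; ring
    · have h1 : lower 2 0 (a ::ₘ M) = a ::ₘ lower 2 0 M :=
        Multiset.filter_cons_of_pos M (not_dvd_pow_one.2 ⟨b, hb⟩)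
      have h2 : (a : ℝ) * (x + 1 / 2) = (a * x + 1 / 2) + b := by rw [hb]; push_cast; ring
      rw [h1, h2, sawtooth_add_int, sawtooth_sub_half]
      simp only [squareSum, Multiset.map_cons, Multiset.sum_cons]
      ring

theorem mean_square {a b : ℤ} (ha : Odd a) (hb : Odd b) :
    mean (fun x => square (a * x) * square (b * x)) = corr a b := by
  have a0 := odd_ne_zero ha
  have b0 := odd_ne_zero hb
  have hs : ∀ c : ℤ, BddMeas fun x => sawtooth (c * x) := fun c => bddMeas_sawtooth.comp_mul _
  have e : ∀ x : ℝ, square (a * x) * square (b * x) =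
      (16 * (sawtooth (a * x) * sawtooth (b * x)) +
        (-8) * (sawtooth (a * x) * sawtooth ((2 * b : ℤ) * x))) +
      ((-8) * (sawtooth ((2 * a : ℤ) * x) * sawtooth (b * x)) +
        4 * (sawtooth ((2 * a : ℤ) * x) * sawtooth ((2 * b : ℤ) * x))) := by
    intro x
    rw [square, square]
    push_cast
    rw [mul_assoc 2 (a : ℝ), mul_assoc 2 (b : ℝ)]
    ring
  simp only [e]
  rw [mean_add (((hs a).mul (hs b)).const_mul _ |>.add (((hs a).mul (hs _)).const_mul _))
      ((((hs _).mul (hs b)).const_mul _).add (((hs _).mul (hs _)).const_mul _)),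
    mean_add (((hs a).mul (hs b)).const_mul _) (((hs a).mul (hs _)).const_mul _),
    mean_add (((hs _).mul (hs b)).const_mul _) (((hs _).mul (hs _)).const_mul _)]
  simp only [mean_const_mul]
  rw [mean_sawtooth a0 b0, mean_sawtooth a0 (by simpa using b0), 
    mean_sawtooth (by simpa using a0) b0,
    mean_sawtooth (by simpa using a0) (by simpa using b0), corr_mul_mul two_ne_zero]
  have h1 := corr_prime_mul Nat.prime_two (k := 0) (a := a) (b := b)
    (not_dvd_pow_one.2 ha) (by simp)
  have h2 := corr_prime_mul Nat.prime_two (k := 0) (a := b) (b := a)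
    (not_dvd_pow_one.2 hb) (by simp)
  push_cast at h1 h2
  rw [h1, corr_comm (2 * a), h2, corr_comm b a]
  ring

theorem mean_squareSum_mul (hM : AllOdd M) {c : ℤ} (hc : Odd c) :
    mean (fun x => squareSum M x * square (c * x)) = form M {c} := by
  have hs : ∀ c : ℤ, BddMeas fun x => square (c * x) := fun c => bddMeas_square.comp_mul _
  simp only [squareSum, ← Multiset.sum_map_mul_right]
  rw [mean_multiset_sum (F := fun (a : ℤ) x => square (a * x) * square (c * x)) M
    fun a => (hs a).mul (hs c), form]
  congr 1
  refine Multiset.map_congr rfl fun a ha => ?_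
  simp [mean_square (hM a ha) hc]

/-- For an integer-valued function `F`, the inequality `F² + F'² ≥ |F - F'|`, with `F'` the shift
of `F` by `1 / 2`, turns the first moment of `F - F'` into a lower bound for the norm. -/
theorem mean_abs_squareSum_le (h0 : 0 ∉ M) (hs : M.sum = 0) (hc : Even M.card) :
    3 * mean (fun x => |squareSum (lower 2 0 M) x|) ≤ nsq M := by
  have bw := bddMeas_wave M
  have h1 : mean (fun x => |squareSum (lower 2 0 M) x|) ≤
      mean (fun x => 2 * (wave M x ^ 2 + wave M (x + 1 / 2) ^ 2)) := by
    refine mean_mono (bddMeas_squareSum _).abs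
      ((bw.sq.add (bw.comp_add (1 / 2)).sq).const_mul 2) fun x => ?_
    obtain ⟨k, hk⟩ := exists_wave_eq_intCast hs hc x
    obtain ⟨l, hl⟩ := exists_wave_eq_intCast hs hc (x + 1 / 2)
    have e : squareSum (lower 2 0 M) x = 2 * ((k : ℝ) - l) := by
      have := wave_sub_half M x
      rw [hk, hl] at this
      linarith
    have hz : ∀ n : ℤ, |(n : ℝ)| ≤ (n : ℝ) ^ 2 := fun n => by
      have : |n| ≤ n ^ 2 := by
        rcases eq_or_ne n 0 with rfl | hn
        · simp
        · nlinarith [Int.one_le_abs hn, sq_abs n]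
      exact_mod_cast this
    rw [e, hk, hl, abs_mul, abs_two]
    have := abs_sub (k : ℝ) l
    linarith [hz k, hz l]
  rw [mean_const_mul, mean_add bw.sq (bw.comp_add (1 / 2)).sq] at h1
  have h2 : mean (fun x => wave M (x + 1 / 2) ^ 2) = mean fun x => wave M x ^ 2 :=
    mean_comp_add (f := fun x => wave M x ^ 2)
      (fun x => by simp only [wave_periodic M x]) (1 / 2)
  rw [h2] at h1
  rw [nsq_eq_mean h0]
  linarith

/-- Testing an integer-valued `wave` against a square wave of odd frequency. -/
theorem abs_form_lower_le (h0 : 0 ∉ M) (hs : M.sum = 0) (hc : Even M.card) {c : ℤ} (hc' : Odd c) :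
    3 * |form (lower 2 0 M) {c}| ≤ nsq M := by
  have h1 := mean_abs_squareSum_le h0 hs hc
  have bS := bddMeas_squareSum (lower 2 0 M)
  have bc : BddMeas fun x => square (c * x) := bddMeas_square.comp_mul _
  have h2 := mean_squareSum_mul (allOdd_lower M) hc'
  have h3 : ∀ x, |squareSum (lower 2 0 M) x * square (c * x)| ≤ |squareSum (lower 2 0 M) x| := by
    intro x
    rw [abs_mul]
    rcases square_eq_or (c * x) with h | h <;> simp [h]
  have h4 := mean_mono (bS.mul bc) bS.abs fun x => (le_abs_self _).trans (h3 x)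
  have h5 := mean_mono ((bS.mul bc).const_mul (-1)) bS.abs fun x => by
    rw [neg_one_mul]; exact (neg_le_abs _).trans (h3 x)
  rw [mean_const_mul] at h5
  rw [h2] at h4 h5
  have : |form (lower 2 0 M) {c}| ≤ mean fun x => |squareSum (lower 2 0 M) x| :=
    abs_le.2 ⟨by linarith, h4⟩
  linarith

/-! ### Two pairs in ratio `-3` -/

/-- The normalized sum of the square waves of frequencies `1` and `-3`, with values in
`{-1, 0, 1}`. -/
noncomputable def pairWave (y : ℝ) : ℝ := (square y + square (-3 * y)) / 2

theorem bddMeas_pairWave : BddMeas pairWave := by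
  have := (bddMeas_square.add (bddMeas_square.comp_mul (-3))).const_mul (1 / 2)
  convert this using 2
  rw [pairWave]; ring

theorem pairWave_add_int (y : ℝ) (k : ℤ) : pairWave (y + k) = pairWave y := by
  have h1 : square (y + k) = square y := by simpa using square_periodic.int_mul k y
  have h2 : square (-3 * (y + k)) = square (-3 * y) := by
    have := square_periodic.int_mul (-3 * k) (-3 * y)
    rw [mul_one] at this
    rw [← this]; push_cast; ring_nf
  rw [pairWave, pairWave, h1, h2]

theorem pairWave_cases (y : ℝ) : pairWave y = 0 ∨ pairWave y = 1 ∨ pairWave y = -1 := by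
  rw [pairWave]
  rcases square_eq_or y with h | h <;> rcases square_eq_or (-3 * y) with h' | h' <;>
    rw [h, h'] <;> norm_num

theorem fract_mem_of_pairWave_ne_zero {y : ℝ} (h : pairWave y ≠ 0) (hy : ∀ k : ℤ, 6 * y ≠ k) :
    1 / 3 < Int.fract (2 * y) ∧ Int.fract (2 * y) < 2 / 3 := by
  set w := Int.fract y with hw
  have hyw : y = ⌊y⌋ + w := (Int.floor_add_fract y).symm
  have h0 : 0 ≤ w := Int.fract_nonneg y
  have h1 : w < 1 := Int.fract_lt_one y
  have hne : ∀ k : ℤ, 6 * w ≠ k := by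
    intro k hk
    refine hy (6 * ⌊y⌋ + k) ?_
    push_cast
    linarith
  have n0 := hne 0
  have n1 := hne 1
  have n2 := hne 2
  have n3 := hne 3
  have n4 := hne 4
  have n5 := hne 5
  push_cast at n0 n1 n2 n3 n4 n5
  have fr : ∀ c : ℤ, 0 ≤ -3 * w + c → -3 * w + c < 1 → Int.fract (-3 * y) = -3 * w + c := by
    intro c hc0 hc1
    rw [Int.fract_eq_iff]
    refine ⟨hc0, hc1, -3 * ⌊y⌋ - c, ?_⟩
    push_cast
    linarith
  -- On the intervals excluded below, `square y` and `square (-3 y)` have opposite signs.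
  have hz : ∀ c : ℤ, 0 ≤ -3 * w + c → -3 * w + c < 1 →
      ¬ (w < 1 / 2 ∧ 1 / 2 ≤ -3 * w + c) ∧ ¬ (1 / 2 ≤ w ∧ -3 * w + c < 1 / 2) := by
    intro c hc0 hc1
    refine ⟨fun hh => h ?_, fun hh => h ?_⟩
    · rw [pairWave, square_eq, square_eq, fr c hc0 hc1, if_pos hh.1, if_neg (not_lt.2 hh.2)]
      norm_num
    · rw [pairWave, square_eq, square_eq, fr c hc0 hc1, if_neg (not_lt.2 hh.1), if_pos hh.2]
      norm_num
  have z1 := hz 1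
  have z2 := hz 2
  have z3 := hz 3
  push_cast at z1 z2 z3
  rw [fract_two_mul]
  rcases lt_or_gt_of_ne (show w ≠ 1 / 6 from fun e => n1 (by linarith)) with a1 | a1
  · have : 0 < w := lt_of_le_of_ne h0 fun e => n0 (by linarith)
    exact absurd ⟨by linarith, by linarith⟩ (z1 (by linarith) (by linarith)).1
  rcases lt_or_gt_of_ne (show w ≠ 2 / 6 from fun e => n2 (by linarith)) with a2 | a2
  · rw [if_pos (by linarith)]; constructor <;> linarith
  rcases lt_or_gt_of_ne (show w ≠ 3 / 6 from fun e => n3 (by linarith)) with a3 | a3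
  · exact absurd ⟨by linarith, by linarith⟩ (z2 (by linarith) (by linarith)).1
  rcases lt_or_gt_of_ne (show w ≠ 4 / 6 from fun e => n4 (by linarith)) with a4 | a4
  · exact absurd ⟨by linarith, by linarith⟩ (z2 (by linarith) (by linarith)).2
  rcases lt_or_gt_of_ne (show w ≠ 5 / 6 from fun e => n5 (by linarith)) with a5 | a5
  · rw [if_neg (by linarith)]; constructor <;> linarith
  · exact absurd ⟨by linarith, by linarith⟩ (z3 (by linarith) (by linarith)).2

theorem ae_six_mul_ne {u : ℤ} (hu : u ≠ 0) (δ : ℝ) :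
    ∀ᵐ x : ℝ, ∀ k : ℤ, 6 * (u * (x + δ)) ≠ k := by
  have hu' : (u : ℝ) ≠ 0 := by exact_mod_cast hu
  have hc : (Set.range fun k : ℤ => (k : ℝ) / (6 * u) - δ).Countable := Set.countable_range _
  filter_upwards [hc.ae_notMem volume] with x hx k hk
  exact hx ⟨k, by simp only [← hk]; field_simp; ring⟩

theorem pairWave_sq (y : ℝ) : pairWave y ^ 2 = 1 / 2 + 1 / 2 * (square y * square (-3 * y)) := by
  rw [pairWave]
  rcases square_eq_or y with h | h <;> rcases square_eq_or (-3 * y) with h' | h' <;>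
    rw [h, h'] <;> norm_num

theorem mean_pairWave_sq {u : ℤ} (hu : Odd u) : mean (fun x => pairWave (u * x) ^ 2) = 1 / 3 := by
  have h := mean_square hu (b := -3 * u) ((by decide : Odd (-3 : ℤ)).mul hu)
  rw [NegThree.corr_eq (Or.inl rfl) (odd_ne_zero hu)] at h
  have b1 : BddMeas fun x => square (u * x) * square ((-3 * u : ℤ) * x) :=
    (bddMeas_square.comp_mul _).mul (bddMeas_square.comp_mul _)
  have e : ∀ x : ℝ, pairWave (u * x) ^ 2 =
      1 / 2 + 1 / 2 * (square (u * x) * square ((-3 * u : ℤ) * x)) := fun x => by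
    rw [pairWave_sq]; push_cast; rw [mul_assoc]
  simp only [e]
  rw [mean_add (BddMeas.const _) (b1.const_mul _), mean_const, mean_const_mul, h]
  norm_num

theorem mean_pairWave_mul {u v : ℤ} (hu : Odd u) (hv : Odd v) :
    mean (fun x => pairWave (u * x) * pairWave (v * x)) =
      form {u, -3 * u} {v, -3 * v} / 4 := by
  have o3 : ∀ {w : ℤ}, Odd w → Odd (-3 * w) := fun h => (by decide : Odd (-3 : ℤ)).mul h
  have hb : ∀ a b : ℤ, BddMeas fun x => square (a * x) * square (b * x) := fun a b =>
    (bddMeas_square.comp_mul _).mul (bddMeas_square.comp_mul _)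
  have e : ∀ x : ℝ, pairWave (u * x) * pairWave (v * x) =
      1 / 4 * ((square (u * x) * square (v * x) + square (u * x) * square ((-3 * v : ℤ) * x)) +
      (square ((-3 * u : ℤ) * x) * square (v * x) +
        square ((-3 * u : ℤ) * x) * square ((-3 * v : ℤ) * x))) := fun x => by
    rw [pairWave, pairWave]; push_cast; rw [mul_assoc (-3), mul_assoc (-3)]; ring
  simp only [e]
  rw [mean_const_mul, mean_add ((hb _ _).add (hb _ _)) ((hb _ _).add (hb _ _)),
    mean_add (hb _ _) (hb _ _), mean_add (hb _ _) (hb _ _), mean_square hu hv,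
    mean_square hu (o3 hv), mean_square (o3 hu) hv, mean_square (o3 hu) (o3 hv), form_pair_pair]
  ring

/-- If `v` is divisible by a higher power of some prime `p` than `u`, then a shift by a suitable
multiple of `1 / p ^ (k + 1)` preserves `pairWave (v x)` and makes the supports of `pairWave (u x)`
and of its shift disjoint. -/
theorem mean_pairWave_sq_mul_le_aux {p k : ℕ} {u v : ℤ} (hp : p.Prime) (hp2 : p ≠ 2) (hu : Odd u)
    (hv : Odd v) (h1 : (p : ℤ) ^ k ∣ u) (h2 : ¬ (p : ℤ) ^ (k + 1) ∣ u)
    (h3 : (p : ℤ) ^ (k + 1) ∣ v) :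
    mean (fun x => pairWave (u * x) ^ 2 * pairWave (v * x) ^ 2) ≤ 1 / 6 := by
  have hp0 : (p : ℝ) ≠ 0 := by exact_mod_cast hp.ne_zero
  obtain ⟨u', rfl⟩ := h1
  obtain ⟨v', rfl⟩ := h3
  obtain ⟨m, hm⟩ := hp.odd_of_ne_two hp2
  have hm1 : 1 ≤ m := by
    have := hp.two_le
    omega
  have hcop : IsCoprime (2 * u') (p : ℤ) := by
    refine ((Nat.prime_iff_prime_int.1 hp).irreducible.coprime_iff_not_dvd.2 fun h => ?_).symm
    rcases (Nat.prime_iff_prime_int.1 hp).dvd_mul.1 h with h | h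
    · have := Int.le_of_dvd two_pos h
      have := hp.two_le
      omega
    · exact h2 (by rw [pow_succ]; exact mul_dvd_mul_left _ h)
  obtain ⟨r, s, hrs⟩ := hcop
  -- With `j = r m` one has `2 u' j ≡ m = (p - 1) / 2` modulo `p`.
  set δ : ℝ := (r * m : ℤ) / (p : ℝ) ^ (k + 1) with hδ
  have hvδ : ∀ x : ℝ, pairWave (((p : ℤ) ^ (k + 1) * v' : ℤ) * (x + δ)) =
      pairWave (((p : ℤ) ^ (k + 1) * v' : ℤ) * x) := by
    intro x
    have e : (((p : ℤ) ^ (k + 1) * v' : ℤ) : ℝ) * (x + δ) =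
        ((p : ℤ) ^ (k + 1) * v' : ℤ) * x + (v' * (r * m) : ℤ) := by
      rw [mul_add, hδ]
      push_cast
      field_simp
    rw [e, pairWave_add_int]
  have huδ : ∀ x : ℝ, 2 * ((((p : ℤ) ^ k * u' : ℤ) : ℝ) * (x + δ)) =
      2 * ((((p : ℤ) ^ k * u' : ℤ) : ℝ) * x) + m / p + (-(s * m) : ℤ) := by
    intro x
    have hrs' : (r : ℝ) * (2 * u') + s * p = 1 := by exact_mod_cast hrs
    rw [hδ]
    push_cast
    rw [pow_succ]
    field_simp
    linear_combination (m : ℝ) * hrs'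
  set u := (p : ℤ) ^ k * u' with hudef
  set v := (p : ℤ) ^ (k + 1) * v' with hvdef
  have u0 := odd_ne_zero hu
  have bu : BddMeas fun x => pairWave (u * x) ^ 2 := (bddMeas_pairWave.comp_mul _).sq
  have bv : BddMeas fun x => pairWave (v * x) ^ 2 := (bddMeas_pairWave.comp_mul _).sq
  have bu' : BddMeas fun x => pairWave (u * (x + δ)) ^ 2 := bu.comp_add δ
  have hper : ∀ w : ℤ, Function.Periodic (fun x => pairWave (w * x) ^ 2) 1 := fun w x => by
    simp only [mul_add, mul_one, pairWave_add_int]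
  have hshift : mean (fun x => pairWave (u * (x + δ)) ^ 2 * pairWave (v * x) ^ 2) =
      mean (fun x => pairWave (u * x) ^ 2 * pairWave (v * x) ^ 2) := by
    rw [← mean_comp_add (f := fun x => pairWave (u * x) ^ 2 * pairWave (v * x) ^ 2)
      ((hper u).mul (hper v)) δ]
    simp only [hvδ]
  have hα : (1 : ℝ) / 3 ≤ m / p ∧ (m : ℝ) / p < 1 / 2 := by
    have hpp : (0 : ℝ) < p := by exact_mod_cast hp.pos
    have hmp : (p : ℝ) = 2 * m + 1 := by exact_mod_cast hm
    have : (1 : ℝ) ≤ m := by exact_mod_cast hm1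
    constructor
    · rw [div_le_div_iff₀ (by norm_num) hpp]; linarith
    · rw [div_lt_div_iff₀ hpp (by norm_num)]; linarith
  have hdisj : ∀ᵐ x : ℝ, pairWave (u * x) ^ 2 + pairWave (u * (x + δ)) ^ 2 ≤ 1 := by
    have ae0 := ae_six_mul_ne u0 0
    simp only [add_zero] at ae0
    filter_upwards [ae0, ae_six_mul_ne u0 δ] with x hx hx'
    have hor : pairWave (u * x) = 0 ∨ pairWave (u * (x + δ)) = 0 := by
      by_contra hcon
      push Not at hcon
      obtain ⟨a1, a2⟩ := fract_mem_of_pairWave_ne_zero hcon.1 hx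
      obtain ⟨b1, b2⟩ := fract_mem_of_pairWave_ne_zero hcon.2 hx'
      rw [huδ, Int.fract_add_intCast] at b1 b2
      set y : ℝ := 2 * (u * x) with hy
      have hy' : y = ⌊y⌋ + Int.fract y := (Int.floor_add_fract y).symm
      rcases lt_or_ge (Int.fract y + m / p) 1 with hlt | hge
      · have : Int.fract (y + m / p) = Int.fract y + m / p := by
          rw [Int.fract_eq_iff]
          exact ⟨by linarith, hlt, ⌊y⌋, by linarith⟩
        linarith
      · have : Int.fract (y + m / p) = Int.fract y + m / p - 1 := by
          rw [Int.fract_eq_iff]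
          exact ⟨by linarith, by linarith, ⌊y⌋ + 1, by push_cast; linarith⟩
        linarith
    rcases hor with h | h <;> rw [h]
    · rcases pairWave_cases (u * (x + δ)) with h' | h' | h' <;> rw [h'] <;> norm_num
    · rcases pairWave_cases (u * x) with h' | h' | h' <;> rw [h'] <;> norm_num
  have hle := mean_mono_ae ((bu.add bu').mul bv) bv (hdisj.mono fun x hx =>
    mul_le_of_le_one_left (sq_nonneg _) hx)
  rw [mean_pairWave_sq hv] at hle
  simp only [add_mul] at hle
  rw [mean_add (bu.mul bv) (bu'.mul bv), hshift] at hle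
  linarith

theorem mean_pairWave_sq_mul_le {u v : ℤ} (hu : Odd u) (hv : Odd v) (h1 : u ≠ v) (h2 : u ≠ -v) :
    mean (fun x => pairWave (u * x) ^ 2 * pairWave (v * x) ^ 2) ≤ 1 / 6 := by
  have hM0 : (0 : ℤ) ∉ ({u, v} : Multiset ℤ) := by
    simp [(odd_ne_zero hu).symm, (odd_ne_zero hv).symm]
  have ho : AllOdd {u, v} := by
    intro a ha
    simp only [Multiset.insert_eq_cons, Multiset.mem_cons, Multiset.mem_singleton] at ha
    rcases ha with rfl | rfl <;> assumption
  have hns : ¬ ∀ p : ℕ, p.Prime → SameLevel p {u, v} := by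
    intro h
    have e := Nat.dvd_antisymm (dvd_of_sameLevel (a := u) (b := v) (by simp) (by simp) h)
      (dvd_of_sameLevel (a := v) (b := u) (by simp) (by simp) h)
    rcases Int.natAbs_eq_natAbs_iff.1 e with e | e
    · exact h1 e
    · exact h2 e
  push Not at hns
  obtain ⟨p, hp, hs⟩ := hns
  have hp2 : p ≠ 2 := by rintro rfl; exact hs ho.sameLevel_two
  obtain ⟨k, hk, hl, hup⟩ := (sameLevel_or_split hp (by simp) hM0).resolve_left hs
  obtain ⟨a, ha⟩ := Multiset.exists_mem_of_ne_zero hl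
  obtain ⟨b, hb⟩ := Multiset.exists_mem_of_ne_zero hup
  obtain ⟨ha1, ha2⟩ := mem_lower.1 ha
  obtain ⟨hb1, hb2⟩ := mem_upper.1 hb
  simp only [Multiset.insert_eq_cons, Multiset.mem_cons, Multiset.mem_singleton] at ha1 hb1
  have hku := hk u (by simp)
  have hkv := hk v (by simp)
  rcases ha1 with rfl | rfl <;> rcases hb1 with rfl | rfl
  · exact absurd hb2 ha2
  · exact mean_pairWave_sq_mul_le_aux hp hp2 hu hv hku ha2 hb2
  · simp only [mul_comm (pairWave (b * _) ^ 2)]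
    exact mean_pairWave_sq_mul_le_aux hp hp2 hv hu hkv ha2 hb2
  · exact absurd hb2 ha2

theorem nsq_ge_of_lower_twoPair (hM : Nondeg M) (hs : M.sum = 0) (hc : Even M.card)
    (h : TwoPair (lower 2 0 M)) : 7 / 3 ≤ nsq M := by
  obtain ⟨u, v, huv⟩ := h
  have hA := hM.lower 2 0
  have ho := allOdd_lower M
  rw [huv] at hA ho
  have hu := ho u (by simp)
  have hv := ho v (by simp)
  have hne : u ≠ -v := fun h => hA.2 v (by simp) (by simp [h])
  by_cases he : u = v
  · have h1 := abs_form_lower_le hM.1 hs hc hu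
    have h2 : form (lower 2 0 M) {u} = 4 / 3 := by
      have h3 : corr (-3 * u) u = -1 / 3 := NegThree.corr_eq (Or.inr rfl) (by
        simpa using odd_ne_zero hu)
      rw [huv, ← he]
      simp only [form, Multiset.insert_eq_cons, Multiset.map_cons, Multiset.map_singleton,
        Multiset.sum_cons, Multiset.sum_singleton]
      rw [corr_self (odd_ne_zero hu), h3]
      norm_num
    rw [h2] at h1
    norm_num at h1
    linarith
  have h1 := mean_abs_squareSum_le hM.1 hs hc
  have e : ∀ x, squareSum (lower 2 0 M) x = 2 * (pairWave (u * x) + pairWave (v * x)) := by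
    intro x
    rw [huv]
    simp only [squareSum, Multiset.insert_eq_cons, Multiset.map_cons, Multiset.map_singleton,
      Multiset.sum_cons, Multiset.sum_singleton, pairWave]
    push_cast
    rw [mul_assoc (-3 : ℝ), mul_assoc (-3 : ℝ)]
    ring
  have bu : BddMeas fun x => pairWave (u * x) := bddMeas_pairWave.comp_mul _
  have bv : BddMeas fun x => pairWave (v * x) := bddMeas_pairWave.comp_mul _
  have hpt : ∀ x : ℝ, (2 * (pairWave (u * x) ^ 2 + pairWave (v * x) ^ 2)) +
      ((-2) * (pairWave (u * x) ^ 2 * pairWave (v * x) ^ 2) +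
        2 * (pairWave (u * x) * pairWave (v * x))) ≤ |squareSum (lower 2 0 M) x| := by
    intro x
    rw [e]
    rcases pairWave_cases (u * x) with h | h | h <;>
      rcases pairWave_cases (v * x) with h' | h' | h' <;>
      rw [h, h'] <;> norm_num
  have h2 := mean_mono (((bu.sq.add bv.sq).const_mul 2).add
    (((bu.sq.mul bv.sq).const_mul (-2)).add ((bu.mul bv).const_mul 2)))
    (bddMeas_squareSum _).abs hpt
  rw [mean_add ((bu.sq.add bv.sq).const_mul 2)
    (((bu.sq.mul bv.sq).const_mul (-2)).add ((bu.mul bv).const_mul 2)),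
    mean_add ((bu.sq.mul bv.sq).const_mul (-2)) ((bu.mul bv).const_mul 2), mean_const_mul,
    mean_const_mul, mean_const_mul, mean_add bu.sq bv.sq, mean_pairWave_sq hu, mean_pairWave_sq hv,
    mean_pairWave_mul hu hv] at h2
  have h3 := mean_pairWave_sq_mul_le hu hv he hne
  have h4 := neg_five_eighteenths_le_form_pairs hu hv hA
  linarith

variable {C : Multiset ℤ}

/-! ### Lower bounds for lists with sum zero -/

/-- The list `M` consists of `N` and of pairs of opposite integers. -/
def CancelsTo (M N : Multiset ℤ) : Prop := ∃ R : Multiset ℤ, M = N + (R + R.map Neg.neg)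

namespace CancelsTo

theorem le (h : CancelsTo M N) : N ≤ M := by
  obtain ⟨R, rfl⟩ := h
  exact Multiset.le_add_right _ _

theorem sum_eq (h : CancelsTo M N) : M.sum = N.sum := by
  obtain ⟨R, rfl⟩ := h
  have : (R.map Neg.neg).sum = -R.sum := by
    simpa using Multiset.sum_map_neg (m := R) (f := fun a : ℤ => a)
  rw [Multiset.sum_add, Multiset.sum_add, this]; ring

theorem even_card_iff (h : CancelsTo M N) : Even M.card ↔ Even N.card := by
  obtain ⟨R, rfl⟩ := h
  rw [Multiset.card_add, Multiset.card_add, Multiset.card_map, ← two_mul]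
  simp [Nat.even_add]

theorem form_eq (h : CancelsTo M N) (K : Multiset ℤ) : form M K = form N K := by
  obtain ⟨R, rfl⟩ := h
  rw [form_add_left, form_add_left, form_neg_left]; ring

theorem nsq_eq (h : CancelsTo M N) : nsq M = nsq N := by
  rw [nsq, h.form_eq, form_comm, h.form_eq, nsq]

theorem lower (h : CancelsTo M N) (p k : ℕ) : CancelsTo (lower p k M) (lower p k N) := by
  obtain ⟨R, rfl⟩ := h
  refine ⟨FactorialRatio.lower p k R, ?_⟩
  simp only [FactorialRatio.lower, Multiset.filter_add, Multiset.filter_map, Function.comp_def,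
    dvd_neg]

theorem cons (h : CancelsTo M N) (x : ℤ) : CancelsTo (x ::ₘ M) (x ::ₘ N) := by
  obtain ⟨R, rfl⟩ := h
  exact ⟨R, (Multiset.cons_add _ _ _).symm⟩

theorem trans (h : CancelsTo M N) (h' : CancelsTo N K) : CancelsTo M K := by
  obtain ⟨R, rfl⟩ := h
  obtain ⟨S, rfl⟩ := h'
  exact ⟨S + R, by rw [Multiset.map_add]; abel⟩

end CancelsTo

theorem exists_cancelsTo_cons (hC : Nondeg C) {x : ℤ} (hx : x ≠ 0) :
    ∃ N, Nondeg N ∧ CancelsTo (x ::ₘ C) N ∧ C.card ≤ N.card + 1 := by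
  by_cases h : -x ∈ C
  · obtain ⟨N, rfl⟩ := Multiset.exists_cons_of_mem h
    refine ⟨N, hC.mono (Multiset.le_cons_self _ _), ⟨{x}, ?_⟩, by simp⟩
    rw [Multiset.map_singleton, add_comm, add_assoc, Multiset.singleton_add, Multiset.singleton_add]
  · refine ⟨x ::ₘ C, ⟨fun h0 => ?_, fun a ha hn => ?_⟩, ⟨0, by simp⟩, by simp; omega⟩
    · rcases Multiset.mem_cons.1 h0 with h0 | h0
      · exact hx h0.symm
      · exact hC.1 h0
    · rcases Multiset.mem_cons.1 ha with rfl | ha <;> rcases Multiset.mem_cons.1 hn with hn | hn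
      · omega
      · exact h hn
      · exact h (by rwa [← hn, neg_neg])
      · exact hC.2 a ha hn

theorem exists_cancelsTo (h0 : 0 ∉ M) : ∃ N, Nondeg N ∧ CancelsTo M N := by
  induction M using Multiset.induction_on with
  | empty => exact ⟨0, ⟨by simp, by simp⟩, ⟨0, by simp⟩⟩
  | cons x M ih =>
    obtain ⟨N, hN, hc⟩ := ih fun h => h0 (Multiset.mem_cons_of_mem h)
    obtain ⟨N', hN', hc', -⟩ := exists_cancelsTo_cons hN
      (x := x) fun h => h0 (by rw [h]; exact Multiset.mem_cons_self _ _)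
    exact ⟨N', hN', (hc.cons x).trans hc'⟩

theorem AllOdd.even_sum_iff (h : AllOdd M) : Even M.sum ↔ Even M.card := by
  induction M using Multiset.induction_on with
  | empty => simp
  | cons a M ih =>
    have ha := h a (Multiset.mem_cons_self _ _)
    have := ih (h.mono (Multiset.le_cons_self _ _))
    rw [Multiset.sum_cons, Multiset.card_cons, Int.even_add, Nat.even_add_one, this]
    simp [Int.not_even_iff_odd.2 ha]

theorem even_card_lower (hs : M.sum = 0) : Even (lower 2 0 M).card := by
  rw [← (allOdd_lower M).even_sum_iff]
  have h1 : Even (upper 2 0 M).sum := by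
    rw [even_iff_two_dvd]
    refine Multiset.dvd_sum fun a ha => ?_
    simpa using (mem_upper.1 ha).2
  have h2 := congrArg Multiset.sum (lower_add_upper 2 0 M)
  rw [Multiset.sum_add, hs] at h2
  rw [eq_neg_of_add_eq_zero_left h2]
  exact h1.neg

/-- A non-empty non-degenerate list with sum zero of even length has length at least four. -/
theorem four_le_card (hM : Nondeg M) (hM0 : M ≠ 0) (hs : M.sum = 0) (hc : Even M.card) :
    4 ≤ M.card := by
  have h1 := Multiset.card_pos.2 hM0
  have h2 : M.card ≠ 2 := by
    intro h
    obtain ⟨a, b, rfl⟩ := Multiset.card_eq_two.1 h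
    have : a + b = 0 := by simpa using hs
    exact hM.2 a (by simp) (by simp [eq_neg_of_add_eq_zero_right this])
  obtain ⟨m, hm⟩ := hc
  omega

theorem not_twoPair_of_sum_eq_zero (hM : Nondeg M) (hs : M.sum = 0) : ¬ TwoPair M := by
  rintro ⟨u, v, rfl⟩
  have : u + (-3 * u + (v + -3 * v)) = 0 := by simpa using hs
  exact hM.2 u (by simp) (by simp [show -u = v by linarith])

theorem form_lower_upper (h0 : AllOdd N) : form N (C.map ((2 : ℤ) * ·)) = form N C / 2 := by
  have := form_map_prime Nat.prime_two (M := N) (N := C) (k := 0)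
    (fun a ha => not_dvd_pow_one.2 (h0 a ha)) (by simp)
  push_cast at this
  exact this

/-- A non-degenerate list with sum zero of even length, with an odd entry, has norm at least
`7 / 3` unless its odd part is of the form `e, -3e`. If the odd part `A` has length two, a square
wave detects it. Otherwise its norm is at least `7 / 3`, except for two pairs in ratio `-3`.
Entries divisible by `4` leave three quarters of it. If the list is `A + 2B` with odd `A` and `B`,
its norm is the average, with weights `3 / 4` and `1 / 4`, of the norm of `A` and that of the list
of odd integers with sum zero to which `A + B + B` cancels.-/
theorem nsq_ge_of_lower_ne (hM : Nondeg M) (hs : M.sum = 0) (hc : Even M.card)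
    (hA0 : lower 2 0 M ≠ 0) (h3 : ∀ e, lower 2 0 M ≠ {e, -3 * e}) : 7 / 3 ≤ nsq M := by
  have hAc := even_card_lower hs
  have hsplit := lower_add_upper 2 0 M
  have ho := allOdd_lower M
  set A := lower 2 0 M with hA
  have hAn : Nondeg A := hM.lower 2 0
  have hc0 := Multiset.card_pos.2 hA0
  rcases Nat.lt_or_ge A.card 4 with h4 | h4
  · obtain ⟨m, hm⟩ := hAc
    obtain ⟨a, b, hab⟩ := Multiset.card_eq_two.1 (show A.card = 2 by omega)
    rw [hab] at hAn ho h3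
    have oa := ho a (by simp)
    have ob := ho b (by simp)
    have hnt : ¬ NegThree b a := by
      rintro (h | h)
      · exact h3 b (by rw [Multiset.pair_comm, h])
      · exact h3 a (by rw [h])
    have h5 := neg_fifth_le_corr ob oa (fun h => hAn.2 a (by simp) (by simp [h])) hnt
    have h6 := abs_form_lower_le hM.1 hs hc oa
    rw [← hA, hab, Multiset.insert_eq_cons, form_cons_left, form_singleton, form_singleton,
      corr_self (odd_ne_zero oa)] at h6
    linarith [le_abs_self (1 + corr b a)]
  by_cases ht : TwoPair A
  · exact nsq_ge_of_lower_twoPair hM hs hc ht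
  have hA7 := nsq_ge_of_not_twoPair hAn ho h4 ht
  by_cases hU0 : upper 2 0 M = 0
  · rw [hU0, add_zero] at hsplit
    rwa [hsplit] at hA7
  by_cases hU1 : upper 2 1 M = 0
  · obtain ⟨B, hB, -⟩ := exists_eq_map_mul Nat.prime_two (M := upper 2 0 M) (k := 0)
      fun a ha => (mem_upper.1 ha).2
    push_cast at hB
    have hBo : AllOdd B := by
      intro b hb
      have hb2 : 2 * b ∈ upper 2 0 M := by rw [hB]; exact Multiset.mem_map_of_mem _ hb
      by_contra hodd
      obtain ⟨c, hc⟩ := even_iff_two_dvd.1 (Int.not_odd_iff_even.1 hodd)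
      have : 2 * b ∈ upper 2 1 M := by
        refine mem_upper.2 ⟨(mem_upper.1 hb2).1, c, ?_⟩
        rw [hc]; push_cast; ring
      rw [hU1] at this
      exact Multiset.notMem_zero _ this
    have hB0 : 0 ∉ B := fun h => by simpa using hBo 0 h
    have hBn : Nondeg B := by
      refine ⟨hB0, fun b hb hn => (hM.upper 2 0).2 (2 * b) ?_ ?_⟩
      · rw [hB]; exact Multiset.mem_map_of_mem _ hb
      · rw [hB, ← mul_neg]; exact Multiset.mem_map_of_mem _ hn
    have hBne : B ≠ 0 := by
      rintro rfl
      exact hU0 (by rw [hB]; rfl)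
    have hnM : nsq M = nsq A + form A B + nsq B := by
      rw [← hsplit, nsq_add, hB, form_lower_upper ho, nsq_map_mul two_ne_zero]; ring
    have hnX : nsq (A + (B + B)) = nsq A + 4 * form A B + 4 * nsq B := by
      rw [nsq_add, nsq_add, form_add_right]
      simp only [nsq]; ring
    have hX0 : 0 ∉ A + (B + B) := by
      simp only [Multiset.mem_add, not_or]
      exact ⟨hAn.1, hB0, hB0⟩
    obtain ⟨X, hXn, hX⟩ := exists_cancelsTo hX0
    have hb1 := one_le_nsq hBn hBne
    by_cases hXz : X = 0
    · have h0 := hX.nsq_eq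
      rw [hXz, nsq_zero, hnX] at h0
      have hcs := form_sq_le hAn.1 hB0
      have : (nsq A - 4 * nsq B) ^ 2 ≤ 0 := by
        have e : form A B = -(nsq A + 4 * nsq B) / 4 := by linarith
        rw [e] at hcs
        nlinarith
      have : nsq A - 4 * nsq B = 0 := by
        have := le_antisymm this (sq_nonneg _)
        exact pow_eq_zero_iff two_ne_zero |>.1 this
      linarith
    · have hXo : AllOdd X := AllOdd.mono (fun a ha => by
        simp only [Multiset.mem_add] at ha
        rcases ha with h | h | h
        · exact ho a h
        · exact hBo a h
        · exact hBo a h) hX.le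
      have hXs : X.sum = 0 := by
        rw [← hX.sum_eq, Multiset.sum_add, Multiset.sum_add, ← hs, ← hsplit, Multiset.sum_add, hB,
          Multiset.sum_map_mul_left]
        simp only [Multiset.map_id']
        ring
      have hXc : Even X.card := by
        rw [← hX.even_card_iff, Multiset.card_add, Multiset.card_add]
        exact hAc.add ⟨_, rfl⟩
      have h7 := nsq_ge_of_not_twoPair hXn hXo (four_le_card hXn hXz hXs hXc)
        (not_twoPair_of_sum_eq_zero hXn hXs)
      rw [← hX.nsq_eq, hnX] at h7
      linarith
  · have h1 := nsq_ge_lower_upper_succ Nat.prime_two (k := 0) hM.1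
    have h2 := one_le_nsq (hM.upper 2 1) hU1
    norm_num at h1
    rw [← hA] at h1
    linarith

theorem corr_mul_self (k l : ℤ) {c : ℤ} (hc : c ≠ 0) : corr (k * c) (l * c) = corr k l := by
  rw [mul_comm k, mul_comm l, corr_mul_mul hc]

/-- The correlations of the list `e, -3e` with `c` and `3c` do not both come close to those of the
list `c, 3c`, which are `4 / 3`. -/
theorem ladder_bound {e c : ℤ} (he : Odd e) (hc : Odd c) :
    8 / 9 ≤ |corr e c - corr (3 * e) c - 4 / 3| ∨
      8 / 9 ≤ |corr e (3 * c) - corr (3 * e) (3 * c) - 4 / 3| := by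
  have e0 := odd_ne_zero he
  have c0 := odd_ne_zero hc
  by_contra hcon
  push Not at hcon
  obtain ⟨h1, h2⟩ := hcon
  rw [corr_mul_mul (by norm_num : (3 : ℤ) ≠ 0)] at h2
  have h2' := (abs_lt.1 h2).1
  have h1' := (abs_lt.1 h1).1
  by_cases a1 : e = c
  · subst a1
    have := corr_mul_self 1 3 e0
    rw [one_mul] at this
    rw [this, corr_self e0] at h2'
    norm_num [corr, Int.gcd] at h2'
  by_cases a2 : c = 3 * e
  · subst a2
    have t1 := corr_mul_self 1 9 e0
    have t2 := corr_mul_self 1 3 e0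
    rw [one_mul] at t1 t2
    rw [show 3 * (3 * e) = 9 * e by ring, t1, t2] at h2'
    norm_num [corr, Int.gcd] at h2'
  by_cases a3 : e = 3 * c
  · subst a3
    have t1 := corr_mul_self 3 1 c0
    have t2 := corr_mul_self 9 1 c0
    rw [one_mul] at t1 t2
    rw [show 3 * (3 * c) = 9 * c by ring, t1, t2] at h1'
    norm_num [corr, Int.gcd] at h1'
  by_cases a4 : e = -c
  · subst a4
    have t1 := corr_mul_self 3 1 c0
    rw [one_mul] at t1
    rw [mul_neg, corr_neg_left, corr_neg_left, t1, corr_self c0] at h1'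
    norm_num [corr, Int.gcd] at h1'
  have h5 := corr_le_fifth he hc a1 a2 a3
  have h6 := neg_third_le_corr he hc a4
  rcases corr_three_mul' e0 c0 with h | ⟨h, -⟩ <;> rw [h] at h2' <;> linarith

/-- A list `c, -3c` together with the double of a list `C` of length at least four, with sum zero.
Its norm is the average of the norms of `c, -2c, C` and of `-3c, 2c, C`, both of which have sum
zero. -/
theorem nsq_ge_of_lower_eq (hM : Nondeg M) (hs : M.sum = 0) (hc : Even M.card) (h6 : 6 ≤ M.card)
    {c : ℤ} (hA : lower 2 0 M = {c, -3 * c}) : 7 / 3 ≤ nsq M := by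
  have hsplit := lower_add_upper 2 0 M
  have ho := allOdd_lower M
  rw [hA] at hsplit ho
  have oc := ho c (by simp)
  have c0 := odd_ne_zero oc
  obtain ⟨C, hC, -⟩ := exists_eq_map_mul Nat.prime_two (M := upper 2 0 M) (k := 0)
    fun a ha => (mem_upper.1 ha).2
  push_cast at hC
  rw [hC] at hsplit
  have hCn : Nondeg C := by
    refine ⟨fun h => (hM.upper 2 0).1 ?_, fun b hb hn => (hM.upper 2 0).2 (2 * b) ?_ ?_⟩
    · rw [hC]; exact Multiset.mem_map.2 ⟨0, h, rfl⟩
    · rw [hC]; exact Multiset.mem_map_of_mem _ hb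
    · rw [hC, ← mul_neg]; exact Multiset.mem_map_of_mem _ hn
  have hCcard : M.card = C.card + 2 := by
    rw [← hsplit, Multiset.card_add, Multiset.card_map]; simp [add_comm]
  have hCsum : C.sum = c := by
    have := hs
    rw [← hsplit, Multiset.sum_add, Multiset.sum_map_mul_left] at this
    simp only [Multiset.map_id'] at this
    simp at this
    linarith
  have hCeven : Even C.card := by
    rw [hCcard] at hc
    exact (Nat.even_add.1 hc).2 even_two
  -- The two neighbouring lists, and the non-degenerate lists to which they cancel.
  have main : ∀ x y : ℤ, x ≠ 0 → y ≠ 0 → Odd x → Even y → x + y + c = 0 →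
      ∃ P : Multiset ℤ, (∀ z, form P {z} = form (lower 2 0 C) {z} + corr x z) ∧
        1 ≤ nsq (x ::ₘ y ::ₘ C) ∧
        (∀ z, Odd z → 3 * |form (lower 2 0 C) {z} + corr x z| ≤ nsq (x ::ₘ y ::ₘ C)) ∧
        (P = 0 ∨ (∃ e, Odd e ∧ P = {e, -3 * e}) ∨ 7 / 3 ≤ nsq (x ::ₘ y ::ₘ C)) := by
    intro x y hx hy ox ey hxy
    obtain ⟨N', hN', hc', hcard'⟩ := exists_cancelsTo_cons hCn hy
    obtain ⟨N, hN, hcN, hcard⟩ := exists_cancelsTo_cons hN' hx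
    have hcan := (hc'.cons x).trans hcN
    have hlow : lower 2 0 (x ::ₘ y ::ₘ C) = x ::ₘ lower 2 0 C := by
      have hx' : ¬ ((2 : ℕ) : ℤ) ^ (0 + 1) ∣ x := not_dvd_pow_one.2 ox
      have hy' : ¬ ¬ ((2 : ℕ) : ℤ) ^ (0 + 1) ∣ y :=
        fun h => Int.not_odd_iff_even.2 ey (not_dvd_pow_one.1 h)
      rw [lower, Multiset.filter_cons_of_pos (p := fun a => ¬ ((2 : ℕ) : ℤ) ^ (0 + 1) ∣ a) _ hx',
        Multiset.filter_cons_of_neg (p := fun a => ¬ ((2 : ℕ) : ℤ) ^ (0 + 1) ∣ a) _ hy']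
      rfl
    have hform : ∀ z, form (lower 2 0 (x ::ₘ y ::ₘ C)) {z} =
        form (lower 2 0 C) {z} + corr x z := fun z => by
      rw [hlow, form_cons_left, form_singleton, add_comm]
    have hsum : (x ::ₘ y ::ₘ C).sum = 0 := by
      rw [Multiset.sum_cons, Multiset.sum_cons, hCsum]; linarith
    have hev : Even (x ::ₘ y ::ₘ C).card := by
      rw [Multiset.card_cons, Multiset.card_cons]
      exact (Nat.even_add (n := 2)).2 ⟨fun _ => even_two, fun _ => hCeven⟩
    have h0 : 0 ∉ x ::ₘ y ::ₘ C := by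
      simp only [Multiset.mem_cons, not_or]
      exact ⟨hx.symm, hy.symm, hCn.1⟩
    have hNne : N ≠ 0 := by
      rintro rfl
      rw [Multiset.card_zero] at hcard
      omega
    refine ⟨lower 2 0 N, fun z => ?_, ?_, fun z hz => ?_, ?_⟩
    · rw [← hform, (hcan.lower 2 0).form_eq]
    · rw [hcan.nsq_eq]; exact one_le_nsq hN hNne
    · rw [← hform]; exact abs_form_lower_le h0 hsum hev hz
    · by_cases hP0 : lower 2 0 N = 0
      · exact Or.inl hP0
      by_cases hP3 : ∃ e, lower 2 0 N = {e, -3 * e}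
      · obtain ⟨e, he⟩ := hP3
        refine Or.inr (Or.inl ⟨e, odd_of_mem_lower (M := N) ?_, he⟩)
        rw [he]; simp
      · push Not at hP3
        refine Or.inr (Or.inr ?_)
        rw [hcan.nsq_eq]
        exact nsq_ge_of_lower_ne hN (hcan.sum_eq.symm.trans hsum) (hcan.even_card_iff.1 hev) hP0 hP3
  obtain ⟨P, hP, p1, pT, pcases⟩ := main c (-2 * c) c0 (by simpa using c0) oc
    (by rw [neg_mul]; exact (even_two_mul c).neg) (by ring)
  obtain ⟨Q, hQ, q1, qT, qcases⟩ := main (-3 * c) (2 * c) (by simpa using c0) (by simpa using c0)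
    ((by decide : Odd (-3 : ℤ)).mul oc) (even_two_mul c) (by ring)
  have hn3 : ∀ z, corr (-3 * c) z = -corr (3 * c) z := fun z => by rw [neg_mul, corr_neg_left]
  have havg : nsq M = (nsq (c ::ₘ -2 * c ::ₘ C) + nsq (-3 * c ::ₘ 2 * c ::ₘ C)) / 2 := by
    have e1 : ∀ x y : ℤ, x ::ₘ y ::ₘ C = {x, y} + C := fun x y => by
      simp only [Multiset.insert_eq_cons, Multiset.cons_add, Multiset.singleton_add]
    have e2 : ∀ x y : ℤ, form {x, y} C = form {x} C + form {y} C := fun x y => by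
      rw [Multiset.insert_eq_cons, form_cons_left]
    have e3 : ∀ k : ℤ, form {(-k) * c} C = -form {k * c} C := fun k => by
      have := form_neg_left {k * c} C
      rwa [Multiset.map_singleton, ← neg_mul] at this
    have t1 := corr_mul_self 1 (-2) c0
    have t2 := corr_mul_self (-3) 2 c0
    rw [one_mul] at t1
    rw [← hsplit, nsq_add, form_lower_upper ho, nsq_map_mul two_ne_zero, e1, e1, nsq_add, nsq_add,
      e2, e2, e2, e3, e3, nsq_negThree c0, nsq_pair _ _ c0 (by simpa using c0),
      nsq_pair _ _ (by simpa using c0) (by simpa using c0), t1, t2]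
    norm_num [corr, Int.gcd]
    ring
  have hcc := corr_self c0
  have hcc3 : corr (3 * c) (3 * c) = 1 := corr_self (by simpa using c0)
  have hc3 : corr c (3 * c) = 1 / 3 := by
    have := corr_mul_self 1 3 c0
    rw [one_mul] at this
    rw [this]; norm_num [corr, Int.gcd]
  have hc3' : corr (3 * c) c = 1 / 3 := by rw [corr_comm, hc3]
  have o3 : Odd (3 * c) := (by decide : Odd (3 : ℤ)).mul oc
  have hpair : ∀ e z : ℤ, form {e, -3 * e} {z} = corr e z - corr (3 * e) z := fun e z => by
    rw [Multiset.insert_eq_cons, form_cons_left, form_singleton, form_singleton, neg_mul,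
      corr_neg_left]; ring
  have hpe : ∀ e : ℤ, Odd e → form {e, -3 * e} {e} = 2 / 3 := fun e he => by
    have := corr_mul_self 3 1 (odd_ne_zero he)
    rw [one_mul] at this
    rw [hpair, corr_self (odd_ne_zero he), this]
    norm_num [corr, Int.gcd]
  have a43 : |(4 / 3 : ℝ)| = 4 / 3 := abs_of_pos (by norm_num)
  have a23 : |(2 / 3 : ℝ)| = 2 / 3 := abs_of_pos (by norm_num)
  rw [havg]
  rcases pcases with rfl | ⟨e, he, rfl⟩ | hp7
  · have h1 := hP c
    have h2 := qT c oc
    rw [form_zero_left] at h1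
    rw [hn3] at h2
    have : form (lower 2 0 C) {c} + -corr (3 * c) c = -(4 / 3) := by linarith
    rw [this, abs_neg, a43] at h2
    linarith
  · have h1 := pT e he
    rw [← hP, hpe e he, a23] at h1
    have key : ∀ z, form (lower 2 0 C) {z} + corr (-3 * c) z =
        corr e z - corr (3 * e) z - corr c z - corr (3 * c) z := fun z => by
      have := hP z
      rw [hpair] at this
      rw [hn3]; linarith
    rcases ladder_bound he oc with h | h
    · have h2 := qT c oc
      rw [key, show corr e c - corr (3 * e) c - corr c c - corr (3 * c) c =
        corr e c - corr (3 * e) c - 4 / 3 by rw [hcc, hc3']; ring] at h2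
      linarith
    · have h2 := qT (3 * c) o3
      rw [key, show corr e (3 * c) - corr (3 * e) (3 * c) - corr c (3 * c) - corr (3 * c) (3 * c) =
        corr e (3 * c) - corr (3 * e) (3 * c) - 4 / 3 by rw [hcc3, hc3]; ring] at h2
      linarith
  · rcases qcases with rfl | ⟨e, he, rfl⟩ | hq7
    · have h1 := hQ c
      have h2 := pT c oc
      rw [form_zero_left, hn3] at h1
      have : form (lower 2 0 C) {c} + corr c c = 4 / 3 := by linarith
      rw [this, a43] at h2
      linarith
    · have h1 := qT e he
      rw [← hQ, hpe e he, a23] at h1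
      have key : ∀ z, form (lower 2 0 C) {z} + corr c z =
          corr e z - corr (3 * e) z + corr (3 * c) z + corr c z := fun z => by
        have := hQ z
        rw [hpair, hn3] at this
        linarith
      have hneg : ∀ z, |corr (-e) z - corr (3 * -e) z - 4 / 3| =
          |corr e z - corr (3 * e) z + 4 / 3| := fun z => by
        rw [mul_neg, corr_neg_left, corr_neg_left, ← abs_neg]
        congr 1; ring
      rcases ladder_bound he.neg oc with h | h
      · have h2 := pT c oc
        rw [key, show corr e c - corr (3 * e) c + corr (3 * c) c + corr c c =
          corr e c - corr (3 * e) c + 4 / 3 by rw [hcc, hc3']; ring, ← hneg] at h2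
        linarith
      · have h2 := pT (3 * c) o3
        rw [key, show corr e (3 * c) - corr (3 * e) (3 * c) + corr (3 * c) (3 * c) +
            corr c (3 * c) =
          corr e (3 * c) - corr (3 * e) (3 * c) + 4 / 3 by rw [hcc3, hc3]; ring, ← hneg] at h2
        linarith
    · linarith

/-- Dividing by a power of two, one may assume that a list has an odd entry. -/
theorem exists_eq_map_two_pow (hM : Nondeg M) (hM0 : M ≠ 0) (hs : M.sum = 0) :
    ∃ N, Nondeg N ∧ N.sum = 0 ∧ N.card = M.card ∧ nsq N = nsq M ∧ lower 2 0 N ≠ 0 := by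
  obtain ⟨k, hk, hl⟩ := exists_level Nat.prime_two hM0 hM.1
  have hpow : ((2 : ℕ) : ℤ) ^ k ≠ 0 := by positivity
  have hmap : M = (M.map (· / ((2 : ℕ) : ℤ) ^ k)).map (((2 : ℕ) : ℤ) ^ k * ·) := by
    rw [Multiset.map_map]
    conv_lhs => rw [← Multiset.map_id M]
    exact Multiset.map_congr rfl fun a ha => (Int.mul_ediv_cancel' (hk a ha)).symm
  generalize M.map (· / ((2 : ℕ) : ℤ) ^ k) = N at hmap
  subst hmap
  have hmem : ∀ b ∈ N, ((2 : ℕ) : ℤ) ^ k * b ∈ N.map (((2 : ℕ) : ℤ) ^ k * ·) := fun b hb =>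
    Multiset.mem_map_of_mem _ hb
  refine ⟨N, ⟨fun h => hM.1 ?_, fun b hb hn => hM.2 _ (hmem b hb) ?_⟩, ?_, by simp,
    (nsq_map_mul hpow N).symm, fun h => ?_⟩
  · simpa using hmem 0 h
  · rw [← mul_neg]; exact hmem _ hn
  · rw [Multiset.sum_map_mul_left, Multiset.map_id'] at hs
    exact (mul_eq_zero.1 hs).resolve_left hpow
  · obtain ⟨a, ha⟩ := Multiset.exists_mem_of_ne_zero hl
    obtain ⟨ha, hnd⟩ := mem_lower.1 ha
    obtain ⟨b, hb, rfl⟩ := Multiset.mem_map.1 ha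
    have : b ∈ lower 2 0 N := mem_lower.2 ⟨hb, fun hd => hnd ?_⟩
    · rw [h] at this; exact Multiset.notMem_zero _ this
    · rw [pow_succ]; exact mul_dvd_mul_left _ (by simpa using hd)

/-- A non-empty non-degenerate list with sum zero has norm at least `2`. -/
theorem two_le_nsq (hM : Nondeg M) (hM0 : M ≠ 0) (hs : M.sum = 0) : 2 ≤ nsq M := by
  obtain ⟨N, hN, hNs, hNc, hNM, hl⟩ := exists_eq_map_two_pow hM hM0 hs
  rw [← hNM]
  rcases Nat.even_or_odd N.card with hc | hc
  · by_cases h : ∃ e, lower 2 0 N = {e, -3 * e}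
    · obtain ⟨e, he⟩ := h
      have oe : Odd e := odd_of_mem_lower (M := N) (by rw [he]; simp)
      have h1 := abs_form_lower_le hN.1 hNs hc oe
      have h2 := corr_mul_self (-3) 1 (odd_ne_zero oe)
      rw [one_mul] at h2
      rw [he, Multiset.insert_eq_cons, form_cons_left, form_singleton, form_singleton,
        corr_self (odd_ne_zero oe), h2,
        show corr (-3) 1 = -(1 / 3) by norm_num [corr, Int.gcd]] at h1
      linarith [le_abs_self (1 + -(1 / 3) : ℝ)]
    · push Not at h
      linarith [nsq_ge_of_lower_ne hN hNs hc hl h]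
  · linarith [three_le_nsq_of_odd_card hN.1 hNs hc]

/-- A non-degenerate list with sum zero of length at least five has norm at least `7 / 3`. -/
theorem seven_thirds_le_nsq (hM : Nondeg M) (h5 : 5 ≤ M.card) (hs : M.sum = 0) : 7 / 3 ≤ nsq M := by
  have hM0 : M ≠ 0 := by rintro rfl; simp at h5
  obtain ⟨N, hN, hNs, hNc, hNM, hl⟩ := exists_eq_map_two_pow hM hM0 hs
  rw [← hNM]
  rcases Nat.even_or_odd N.card with hc | hc
  · by_cases h : ∃ e, lower 2 0 N = {e, -3 * e}
    · obtain ⟨e, he⟩ := h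
      refine nsq_ge_of_lower_eq hN hNs hc ?_ he
      obtain ⟨m, hm⟩ := hc
      omega
    · push Not at h
      exact nsq_ge_of_lower_ne hN hNs hc hl h
  · linarith [three_le_nsq_of_odd_card hN.1 hNs hc]

/-! ### Passing between tuples and multisets -/

theorem form_map_univ {ι κ : Type*} [Fintype ι] [Fintype κ] (a : ι → ℤ) (b : κ → ℤ) :
    form (Finset.univ.val.map a) (Finset.univ.val.map b) = ∑ i, ∑ j, corr (a i) (b j) := by
  simp only [form, Multiset.map_map, Function.comp_def]
  rfl

theorem nsq_map_finset {ι : Type*} (S : Finset ι) (a : ι → ℤ) :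
    nsq (S.val.map a) = ∑ i ∈ S, ∑ j ∈ S, corr (a i) (a j) := by
  simp only [nsq, form, Multiset.map_map, Function.comp_def]
  rfl

theorem mem_nondegLists_iff {n : ℕ} {a : Fin n → ℤ} :
    a ∈ nondegLists n ↔ Nondeg (Finset.univ.val.map a) := by
  simp only [nondegLists, Set.mem_ofPred_eq, Nondeg, Multiset.mem_map, Finset.mem_val,
    Finset.mem_univ, true_and, not_exists]
  constructor
  · rintro ⟨h1, h2⟩
    refine ⟨h1, ?_⟩
    rintro _ ⟨i, rfl⟩ j hj
    exact h2 j i hj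
  · rintro ⟨h1, h2⟩
    exact ⟨h1, fun i j h => h2 (a j) ⟨j, rfl⟩ i h⟩

theorem exists_map_univ_eq {α : Type*} (M : Multiset α) :
    ∃ a : Fin M.card → α, Finset.univ.val.map a = M := by
  obtain ⟨l, rfl⟩ := Quot.exists_rep M
  refine ⟨l.get, ?_⟩
  change Multiset.map l.get (Finset.univ : Finset (Fin l.length)).val = (l : Multiset α)
  rw [Fin.univ_val_map, List.ofFn_get]

theorem sum_map_univ {n : ℕ} (a : Fin n → ℤ) : (Finset.univ.val.map a).sum = ∑ i, a i := rfl

theorem G_le (hM : Nondeg M) : G M.card ≤ ENNReal.ofReal (nsq M / 12) := by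
  obtain ⟨a, ha⟩ := exists_map_univ_eq M
  have hm : a ∈ nondegLists M.card := mem_nondegLists_iff.2 (by rwa [ha])
  refine (iInf₂_le a hm).trans ?_
  rw [listNorm_eq a hm.1, ha]

/-- As the space `0` is the only one of dimension `0`, every non-empty non-degenerate list with sum
zero bounds `G̃`. -/
theorem Gtilde_le (hM : Nondeg M) (hM0 : M ≠ 0) (hs : M.sum = 0) :
    Gtilde M.card ≤ ENNReal.ofReal (nsq M / 12) := by
  obtain ⟨a, ha⟩ := exists_map_univ_eq M
  have hm : a ∈ nondegLists M.card := mem_nondegLists_iff.2 (by rwa [ha])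
  refine iSup₂_le fun 𝒱 h𝒱 => ?_
  have hav : a ∈ avoiding (zeroSumLists M.card) 𝒱 := by
    refine ⟨⟨hm, ?_⟩, fun V hV hmem => ?_⟩
    · rw [← sum_map_univ, ha, hs]
    · have hV0 := Submodule.finrank_eq_zero.1 (Nat.le_zero.1 (h𝒱 V hV))
      rw [hV0, Submodule.mem_bot] at hmem
      have h0 := congrFun hmem ⟨0, Multiset.card_pos.2 hM0⟩
      exact hm.1 _ (by simpa using h0)
  refine (iInf₂_le a hav).trans ?_
  rw [listNorm_eq a hm.1, ha]

theorem le_G {n : ℕ} {c : ℝ} (h : ∀ M, Nondeg M → M.card = n → c ≤ nsq M / 12) :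
    ENNReal.ofReal c ≤ G n := by
  refine le_iInf₂ fun a ha => ENNReal.ofReal_le_ofReal ?_
  rw [listNorm_eq a ha.1]
  exact h _ (mem_nondegLists_iff.1 ha) (by simp)

theorem infNorm_avoiding_empty {n : ℕ} (L : Set (Fin n → ℤ)) : infNorm (avoiding L ∅) =
    infNorm L := by
  simp [avoiding]

theorem infNorm_le_supInfNorm {n : ℕ} (L : Set (Fin n → ℤ)) (d : ℕ) :
    infNorm L ≤ supInfNorm L d := by
  rw [← infNorm_avoiding_empty]
  exact le_iSup₂_of_le ∅ (by simp) le_rfl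

theorem le_Gtilde {n : ℕ} {c : ℝ}
    (h : ∀ M, Nondeg M → M.card = n → M.sum = 0 → c ≤ nsq M / 12) :
    ENNReal.ofReal c ≤ Gtilde n := by
  refine le_trans (le_iInf₂ fun a ha => ENNReal.ofReal_le_ofReal ?_) (infNorm_le_supInfNorm _ 0)
  rw [listNorm_eq a ha.1.1]
  exact h _ (mem_nondegLists_iff.1 ha.1) (by simp) ha.2

theorem ne_zero_of_card_eq {n : ℕ} (hn : 1 ≤ n) (h : M.card = n) : M ≠ 0 := by
  rintro rfl
  rw [Multiset.card_zero] at h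
  omega

theorem twelfth_le_G {n : ℕ} (hn : 1 ≤ n) : ENNReal.ofReal (1 / 12) ≤ G n :=
  le_G fun M hM hc => by linarith [one_le_nsq hM (ne_zero_of_card_eq hn hc)]

theorem ninth_le_G {n : ℕ} (hn : 3 ≤ n) : ENNReal.ofReal (1 / 9) ≤ G n :=
  le_G fun M hM hc => by linarith [four_thirds_le_nsq hM (hc.symm ▸ hn)]

theorem sixth_le_Gtilde {n : ℕ} (hn : 1 ≤ n) : ENNReal.ofReal (1 / 6) ≤ Gtilde n :=
  le_Gtilde fun M hM hc hs => by linarith [two_le_nsq hM (ne_zero_of_card_eq hn hc) hs]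

theorem seven_thirtysixths_le_Gtilde {n : ℕ} (hn : 5 ≤ n) : ENNReal.ofReal (7 / 36) ≤ Gtilde n :=
  le_Gtilde fun M hM hc hs => by linarith [seven_thirds_le_nsq hM (hc.symm ▸ hn) hs]

theorem G_one_le : G 1 ≤ ENNReal.ofReal (1 / 12) := by
  have h := G_le (M := {1}) ⟨by simp, by simp⟩
  rwa [nsq_singleton one_ne_zero, Multiset.card_singleton] at h

theorem G_two_le : G 2 ≤ ENNReal.ofReal (1 / 12) := by
  have h := G_le (M := {1, -2}) ⟨by simp, by simp⟩
  rw [nsq_pair _ _ (by norm_num) (by norm_num)] at h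
  norm_num [corr, Int.gcd] at h
  simpa using h

/-! ### Concatenating dilates of lists by powers of a large prime -/

theorem abs_corr_le_one (a b : ℤ) : |corr a b| ≤ 1 := by
  by_cases ha : a = 0
  · simp [corr, ha]
  by_cases hb : b = 0
  · simp [corr, hb]
  have h1 : (Int.gcd a b : ℝ) ≤ |(a : ℝ)| := by
    rw [← Int.cast_abs, ← Nat.cast_natAbs]
    exact_mod_cast Nat.le_of_dvd (Int.natAbs_pos.2 ha) (Int.gcd_dvd_natAbs_left a b)
  have h2 : (Int.gcd a b : ℝ) ≤ |(b : ℝ)| := by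
    rw [← Int.cast_abs, ← Nat.cast_natAbs]
    exact_mod_cast Nat.le_of_dvd (Int.natAbs_pos.2 hb) (Int.gcd_dvd_natAbs_right a b)
  rw [corr, abs_div, abs_mul, abs_pow, Nat.abs_cast, pow_two]
  exact div_le_one_of_le₀ (mul_le_mul h1 h2 (Nat.cast_nonneg _) (abs_nonneg _)) (by positivity)

theorem abs_corr_pow_mul_le {p : ℕ} (hp : p.Prime) {a b : ℤ} (ha : ¬ (p : ℤ) ∣ a)
    (hb : ¬ (p : ℤ) ∣ b) {i j : ℕ} (hij : i ≠ j) :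
    |corr ((p : ℤ) ^ i * a) ((p : ℤ) ^ j * b)| ≤ 1 / p := by
  have hp0 : (p : ℤ) ≠ 0 := by exact_mod_cast hp.ne_zero
  wlog h : i < j generalizing i j a b
  · rw [corr_comm]
    exact this hb ha hij.symm (by omega)
  obtain ⟨m, rfl⟩ := Nat.exists_eq_add_of_lt h
  have h1 : corr ((p : ℤ) ^ i * a) ((p : ℤ) ^ (i + m + 1) * b) =
      corr a ((p : ℤ) ^ m * b) / p := by
    rw [show (p : ℤ) ^ (i + m + 1) * b = (p : ℤ) ^ i * (p * ((p : ℤ) ^ m * b)) by ring,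
      corr_mul_mul (pow_ne_zero _ hp0)]
    exact corr_prime_mul hp (k := 0) (by simpa using ha) (by simp)
  rw [h1, abs_div, Nat.abs_cast]
  exact div_le_div_of_nonneg_right (abs_corr_le_one _ _) (Nat.cast_nonneg _)

/-- A subspace contains at most finitely many of the points `∑ⱼ Tʲ eⱼ`, unless it contains all `eⱼ`:
a functional that vanishes on it turns the condition on `T` into a non-zero polynomial equation. -/
theorem finite_setOf_sum_pow_smul_mem {E : Type*} [AddCommGroup E] [Module ℝ E]
    (V : Submodule ℝ E) {k : ℕ} (e : Fin k → E) (h : ∃ j, e j ∉ V) :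
    {T : ℕ | ∑ j : Fin k, (T : ℝ) ^ (j : ℕ) • e j ∈ V}.Finite := by
  classical
  obtain ⟨j, hj⟩ := h
  obtain ⟨f, hf, hV⟩ := Submodule.exists_le_ker_of_notMem hj
  set P : Polynomial ℝ := ∑ i : Fin k, Polynomial.monomial (i : ℕ) (f (e i)) with hP
  have hP0 : P ≠ 0 := by
    intro h0
    have := congrArg (fun Q => Polynomial.coeff Q (j : ℕ)) h0
    simp only [hP, Polynomial.finsetSum_coeff, Polynomial.coeff_monomial, Polynomial.coeff_zero,
      Fin.val_inj, Finset.sum_ite_eq', Finset.mem_univ, if_true] at this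
    exact hf this
  refine Set.Finite.subset ((P.roots.toFinset.finite_toSet).preimage
    (f := fun T : ℕ => (T : ℝ)) (Nat.cast_injective.injOn)) fun T hT => ?_
  have h1 : f (∑ j : Fin k, (T : ℝ) ^ (j : ℕ) • e j) = 0 := hV hT
  rw [Set.mem_preimage, Finset.mem_coe, Multiset.mem_toFinset, Polynomial.mem_roots hP0,
    Polynomial.IsRoot.def, hP, Polynomial.eval_finsetSum, ← h1, map_sum]
  refine Finset.sum_congr rfl fun i _ => ?_
  rw [Polynomial.eval_monomial, map_smul, smul_eq_mul, mul_comm]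

theorem exists_single_notMem {n k d : ℕ} (π : Fin n → Fin k) (hπ : Function.Surjective π)
    {b : Fin n → ℤ} (hb : ∀ i, b i ≠ 0) (hd : d < k) (V : Submodule ℝ (Fin n → ℝ))
    (hV : Module.finrank ℝ V ≤ d) :
    ∃ j, (fun i => if π i = j then (b i : ℝ) else 0) ∉ V := by
  by_contra hcon
  push Not at hcon
  let f : (Fin k → ℝ) →ₗ[ℝ] (Fin n → ℝ) :=
    { toFun := fun c i => c (π i) * b i
      map_add' := fun x y => by ext i; simp [add_mul]
      map_smul' := fun r x => by ext i; simp [mul_assoc] }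
  have hf : ∀ c, f c ∈ V := by
    intro c
    have : f c = ∑ j, c j • fun i => if π i = j then (b i : ℝ) else 0 := by
      ext i
      simp [f]
    rw [this]
    exact V.sum_mem fun j _ => V.smul_mem _ (hcon j)
  have hinj : Function.Injective (f.codRestrict V hf) := by
    intro x y hxy
    ext j
    obtain ⟨i, rfl⟩ := hπ j
    have h1 : f x i = f y i := congrFun (congrArg Subtype.val hxy) i
    exact mul_right_cancel₀ (by exact_mod_cast hb i : (b i : ℝ) ≠ 0) h1
  have := LinearMap.finrank_le_finrank_of_injective hinj
  rw [Module.finrank_fin_fun] at this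
  omega

/-- The multiset of entries of a tuple over one fibre of a map. -/
def fiber {ι κ : Type*} [Fintype ι] [DecidableEq κ] (π : ι → κ) (b : ι → ℤ) (c : κ) : Multiset ℤ :=
  (Finset.univ.filter fun i => π i = c).val.map b

section Fiber

variable {ι κ : Type*} [Fintype ι] [DecidableEq κ] (π : ι → κ) (b : ι → ℤ)

theorem fiber_le (c : κ) : fiber π b c ≤ Finset.univ.val.map b :=
  Multiset.map_le_map (Multiset.filter_le _ _)

theorem card_fiber (c : κ) : (fiber π b c).card = (Finset.univ.filter fun i => π i = c).card := by
  rw [fiber, Multiset.card_map, Finset.card_val]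

theorem mem_fiber {a : ℤ} {c : κ} : a ∈ fiber π b c ↔ ∃ i, π i = c ∧ b i = a := by
  simp only [fiber, Multiset.mem_map, Finset.mem_val, Finset.mem_filter_univ]

theorem sum_card_fiber [Fintype κ] : ∑ c, (fiber π b c).card = Fintype.card ι := by
  simp only [card_fiber]
  exact (Finset.card_eq_sum_card_fiberwise (s := Finset.univ) (t := Finset.univ)
    fun i _ => Finset.mem_univ (π i)).symm

theorem sum_nsq_fiber [Fintype κ] : ∑ c, nsq (fiber π b c) =
    ∑ i, ∑ j, if π i = π j then corr (b i) (b j) else 0 := by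
  simp only [fiber, nsq_map_finset, Finset.sum_filter]
  rw [Finset.sum_comm]
  refine Finset.sum_congr rfl fun i _ => ?_
  simp [eq_comm]

/-- If the correlations across fibres are at most `δ`, the norm is almost the sum over the fibres.
-/
theorem abs_nsq_sub_sum_nsq_fiber_le [Fintype κ] {δ : ℝ} (hδ : 0 ≤ δ)
    (h : ∀ i j, π i ≠ π j → |corr (b i) (b j)| ≤ δ) :
    |nsq (Finset.univ.val.map b) - ∑ c, nsq (fiber π b c)| ≤ (Fintype.card ι : ℝ) ^ 2 * δ := by
  rw [sum_nsq_fiber, nsq, form_map_univ, ← Finset.sum_sub_distrib]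
  have h1 : ∀ i j, |corr (b i) (b j) - if π i = π j then corr (b i) (b j) else 0| ≤ δ := by
    intro i j
    split_ifs with hij
    · simpa using hδ
    · simpa using h i j hij
  calc _ ≤ ∑ i : ι, ∑ j : ι, δ := by
        refine (Finset.abs_sum_le_sum_abs _ _).trans (Finset.sum_le_sum fun i _ => ?_)
        rw [← Finset.sum_sub_distrib]
        exact (Finset.abs_sum_le_sum_abs _ _).trans (Finset.sum_le_sum fun j _ => h1 i j)
    _ = _ := by simp; ring

end Fiber

/-- Lists can be concatenated, at almost no cost, to a list outside given subspaces of small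
dimension: dilate the `j`-th list by the `j`-th power of a large prime. -/
theorem infNorm_avoiding_le {n k d : ℕ} (π : Fin n → Fin k) (hπ : Function.Surjective π)
    {b : Fin n → ℤ} (hb : ∀ j, Nondeg (fiber π b j)) (hd : d < k)
    (𝒱 : Finset (Submodule ℝ (Fin n → ℝ))) (h𝒱 : ∀ V ∈ 𝒱, Module.finrank ℝ V ≤ d) :
    infNorm (avoiding (nondegLists n) 𝒱) ≤ ENNReal.ofReal ((∑ j, nsq (fiber π b j)) / 12) := by
  have hmem : ∀ i, b i ∈ fiber π b (π i) := fun i =>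
    (mem_fiber π b).2 ⟨i, rfl, rfl⟩
  have hb0 : ∀ i, b i ≠ 0 := fun i => (hb (π i)).ne_zero (hmem i)
  refine ENNReal.le_of_forall_pos_le_add fun ε hε _ => ?_
  -- A prime that is large, divides no entry, and avoids the roots of the polynomials.
  have hfin : (⋃ V ∈ 𝒱, {T : ℕ | ∑ j : Fin k, (T : ℝ) ^ (j : ℕ) •
      (fun i => if π i = j then (b i : ℝ) else 0) ∈ V}).Finite :=
    𝒱.finite_toSet.biUnion fun V hV => finite_setOf_sum_pow_smul_mem V _
      (exists_single_notMem π hπ hb0 hd V (h𝒱 V hV))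
  obtain ⟨B, hB⟩ := hfin.bddAbove
  obtain ⟨p, hpB, hp⟩ := Nat.exists_infinite_primes
    (B + ∑ i, (b i).natAbs + ⌈(n : ℝ) ^ 2 / (12 * (ε : ℝ))⌉₊ + 1)
  have hpb : ∀ i, ¬ (p : ℤ) ∣ b i := fun i hdvd => by
    have h1 := Nat.le_of_dvd (Int.natAbs_pos.2 (hb0 i)) (Int.natCast_dvd.1 hdvd)
    have h2 := Finset.single_le_sum (f := fun i => (b i).natAbs) (fun _ _ => Nat.zero_le _)
      (Finset.mem_univ i)
    omega
  have hp0 : (p : ℤ) ≠ 0 := by exact_mod_cast hp.ne_zero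
  have hpR : (0 : ℝ) < p := by exact_mod_cast hp.pos
  have hpε : (n : ℝ) ^ 2 * (1 / p) / 12 ≤ ε := by
    have h1 : (n : ℝ) ^ 2 / (12 * (ε : ℝ)) ≤ p := by
      refine (Nat.le_ceil _).trans (Nat.cast_le.2 ?_)
      omega
    have hε' : (0 : ℝ) < ε := hε
    rw [div_le_iff₀ (by positivity)] at h1
    rw [mul_one_div, div_div, div_le_iff₀ (by positivity)]
    linarith
  set a : Fin n → ℤ := fun i => (p : ℤ) ^ (π i : ℕ) * b i with ha
  have hfib : ∀ j, fiber π a j = (fiber π b j).map ((p : ℤ) ^ (j : ℕ) * ·) := by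
    intro j
    rw [fiber, fiber, Multiset.map_map]
    refine Multiset.map_congr rfl fun i hi => ?_
    have : π i = j := by simpa using hi
    simp [ha, this]
  have hcross : ∀ i j, π i ≠ π j → |corr (a i) (a j)| ≤ 1 / p := fun i j hij =>
    abs_corr_pow_mul_le hp (hpb i) (hpb j) fun h => hij (Fin.ext h)
  have hnd : a ∈ nondegLists n := by
    refine ⟨fun i => mul_ne_zero (pow_ne_zero _ hp0) (hb0 i), fun i j hij => ?_⟩
    by_cases h : π i = π j
    · have hij' : b i = -b j := by
        have : (p : ℤ) ^ (π i : ℕ) * b i = (p : ℤ) ^ (π i : ℕ) * -b j := by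
          rw [mul_neg, h]; rw [← h]; simpa [ha, h] using hij
        exact mul_left_cancel₀ (pow_ne_zero _ hp0) this
      refine (hb (π j)).2 _ (hmem j) ?_
      rw [← hij', ← h]; exact hmem i
    · have h1 := hcross i j h
      rw [hij, corr_neg_left, abs_neg, corr_self (by
        exact mul_ne_zero (pow_ne_zero _ hp0) (hb0 j)), abs_one, le_div_iff₀ hpR, one_mul] at h1
      have h2 : (2 : ℝ) ≤ p := by exact_mod_cast hp.two_le
      linarith
  have hav : a ∈ avoiding (nondegLists n) 𝒱 := by
    refine ⟨hnd, fun V hV hmemV => ?_⟩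
    have : p ≤ B := hB (Set.mem_biUnion hV (by
      rw [Set.mem_ofPred_eq]
      convert hmemV using 1
      ext i
      simp [ha, Finset.sum_apply]))
    omega
  refine (iInf₂_le a hav).trans ?_
  rw [listNorm_eq a hnd.1]
  have h1 := (abs_le.1 (abs_nsq_sub_sum_nsq_fiber_le π a (by positivity) hcross)).2
  have h2 : ∑ c, nsq (fiber π a c) = ∑ c, nsq (fiber π b c) :=
    Finset.sum_congr rfl fun c _ => by rw [hfib, nsq_map_mul (pow_ne_zero _ hp0)]
  rw [h2, Fintype.card_fin] at h1
  calc ENNReal.ofReal (nsq (Finset.univ.val.map a) / 12)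
      ≤ ENNReal.ofReal ((∑ j, nsq (fiber π b j)) / 12 + ε) :=
        ENNReal.ofReal_le_ofReal (by linarith)
    _ ≤ _ := ENNReal.ofReal_add_le.trans (by rw [ENNReal.ofReal_coe_nnreal])

/-! ### The upper bound for the norms outside subspaces -/

theorem exists_fiber_eq {n k : ℕ} (M : Fin k → Multiset ℤ) (h : ∑ j, (M j).card = n) :
    ∃ (π : Fin n → Fin k) (b : Fin n → ℤ), ∀ j, fiber π b j = M j := by
  set T : Multiset (Fin k × ℤ) := ∑ j, (M j).map fun a => (j, a) with hT
  have hcard : T.card = n := by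
    rw [← h, hT, Multiset.card_sum]
    exact Finset.sum_congr rfl fun j _ => Multiset.card_map _ _
  obtain ⟨f, hf⟩ : ∃ f : Fin n → Fin k × ℤ, Finset.univ.val.map f = T := by
    subst hcard; exact exists_map_univ_eq T
  refine ⟨fun i => (f i).1, fun i => (f i).2, fun j => ?_⟩
  have hfilter : ∀ s : Finset (Fin k), (∑ i ∈ s, (M i).map fun a => (i, a)).filter
      (fun x => x.1 = j) = ∑ i ∈ s, ((M i).map fun a => (i, a)).filter (fun x => x.1 = j) := by
    intro s
    induction s using Finset.induction_on with
    | empty => simp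
    | insert i s hi ih => rw [Finset.sum_insert hi, Finset.sum_insert hi, Multiset.filter_add, ih]
  have h1 : fiber (fun i => (f i).1) (fun i => (f i).2) j =
      (T.filter fun x => x.1 = j).map Prod.snd := by
    rw [← hf, Multiset.filter_map, Multiset.map_map]
    rfl
  have h2 : T.filter (fun x => x.1 = j) = (M j).map fun a => (j, a) := by
    rw [hT, hfilter, Finset.sum_eq_single j]
    · exact Multiset.filter_eq_self.2 fun x hx => by
        obtain ⟨a, -, rfl⟩ := Multiset.mem_map.1 hx; rfl
    · intro i _ hij
      refine Multiset.filter_eq_nil.2 fun x hx => ?_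
      obtain ⟨a, -, rfl⟩ := Multiset.mem_map.1 hx
      exact hij
    · simp
  rw [h1, h2, Multiset.map_map]
  simp

theorem Gd_le_sum {n d : ℕ} (ℓ : Fin (d + 1) → ℕ) (hℓ : ∀ j, 1 ≤ ℓ j) (hs : ∑ j, ℓ j = n) :
    Gd n d ≤ ∑ j, G (ℓ j) := by
  refine iSup₂_le fun 𝒱 h𝒱 => ENNReal.le_of_forall_pos_le_add fun ε hε hfin => ?_
  have hε' : (0 : ℝ≥0∞) < ε / (d + 1) := ENNReal.div_pos (by exact_mod_cast hε.ne') (by finiteness)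
  have hex : ∀ j, ∃ M : Multiset ℤ, Nondeg M ∧ M.card = ℓ j ∧
      ENNReal.ofReal (nsq M / 12) ≤ G (ℓ j) + ε / (d + 1) := by
    intro j
    have hlt : G (ℓ j) < G (ℓ j) + ε / (d + 1) :=
      ENNReal.lt_add_right ((ENNReal.sum_lt_top.1 hfin) j (Finset.mem_univ j)).ne hε'.ne'
    obtain ⟨a, hlt⟩ := iInf_lt_iff.1 hlt
    obtain ⟨ha, hlt⟩ := iInf_lt_iff.1 hlt
    refine ⟨Finset.univ.val.map a, mem_nondegLists_iff.1 ha, by simp, ?_⟩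
    rw [← listNorm_eq a ha.1]
    exact hlt.le
  choose M hM hMc hMn using hex
  obtain ⟨π, b, hπ⟩ := exists_fiber_eq (n := n) M (by simp only [hMc, hs])
  have hsurj : Function.Surjective π := by
    intro j
    have h0 : fiber π b j ≠ 0 := by
      rw [hπ]; exact ne_zero_of_card_eq (hℓ j) (hMc j)
    obtain ⟨x, hx⟩ := Multiset.exists_mem_of_ne_zero h0
    obtain ⟨i, hi, -⟩ := (mem_fiber π b).1 hx
    exact ⟨i, hi⟩
  refine (infNorm_avoiding_le π hsurj (fun j => by rw [hπ]; exact hM j) (Nat.lt_succ_self d)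
    𝒱 h𝒱).trans ?_
  rw [Finset.sum_div, ENNReal.ofReal_sum_of_nonneg fun j _ => by
    rw [hπ]; exact div_nonneg (nsq_nonneg (hM j).1) (by norm_num)]
  calc ∑ j, ENNReal.ofReal (nsq (fiber π b j) / 12) ≤ ∑ j, (G (ℓ j) + ε / (d + 1)) :=
        Finset.sum_le_sum fun j _ => by rw [hπ]; exact hMn j
    _ = _ := by
        rw [Finset.sum_add_distrib, Finset.sum_const, Finset.card_univ, Fintype.card_fin,
          nsmul_eq_mul]
        push_cast
        rw [ENNReal.mul_div_cancel (by simp) (by finiteness)]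

theorem G_add_le {k l : ℕ} (hk : 1 ≤ k) (hl : 1 ≤ l) : G (k + l) ≤ G k + G l := by
  have h := Gd_le_sum (n := k + l) (d := 1) ![k, l] (by simp [Fin.forall_fin_two, hk, hl]) (by simp)
  rw [Fin.sum_univ_two] at h
  exact (infNorm_le_supInfNorm _ 1).trans h

/-- As `G` is subadditive, merging two parts of a composition does not increase the sum. -/
theorem minCompositionSum_G_le_succ {n k : ℕ} (hk : 1 ≤ k) :
    minCompositionSum G n k ≤ minCompositionSum G n (k + 1) := by
  refine le_sInf ?_
  rintro _ ⟨ℓ, hℓ, hs, rfl⟩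
  obtain ⟨m, rfl⟩ : ∃ m, k = m + 1 := ⟨k - 1, by omega⟩
  have hmem : ∑ j, G ((Fin.cons (ℓ 0 + ℓ 1) fun i => ℓ i.succ.succ : Fin (m + 1) → ℕ) j) ∈
      compositionSums G n (m + 1) := by
    refine ⟨Fin.cons (ℓ 0 + ℓ 1) fun i => ℓ i.succ.succ, fun j => ?_, ?_, rfl⟩
    · refine Fin.cases ?_ (fun i => ?_) j
      · rw [Fin.cons_zero]; have := hℓ 0; omega
      · rw [Fin.cons_succ]; exact hℓ _
    · rw [Fin.sum_univ_succ, ← hs, Fin.sum_univ_succ (n := m + 1), Fin.sum_univ_succ (n := m)]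
      simp only [Fin.cons_zero, Fin.cons_succ]
      rw [← Fin.succ_zero_eq_one]; ring
  refine (sInf_le hmem).trans ?_
  rw [Fin.sum_univ_succ, Fin.sum_univ_succ (n := m + 1), Fin.sum_univ_succ (n := m), ← add_assoc]
  simp only [Fin.cons_zero, Fin.cons_succ]
  rw [← Fin.succ_zero_eq_one]
  exact add_le_add (G_add_le (hℓ _) (hℓ _)) le_rfl

theorem minCompositionSum_G_mono {n k l : ℕ} (hk : 1 ≤ k) (hkl : k ≤ l) :
    minCompositionSum G n k ≤ minCompositionSum G n l := by
  induction l, hkl using Nat.le_induction with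
  | base => exact le_rfl
  | succ l hl ih => exact ih.trans (minCompositionSum_G_le_succ (hk.trans hl))

theorem minCompositionSum_le_sum {κ : Type*} [Fintype κ] (F : ℕ → ℝ≥0∞) {n : ℕ} {ℓ : κ → ℕ}
    (hℓ : ∀ c, 1 ≤ ℓ c) (hs : ∑ c, ℓ c = n) :
    minCompositionSum F n (Fintype.card κ) ≤ ∑ c, F (ℓ c) := by
  let e := (Fintype.equivFin κ).symm
  exact sInf_le ⟨fun j => ℓ (e j), fun j => hℓ _, by rw [← hs]; exact e.sum_comp ℓ,
    (e.sum_comp fun c => F (ℓ c)).symm⟩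

/-! ### Splitting a list into components of correlated entries -/

section Components

variable {n : ℕ}

/-- The vectors `x` with `v i j * x i = u i j * x j` for all `i` and `j`. -/
def ratioSpace (u v : Fin n → Fin n → ℤ) : Submodule ℝ (Fin n → ℝ) where
  carrier := {x | ∀ i j, (v i j : ℝ) * x i = u i j * x j}
  add_mem' := fun hx hy i j => by
    simp only [Pi.add_apply, mul_add, hx i j, hy i j]
  zero_mem' := fun _ _ => by simp
  smul_mem' := fun c x hx i j => by
    simp only [Pi.smul_apply, smul_eq_mul]
    rw [mul_left_comm, hx i j, mul_left_comm]

/-- The vectors in which two entries have the same ratio as in `a`, whenever these entries of `a`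
have correlation at least `δ`. -/
def correlatedSpace (δ : ℝ) (a : Fin n → ℤ) : Submodule ℝ (Fin n → ℝ) where
  carrier := {x | ∀ i j, δ ≤ |corr (a i) (a j)| → (a j : ℝ) * x i = a i * x j}
  add_mem' := fun hx hy i j h => by
    simp only [Pi.add_apply, mul_add, hx i j h, hy i j h]
  zero_mem' := fun _ _ _ => by simp
  smul_mem' := fun c x hx i j h => by
    simp only [Pi.smul_apply, smul_eq_mul]
    rw [mul_left_comm, hx i j h, mul_left_comm]

theorem mem_correlatedSpace_self (δ : ℝ) (a : Fin n → ℤ) :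
    (fun i => (a i : ℝ)) ∈ correlatedSpace δ a := fun _ _ _ => mul_comm _ _

theorem natAbs_le_of_le_abs_corr {δ : ℝ} (hδ : 0 < δ) {u v : ℤ} (hu : u ≠ 0) (hv : v ≠ 0)
    (huv : Int.gcd u v = 1) (h : δ ≤ |corr u v|) : (u.natAbs : ℝ) ≤ 1 / δ := by
  rw [corr, huv, Nat.cast_one, one_pow, abs_div, abs_one, abs_mul, le_div_iff₀ (by positivity)] at h
  have h1 : (1 : ℝ) ≤ |(v : ℝ)| := by exact_mod_cast Int.one_le_abs hv
  rw [Nat.cast_natAbs, Int.cast_abs, le_div_iff₀ hδ]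
  nlinarith [mul_nonneg hδ.le (abs_nonneg (u : ℝ))]

/-- Correlated entries have a ratio of bounded height, so that only finitely many spaces arise. -/
theorem finite_range_correlatedSpace {δ : ℝ} (hδ : 0 < δ) :
    {V | ∃ a : Fin n → ℤ, (∀ i, a i ≠ 0) ∧ V = correlatedSpace δ a}.Finite := by
  classical
  set B : ℤ := ((⌈1 / δ⌉₊ : ℕ) : ℤ) with hB
  refine ((Set.finite_Icc (fun _ _ => (-B, -B) : Fin n → Fin n → ℤ × ℤ) fun _ _ => (B, B)).image
    fun w => ratioSpace (fun i j => (w i j).1) fun i j => (w i j).2).subset ?_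
  rintro _ ⟨a, ha, rfl⟩
  have hg : ∀ i j, ∃ w : ℤ × ℤ, ((-B, -B) ≤ w ∧ w ≤ (B, B)) ∧ ∀ x : Fin n → ℝ,
      (w.2 : ℝ) * x i = w.1 * x j ↔ (δ ≤ |corr (a i) (a j)| → (a j : ℝ) * x i = a i * x j) := by
    intro i j
    by_cases h : δ ≤ |corr (a i) (a j)|
    · have hg0 : Int.gcd (a i) (a j) ≠ 0 := fun h0 => ha i (Int.gcd_eq_zero_iff.1 h0).1
      obtain ⟨u, v, huv, hu, hv⟩ := Int.exists_gcd_one (Nat.pos_of_ne_zero hg0)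
      set g : ℤ := (Int.gcd (a i) (a j) : ℤ) with hgdef
      have hgz : g ≠ 0 := Int.natCast_ne_zero.2 hg0
      have hu0 : u ≠ 0 := fun h0 => ha i (by rw [hu, h0, zero_mul])
      have hv0 : v ≠ 0 := fun h0 => ha j (by rw [hv, h0, zero_mul])
      have hc : corr (a i) (a j) = corr u v := by
        rw [hu, hv, mul_comm u, mul_comm v, corr_mul_mul hgz]
      have b1 := natAbs_le_of_le_abs_corr hδ hu0 hv0 huv (hc ▸ h)
      have b2 := natAbs_le_of_le_abs_corr hδ hv0 hu0 (Int.gcd_comm v u ▸ huv)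
        (corr_comm u v ▸ hc ▸ h)
      have c1 : u.natAbs ≤ ⌈1 / δ⌉₊ := Nat.cast_le.1 (b1.trans (Nat.le_ceil _))
      have c2 : v.natAbs ≤ ⌈1 / δ⌉₊ := Nat.cast_le.1 (b2.trans (Nat.le_ceil _))
      refine ⟨(u, v), ⟨⟨?_, ?_⟩, ⟨?_, ?_⟩⟩, fun x => ?_⟩
      · dsimp only; omega
      · dsimp only; omega
      · dsimp only; omega
      · dsimp only; omega
      · have hgr : (g : ℝ) ≠ 0 := by exact_mod_cast hgz
        have hur : (a i : ℝ) = u * g := by exact_mod_cast hu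
        have hvr : (a j : ℝ) = v * g := by exact_mod_cast hv
        simp only [h, true_imp_iff]
        rw [hur, hvr]
        constructor
        · intro hx; linear_combination (g : ℝ) * hx
        · intro hx; exact mul_left_cancel₀ hgr (by linear_combination hx)
    · refine ⟨(0, 0), ⟨⟨?_, ?_⟩, ⟨?_, ?_⟩⟩, fun x => by simp [h]⟩ <;> dsimp only <;> omega
  choose w hw hwx using hg
  refine ⟨w, ⟨fun i j => (hw i j).1, fun i j => (hw i j).2⟩, ?_⟩
  ext x
  exact forall₂_congr fun i j => hwx i j x

/-- The equivalence relation generated by the pairs of indices whose entries have correlation at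
least `δ` in absolute value; its classes are the components of the list. -/
def component (δ : ℝ) (a : Fin n → ℤ) : Setoid (Fin n) :=
  Relation.EqvGen.setoid fun i j => δ ≤ |corr (a i) (a j)|

theorem eq_zero_iff_of_component {δ : ℝ} {a : Fin n → ℤ} (ha : ∀ i, a i ≠ 0) {x : Fin n → ℝ}
    (hx : x ∈ correlatedSpace δ a) {i j : Fin n}
    (h : Relation.EqvGen (fun i j => δ ≤ |corr (a i) (a j)|) i j) : x i = 0 ↔ x j = 0 := by
  induction h with
  | rel i j h =>
    have hi : (a i : ℝ) ≠ 0 := by exact_mod_cast ha i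
    have hj : (a j : ℝ) ≠ 0 := by exact_mod_cast ha j
    have := hx i j h
    constructor
    · intro h0; rw [h0, mul_zero] at this
      exact (mul_eq_zero.1 this.symm).resolve_left hi
    · intro h0; rw [h0, mul_zero] at this
      exact (mul_eq_zero.1 this).resolve_left hj
  | refl i => rfl
  | symm i j _ ih => exact ih.symm
  | trans i j k _ _ ih1 ih2 => exact ih1.trans ih2

theorem finrank_correlatedSpace_le {δ : ℝ} {a : Fin n → ℤ} (ha : ∀ i, a i ≠ 0)
    [Fintype (Quotient (component δ a))] :
    Module.finrank ℝ (correlatedSpace δ a) ≤ Fintype.card (Quotient (component δ a)) := by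
  let f : (Fin n → ℝ) →ₗ[ℝ] (Quotient (component δ a) → ℝ) := LinearMap.funLeft ℝ ℝ Quotient.out
  have hinj : Function.Injective (f ∘ₗ (correlatedSpace δ a).subtype) := by
    rw [← LinearMap.ker_eq_bot, LinearMap.ker_eq_bot']
    intro x hx
    ext i
    have h1 : x.1 (Quotient.out (Quotient.mk (component δ a) i)) = 0 := congrFun hx _
    exact (eq_zero_iff_of_component ha x.2 (Quotient.mk_out (s := component δ a) i)).1 h1
  have := LinearMap.finrank_le_finrank_of_injective hinj
  rwa [Module.finrank_fintype_fun_eq_card] at this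

/-- A list `a` of `W` outside finitely many subspaces of dimension at most `d` satisfies few linear
relations between correlated entries. -/
theorem exists_finset_submodule (W : Submodule ℝ (Fin n → ℝ)) (d : ℕ) {δ : ℝ} (hδ : 0 < δ) :
    ∃ 𝒱 : Finset (Submodule ℝ (Fin n → ℝ)), (∀ V ∈ 𝒱, Module.finrank ℝ V ≤ d) ∧
      ∀ a : Fin n → ℤ, (∀ i, a i ≠ 0) → (fun i => (a i : ℝ)) ∈ W →
        (∀ V ∈ 𝒱, (fun i => (a i : ℝ)) ∉ V) →
        d < Module.finrank ℝ (W ⊓ correlatedSpace δ a : Submodule ℝ (Fin n → ℝ)) := by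
  classical
  have hfin := (finite_range_correlatedSpace (n := n) hδ).image fun V => W ⊓ V
  refine ⟨hfin.toFinset.filter fun V => Module.finrank ℝ V ≤ d,
    fun V hV => (Finset.mem_filter.1 hV).2, fun a ha haW hav => ?_⟩
  by_contra hle
  refine hav (W ⊓ correlatedSpace δ a) (Finset.mem_filter.2 ⟨hfin.mem_toFinset.2
    ⟨_, ⟨a, ha, rfl⟩, rfl⟩, not_lt.1 hle⟩) ⟨haW, mem_correlatedSpace_self δ a⟩

/-- The sum of the bounds for the components is at most the norm, up to `n ^ 2 * δ`. -/
theorem sum_le_ofReal_listNorm_add {δ : ℝ} (hδ : 0 < δ) {a : Fin n → ℤ} (ha : a ∈ nondegLists n)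
    [Fintype (Quotient (component δ a))] [DecidableEq (Quotient (component δ a))]
    {F : ℕ → ℝ≥0∞}
    (hF : ∀ c, F (fiber (Quotient.mk (component δ a)) a c).card ≤
      ENNReal.ofReal (nsq (fiber (Quotient.mk (component δ a)) a c) / 12)) :
    ∑ c, F (fiber (Quotient.mk (component δ a)) a c).card ≤
      ENNReal.ofReal (listNorm a) + ENNReal.ofReal ((n : ℝ) ^ 2 * δ) := by
  have hcross : ∀ i j, Quotient.mk (component δ a) i ≠ Quotient.mk (component δ a) j →
      |corr (a i) (a j)| ≤ δ := fun i j hij => by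
    by_contra h
    exact hij (Quotient.sound (Relation.EqvGen.rel _ _ (not_le.1 h).le))
  have h1 := (abs_le.1 (abs_nsq_sub_sum_nsq_fiber_le _ a hδ.le hcross)).1
  have hnd : ∀ c, Nondeg (fiber (Quotient.mk (component δ a)) a c) := fun c =>
    (mem_nondegLists_iff.1 ha).mono (fiber_le _ a c)
  have h2 : 0 ≤ (n : ℝ) ^ 2 * δ := by positivity
  rw [Fintype.card_fin] at h1
  calc _ ≤ ∑ c, ENNReal.ofReal (nsq (fiber (Quotient.mk (component δ a)) a c) / 12) :=
        Finset.sum_le_sum fun c _ => hF c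
    _ = ENNReal.ofReal (∑ c, nsq (fiber (Quotient.mk (component δ a)) a c) / 12) :=
        (ENNReal.ofReal_sum_of_nonneg fun c _ =>
          div_nonneg (nsq_nonneg (hnd c).1) (by norm_num)).symm
    _ ≤ ENNReal.ofReal (listNorm a + (n : ℝ) ^ 2 * δ) := by
        refine ENNReal.ofReal_le_ofReal ?_
        rw [← Finset.sum_div, listNorm_eq a ha.1]
        linarith
    _ ≤ _ := ENNReal.ofReal_add_le

theorem one_le_card_fiber_mk (s : Setoid (Fin n)) [DecidableEq (Quotient s)] (a : Fin n → ℤ)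
    (c : Quotient s) : 1 ≤ (fiber (Quotient.mk s) a c).card := by
  rw [Nat.one_le_iff_ne_zero, Ne, Multiset.card_eq_zero]
  intro h0
  obtain ⟨i, rfl⟩ := Quotient.exists_rep c
  have : a i ∈ fiber (Quotient.mk s) a (Quotient.mk s i) := (mem_fiber _ a).2 ⟨i, rfl, rfl⟩
  rw [h0] at this
  exact Multiset.notMem_zero _ this

/-- If the components are at least `k` in number, the norm is at least the least sum of `k` values
of `G`, up to `n ^ 2 * δ`. -/
theorem minCompositionSum_G_le_of_card {δ : ℝ} (hδ : 0 < δ) {a : Fin n → ℤ} (ha : a ∈ nondegLists n)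
    [Fintype (Quotient (component δ a))] {k : ℕ} (hk : 1 ≤ k)
    (hc : k ≤ Fintype.card (Quotient (component δ a))) :
    minCompositionSum G n k ≤ ENNReal.ofReal (listNorm a) + ENNReal.ofReal ((n : ℝ) ^ 2 * δ) := by
  classical
  refine ((minCompositionSum_G_mono hk hc).trans (minCompositionSum_le_sum G
    (one_le_card_fiber_mk (component δ a) a) ?_)).trans
    (sum_le_ofReal_listNorm_add hδ ha fun c => G_le
      ((mem_nondegLists_iff.1 ha).mono (fiber_le _ a c)))
  rw [sum_card_fiber, Fintype.card_fin]

end Components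

/-! ### The norms outside subspaces in terms of components -/

theorem exists_pos_ofReal_le (n : ℕ) {ε : NNReal} (hε : 0 < ε) :
    ∃ δ : ℝ, 0 < δ ∧ ENNReal.ofReal ((n : ℝ) ^ 2 * δ) ≤ ε := by
  have hε' : (0 : ℝ) < ε := hε
  refine ⟨ε / ((n : ℝ) ^ 2 + 1), by positivity, ?_⟩
  rw [← ENNReal.ofReal_coe_nnreal]
  refine ENNReal.ofReal_le_ofReal ?_
  rw [← mul_div_assoc, div_le_iff₀ (by positivity)]
  nlinarith [sq_nonneg (n : ℝ)]

theorem Gd_eq (n d : ℕ) : Gd n d = minCompositionSum G n (d + 1) := by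
  classical
  refine le_antisymm (le_sInf ?_) ?_
  · rintro _ ⟨ℓ, hℓ, hs, rfl⟩
    exact Gd_le_sum ℓ hℓ hs
  · refine ENNReal.le_of_forall_pos_le_add fun ε hε _ => ?_
    obtain ⟨δ, hδ, hδε⟩ := exists_pos_ofReal_le n hε
    obtain ⟨𝒱, h𝒱, h⟩ := exists_finset_submodule (n := n) ⊤ d hδ
    rw [← tsub_le_iff_right]
    refine le_trans (le_iInf₂ fun a ha => ?_) (le_iSup₂_of_le 𝒱 h𝒱 le_rfl)
    have h1 := h a ha.1.1 Submodule.mem_top ha.2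
    rw [top_inf_eq] at h1
    rw [tsub_le_iff_right]
    exact (minCompositionSum_G_le_of_card hδ ha.1 (by omega)
      (h1.trans_le (finrank_correlatedSpace_le ha.1.1))).trans (by gcongr)

/-- The vectors whose entries sum to zero. -/
def sumZero (n : ℕ) : Submodule ℝ (Fin n → ℝ) := LinearMap.ker (∑ i, LinearMap.proj i)

theorem mem_sumZero {n : ℕ} {x : Fin n → ℝ} : x ∈ sumZero n ↔ ∑ i, x i = 0 := by
  simp [sumZero, LinearMap.mem_ker, LinearMap.sum_apply]

/-- If all relations between correlated entries imply that the sum is zero, then every component has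
sum zero, as it satisfies these relations. -/
theorem sum_fiber_eq_zero {n : ℕ} {δ : ℝ} {a : Fin n → ℤ}
    [DecidableEq (Quotient (component δ a))] (h : correlatedSpace δ a ≤ sumZero n)
    (c : Quotient (component δ a)) : (fiber (Quotient.mk (component δ a)) a c).sum = 0 := by
  have hx : (fun i => if Quotient.mk (component δ a) i = c then (a i : ℝ) else 0) ∈
      correlatedSpace δ a := by
    intro i j hij
    have : Quotient.mk (component δ a) i = Quotient.mk (component δ a) j :=
      Quotient.sound (Relation.EqvGen.rel _ _ hij)
    simp only [this]
    split_ifs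
    · exact mul_comm _ _
    · simp
  have h0 := mem_sumZero.1 (h hx)
  rw [← Finset.sum_filter] at h0
  exact_mod_cast h0

/-- The lower bound for `G̃(n; d)`: either there are at least `d + 2` components, or there are
`d + 1` components with sum zero. -/
theorem min_le_GtildeD (n d : ℕ) :
    min (Gd n (d + 1)) (minCompositionSum Gtilde n (d + 1)) ≤ GtildeD n d := by
  classical
  refine ENNReal.le_of_forall_pos_le_add fun ε hε _ => ?_
  obtain ⟨δ, hδ, hδε⟩ := exists_pos_ofReal_le n hε
  obtain ⟨𝒱, h𝒱, h⟩ := exists_finset_submodule (sumZero n) d hδ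
  rw [← tsub_le_iff_right]
  refine le_trans (le_iInf₂ fun a ha => ?_) (le_iSup₂_of_le 𝒱 h𝒱 le_rfl)
  have hnd := ha.1.1
  have hsum : (fun i => (a i : ℝ)) ∈ sumZero n := mem_sumZero.2 (by exact_mod_cast ha.1.2)
  have h1 := h a hnd.1 hsum ha.2
  have h2 := finrank_correlatedSpace_le (δ := δ) hnd.1
  rw [tsub_le_iff_right]
  refine le_trans ?_ (add_le_add_right hδε _)
  rcases Nat.lt_or_ge (d + 1) (Fintype.card (Quotient (component δ a))) with hc | hc
  · refine (min_le_left _ _).trans ?_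
    rw [Gd_eq]
    exact minCompositionSum_G_le_of_card hδ hnd (by omega) hc
  · have heq : sumZero n ⊓ correlatedSpace δ a = correlatedSpace δ a :=
      Submodule.eq_of_le_of_finrank_le inf_le_right (by omega)
    have hcard : Fintype.card (Quotient (component δ a)) = d + 1 := by
      rw [heq] at h1; omega
    refine (min_le_right _ _).trans ?_
    rw [← hcard]
    refine (minCompositionSum_le_sum Gtilde (one_le_card_fiber_mk (component δ a) a) ?_).trans
      (sum_le_ofReal_listNorm_add hδ hnd fun c => Gtilde_le
        ((mem_nondegLists_iff.1 hnd).mono (fiber_le _ a c))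
        (ne_zero_of_card_eq (one_le_card_fiber_mk _ a c) rfl)
        (sum_fiber_eq_zero (inf_eq_right.1 heq) c))
    rw [sum_card_fiber, Fintype.card_fin]

/-! ### Explicit values -/

theorem mul_ofReal_le_minCompositionSum {F : ℕ → ℝ≥0∞} {n k : ℕ} {c : ℝ}
    (h : ∀ l, 1 ≤ l → ENNReal.ofReal c ≤ F l) :
    ENNReal.ofReal (k * c) ≤ minCompositionSum F n k := by
  refine le_sInf ?_
  rintro _ ⟨ℓ, hℓ, hs, rfl⟩
  calc ENNReal.ofReal (k * c) = ∑ _j : Fin k, ENNReal.ofReal c := by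
        rw [ENNReal.ofReal_mul (Nat.cast_nonneg _)]; simp
    _ ≤ _ := Finset.sum_le_sum fun j _ => h _ (hℓ j)

/-- A composition of a large number has a large part. -/
theorem add_ofReal_le_minCompositionSum {F : ℕ → ℝ≥0∞} {n k m : ℕ} {c c' : ℝ} (hc : 0 ≤ c)
    (hc' : 0 ≤ c') (h : ∀ l, 1 ≤ l → ENNReal.ofReal c ≤ F l)
    (h' : ∀ l, m < l → ENNReal.ofReal c' ≤ F l) (hn : m * (k + 1) < n) :
    ENNReal.ofReal (k * c + c') ≤ minCompositionSum F n (k + 1) := by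
  refine le_sInf ?_
  rintro _ ⟨ℓ, hℓ, hs, rfl⟩
  obtain ⟨j, hj⟩ : ∃ j, m < ℓ j := by
    by_contra hcon
    push Not at hcon
    have := Finset.sum_le_sum (s := Finset.univ) fun j _ => hcon j
    rw [hs, Finset.sum_const, Finset.card_univ, Fintype.card_fin, smul_eq_mul, mul_comm] at this
    omega
  rw [← Finset.sum_erase_add _ _ (Finset.mem_univ j),
    ENNReal.ofReal_add (mul_nonneg (Nat.cast_nonneg _) hc) hc']
  refine add_le_add ?_ (h' _ hj)
  calc ENNReal.ofReal (k * c) = ∑ _i ∈ Finset.univ.erase j, ENNReal.ofReal c := by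
        rw [ENNReal.ofReal_mul (Nat.cast_nonneg _), Finset.sum_const,
          Finset.card_erase_of_mem (Finset.mem_univ j)]
        simp
    _ ≤ _ := Finset.sum_le_sum fun i _ => h _ (hℓ i)

theorem minCompositionSum_G_le {n k : ℕ} (h1 : k ≤ n) (h2 : n ≤ 2 * k) :
    minCompositionSum G n k ≤ ENNReal.ofReal (k * (1 / 12)) := by
  have h3 : ∀ j, (if j < n - k then 2 else 1) = 1 + if j < n - k then 1 else 0 := fun j => by
    split_ifs <;> rfl
  have hsum : ∑ j : Fin k, (if (j : ℕ) < n - k then 2 else 1) = n := by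
    rw [Fin.sum_univ_eq_sum_range (fun j => if j < n - k then 2 else 1) k]
    simp only [h3]
    rw [Finset.sum_add_distrib, ← Finset.sum_filter, Finset.sum_const, Finset.sum_const,
      Finset.card_range, show (Finset.range k).filter (fun j => j < n - k) = Finset.range (n - k) by
        ext j; simp only [Finset.mem_filter, Finset.mem_range]; omega, Finset.card_range]
    simp only [smul_eq_mul]; omega
  have hmem : ∑ j : Fin k, G (if (j : ℕ) < n - k then 2 else 1) ∈ compositionSums G n k :=
    ⟨fun j => if (j : ℕ) < n - k then 2 else 1, fun j => by beta_reduce; split_ifs <;> norm_num,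
      hsum, rfl⟩
  refine (sInf_le hmem).trans ?_
  calc _ ≤ ∑ _j : Fin k, ENNReal.ofReal (1 / 12) := Finset.sum_le_sum fun j _ => by
        split_ifs
        · exact G_two_le
        · exact G_one_le
    _ = _ := by rw [ENNReal.ofReal_mul (Nat.cast_nonneg _)]; simp

theorem Gd_eq_of_le {n d : ℕ} (h1 : d + 1 ≤ n) (h2 : n ≤ 2 * d + 2) :
    Gd n d = ENNReal.ofReal ((d + 1) / 12) := by
  rw [Gd_eq]
  refine le_antisymm ((minCompositionSum_G_le h1 (by omega)).trans_eq ?_)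
    (le_trans (le_of_eq ?_) (mul_ofReal_le_minCompositionSum (c := 1 / 12)
      fun l hl => twelfth_le_G hl))
  all_goals push_cast; ring_nf

theorem le_Gd {n d : ℕ} (h : 2 * d + 3 ≤ n) : ENNReal.ofReal (d / 12 + 1 / 9) ≤ Gd n d := by
  rw [Gd_eq]
  refine le_trans (le_of_eq ?_) (add_ofReal_le_minCompositionSum (m := 2)
    (c := 1 / 12) (c' := 1 / 9) (by norm_num) (by norm_num) (fun l hl => twelfth_le_G hl)
    (fun l hl => ninth_le_G hl) (by omega))
  ring_nf

theorem le_GtildeD_of_le {n d : ℕ} (h1 : d + 2 ≤ n) (h2 : n ≤ 2 * d + 4) :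
    ENNReal.ofReal ((d + 2) / 12) ≤ GtildeD n d := by
  refine le_trans (le_min ?_ ?_) (min_le_GtildeD n d)
  · rw [Gd_eq_of_le (by omega) (by omega)]
    push_cast
    exact ENNReal.ofReal_le_ofReal (by linarith)
  · refine le_trans (ENNReal.ofReal_le_ofReal ?_) (mul_ofReal_le_minCompositionSum (c := 1 / 6)
      fun l hl => sixth_le_Gtilde hl)
    push_cast
    linarith [Nat.cast_nonneg (α := ℝ) d]

theorem le_GtildeD {n d : ℕ} (h : 2 * d + 5 ≤ n) :
    ENNReal.ofReal (d / 12 + 7 / 36) ≤ GtildeD n d := by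
  refine le_trans (le_min ?_ ?_) (min_le_GtildeD n d)
  · refine le_trans (ENNReal.ofReal_le_ofReal ?_) (le_Gd (by omega))
    push_cast
    linarith
  · rcases Nat.eq_zero_or_pos d with rfl | hd
    · refine le_trans (ENNReal.ofReal_le_ofReal ?_) (add_ofReal_le_minCompositionSum (m := 4)
        (c := 1 / 6) (c' := 7 / 36) (by norm_num) (by norm_num) (fun l hl => sixth_le_Gtilde hl)
        (fun l hl => seven_thirtysixths_le_Gtilde hl) (by omega))
      norm_num
    · refine le_trans (ENNReal.ofReal_le_ofReal ?_) (mul_ofReal_le_minCompositionSum (c := 1 / 6)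
        fun l hl => sixth_le_Gtilde hl)
      have : (1 : ℝ) ≤ d := by exact_mod_cast hd
      push_cast
      linarith

end FactorialRatio

theorem theorem1p3 (n d : ℕ) :
    (d + 1 ≤ n →
      FactorialRatio.Gd n d = FactorialRatio.minCompositionSum FactorialRatio.G n (d + 1)) ∧
    (d + 2 ≤ n →
      min (FactorialRatio.Gd n (d + 1))
          (FactorialRatio.minCompositionSum FactorialRatio.Gtilde n (d + 1))
        ≤ FactorialRatio.GtildeD n d) ∧
    (d + 1 ≤ n → n ≤ 2 * d + 2 → FactorialRatio.Gd n d = ((d : ℝ≥0∞) + 1) / 12) ∧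
    (2 * d + 3 ≤ n → (d : ℝ≥0∞) / 12 + 1 / 9 ≤ FactorialRatio.Gd n d) ∧
    (d + 2 ≤ n → n ≤ 2 * d + 4 → ((d : ℝ≥0∞) + 2) / 12 ≤ FactorialRatio.GtildeD n d) ∧
    (2 * d + 5 ≤ n → (d : ℝ≥0∞) / 12 + 7 / 36 ≤ FactorialRatio.GtildeD n d) := by
  have hdiv : ∀ (x y : ℝ≥0∞) (a b : ℝ), 0 < b → ENNReal.ofReal a = x → ENNReal.ofReal b = y →
      ENNReal.ofReal (a / b) = x / y := fun x y a b hb hx hy => by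
    rw [ENNReal.ofReal_div_of_pos hb, hx, hy]
  have hd0 : (0 : ℝ) ≤ d := Nat.cast_nonneg d
  have hd : ENNReal.ofReal (d / 12) = (d : ℝ≥0∞) / 12 :=
    hdiv _ _ _ _ (by norm_num) (by simp) (by simp)
  refine ⟨fun _ => FactorialRatio.Gd_eq n d, fun _ => FactorialRatio.min_le_GtildeD n d,
    fun h1 h2 => ?_, fun h => ?_, fun h1 h2 => ?_, fun h => ?_⟩
  · rw [FactorialRatio.Gd_eq_of_le h1 h2]
    exact hdiv _ _ _ _ (by norm_num) (by rw [ENNReal.ofReal_add hd0 (by norm_num)]; simp) (by simp)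
  · refine le_of_eq_of_le ?_ (FactorialRatio.le_Gd h)
    rw [ENNReal.ofReal_add (by positivity) (by norm_num), hd,
      hdiv 1 9 1 9 (by norm_num) (by simp) (by simp)]
  · refine le_of_eq_of_le ?_ (FactorialRatio.le_GtildeD_of_le h1 h2)
    exact (hdiv _ _ _ _ (by norm_num) (by rw [ENNReal.ofReal_add hd0 (by norm_num)]; simp)
      (by simp)).symm
  · refine le_of_eq_of_le ?_ (FactorialRatio.le_GtildeD h)
    rw [ENNReal.ofReal_add (by positivity) (by norm_num), hd,
      hdiv 7 36 7 36 (by norm_num) (by simp) (by simp)]
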